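/- For $u\in\mathbb R$ and $x>0$ let $K_{\mathrm i u}(x)=\int_0^\infty e^{-x\cosh w}\cos(uw)\,\mathrm dw$ be the modified Bessel function of imaginary index, and let $$p_t(x,y)=\frac{2}{\pi}\int_0^\infty e^{-tu^2}K_{\mathrm i u}(e^x)K_{\mathrm i u}(e^y)\,\frac{\mathrm du}{|\Gamma(\mathrm i u)|^2},\qquad t>0,\ x,y\in\mathbb R,$$ be the Yakubovich heat kernel. Fix $\tau>0$ and $a,c\in\mathbb R$ with $a+c>0$. Then the normalizing constant $$C^{\tau}_{a,c}=\int_{\mathbb R}\int_{\mathbb R}e^{ax+cy}p_\tau(x,y)\,\mathrm dx\,\mathrm dy$$ is finite (the integrand is integrable on $\mathbb R^2$) and strictly positive, and there exists a real-valued Markov process $(Y_t)_{t\in[0,\tau]}$ such that for every $d\ge 0$ and all $0=t_0<t_1<\dots<t_d<t_{d+1}=\tau$ the random vector $(Y_{t_0},\dots,Y_{t_{d+1}})$ has the density $$f(x_0,\dots,x_{d+1})=\frac{1}{C^{\tau}_{a,c}}\,e^{c x_0+a x_{d+1}}\prod_{k=1}^{d+1}p_{t_k-t_{k-1}}(x_{k-1},x_k)$$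 with respect to Lebesgue measure on $\mathbb R^{d+2}$. -/

import Mathlib

open MeasureTheory Set

namespace Yakubovich

noncomputable section

/-- The modified Bessel function `K_{iu}(x) = ∫_0^∞ e^{-x cosh w} cos(u w) dw`
of purely imaginary index `iu`, used for `u ∈ ℝ` and `x > 0`. -/
def besselK (u x : ℝ) : ℝ :=
  ∫ w in Ioi (0 : ℝ), Real.exp (-x * Real.cosh w) * Real.cos (u * w)

/-- The measure `μ(du) = (2/π) du / |Γ(iu)|²` on `(0,∞)`. -/
def spectralMeasure : Measure ℝ :=
  (volume.restrict (Ioi (0 : ℝ))).withDensity fun u =>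
    ENNReal.ofReal (2 / Real.pi / ‖Complex.Gamma (Complex.I * u)‖ ^ 2)

/-- The Yakubovich heat kernel
`p_t(x,y) = ∫_0^∞ e^{-t u²} K_{iu}(e^x) K_{iu}(e^y) μ(du)`, used for `t > 0` and `x, y ∈ ℝ`. -/
def heatKernel (t x y : ℝ) : ℝ :=
  ∫ u, Real.exp (-t * u ^ 2) * besselK u (Real.exp x) * besselK u (Real.exp y) ∂spectralMeasure

/-- The normalizing constant `C = ∫_ℝ ∫_ℝ e^{a x + c y} p_τ(x,y) dx dy`. -/
def normConst (τ a c : ℝ) : ℝ :=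
  ∫ y : ℝ, ∫ x : ℝ, Real.exp (a * x + c * y) * heatKernel τ x y

/-- The function `f_t(x) = C⁻¹ e^{c x_0 + a x_{d+1}} ∏_{k=1}^{d+1} p_{t_k - t_{k-1}}(x_{k-1}, x_k)`
of `x = (x_0, …, x_{d+1})`, for times `t = (t_0, …, t_{d+1})`. -/
def jointDensity (τ a c : ℝ) {d : ℕ} (t x : Fin (d + 2) → ℝ) : ℝ :=
  1 / normConst τ a c * Real.exp (c * x 0 + a * x (Fin.last (d + 1))) *
    ∏ k : Fin (d + 1),
      heatKernel (t k.succ - t k.castSucc) (x k.castSucc) (x k.succ)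

/-- The measure `ν` has the nonnegative measurable real function `f` as its density
with respect to Lebesgue measure. -/
structure HasDensity {n : ℕ} (ν : Measure (Fin n → ℝ)) (f : (Fin n → ℝ) → ℝ) : Prop where
  measurable : Measurable f
  nonneg : ∀ x, 0 ≤ f x
  eq_withDensity : ν = volume.withDensity fun x => ENNReal.ofReal (f x)

/-- A real-valued process `Y` on a probability space is a Markov process: each `Y t` is a random
variable and, for `s ≤ t`, conditioning an event `{Y t ∈ B}` on the past `σ(Y r : r ≤ s)` is the
same as conditioning it on the present `σ(Y s)`. -/
structure IsMarkovProcess {T Ω : Type*} [LinearOrder T] [MeasurableSpace Ω]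
    (Y : T → Ω → ℝ) (P : Measure Ω) [IsProbabilityMeasure P] : Prop where
  measurable : ∀ t, Measurable (Y t)
  markov : ∀ s t, s ≤ t → ∀ B : Set ℝ, MeasurableSet B →
    P[(Y t ⁻¹' B).indicator (fun _ => (1 : ℝ)) |
        ⨆ r, ⨆ _ : r ≤ s, MeasurableSpace.comap (Y r) inferInstance]
      =ᵐ[P] P[(Y t ⁻¹' B).indicator (fun _ => (1 : ℝ)) |
        MeasurableSpace.comap (Y s) inferInstance]


lemma norm_sq_Gamma_I_mul {u : ℝ} (hu : 0 < u) :
    2 / Real.pi / ‖Complex.Gamma (Complex.I * u)‖ ^ 2 =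
      2 / Real.pi ^ 2 * u * Real.sinh (Real.pi * u) := by
  have h := Complex.Gamma_mul_Gamma_one_sub (Complex.I * u)
  have h0 : (-(Complex.I * u) : ℂ) ≠ 0 := by
    simp [hu.ne']
  have h1 := Complex.Gamma_add_one _ h0
  rw [show (1 - Complex.I * u : ℂ) = -(Complex.I * u) + 1 by ring, h1] at h
  have h2 : Complex.Gamma (-(Complex.I * u)) =
      (starRingEnd ℂ) (Complex.Gamma (Complex.I * u)) := by
    rw [← Complex.Gamma_conj]; simp
  rw [h2] at h
  have h3 : Complex.sin (Real.pi * (Complex.I * u)) =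
      (Real.sinh (Real.pi * u) : ℝ) * Complex.I := by
    rw [show (Real.pi * (Complex.I * u) : ℂ) = ((Real.pi * u : ℝ) : ℂ) * Complex.I by
      push_cast; ring, Complex.sin_mul_I, Complex.ofReal_sinh]
  have hs : 0 < Real.sinh (Real.pi * u) := Real.sinh_pos_iff.2 (by positivity)
  have h4 := congrArg norm h
  rw [h3] at h4
  simp only [norm_mul, norm_neg, norm_div, Complex.norm_I, Complex.norm_real, RCLike.norm_conj,
    Real.norm_eq_abs, abs_of_pos hu, abs_of_pos hs, abs_of_pos Real.pi_pos] at h4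
  have hg : ‖Complex.Gamma (Complex.I * u)‖ ^ 2 = Real.pi / (u * Real.sinh (Real.pi * u)) := by
    field_simp at h4 ⊢
    linarith
  rw [hg]
  have := Real.pi_pos
  field_simp

/-- The integral defining `K_{iu}(x)` converges absolutely. -/
lemma integrableOn_besselK (u : ℝ) {x : ℝ} (hx : 0 < x) :
    IntegrableOn (fun w => Real.exp (-x * Real.cosh w) * Real.cos (u * w)) (Ioi 0) := by
  refine Integrable.mono' (integrableOn_exp_mul_Ioi (a := -(x / 2)) (by linarith) 0)
    (by fun_prop) ?_
  refine (ae_restrict_iff' measurableSet_Ioi).2 (.of_forall fun w _ => ?_)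
  rw [norm_mul, Real.norm_eq_abs, Real.norm_eq_abs, abs_of_pos (Real.exp_pos _)]
  have h1 : w / 2 ≤ Real.cosh w := by
    rw [Real.cosh_eq]
    have := Real.add_one_le_exp w
    have := Real.exp_pos (-w)
    linarith
  calc _ ≤ Real.exp (-x * Real.cosh w) * 1 := by
        gcongr; exact Real.abs_cos_le_one _
    _ ≤ _ := by
        rw [mul_one]
        apply Real.exp_le_exp.2
        nlinarith

lemma abs_besselK_le (u : ℝ) {x : ℝ} (hx : 0 < x) : |besselK u x| ≤ besselK 0 x := by
  unfold besselK
  rw [← Real.norm_eq_abs]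
  refine norm_integral_le_of_norm_le (integrableOn_besselK 0 hx) (.of_forall fun w => ?_)
  rw [norm_mul, Real.norm_eq_abs, Real.norm_eq_abs, abs_of_pos (Real.exp_pos _)]
  simp only [zero_mul, Real.cos_zero]
  gcongr; exact Real.abs_cos_le_one _

/-- The integral defining `p_t(x,y)` converges absolutely for `t > 0`. -/
lemma integrable_heatKernel {t : ℝ} (ht : 0 < t) (x y : ℝ) :
    Integrable (fun u => Real.exp (-t * u ^ 2) * besselK u (Real.exp x) *
      besselK u (Real.exp y)) spectralMeasure := by
  have hm : ∀ z : ℝ, Measurable fun u => besselK u z := fun z =>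
    (StronglyMeasurable.integral_prod_right (f := fun u w : ℝ =>
      Real.exp (-z * Real.cosh w) * Real.cos (u * w))
      (by apply Continuous.stronglyMeasurable; unfold Function.uncurry; fun_prop)).measurable
  have hG : Measurable fun u : ℝ => Complex.Gamma (Complex.I * u) := by
    have : (fun u : ℝ => Complex.Gamma (Complex.I * u)) =
        fun u : ℝ => (Complex.Gamma (Complex.I * u + 1)) / (Complex.I * u) := by
      ext u
      by_cases hu : u = 0
      · simp [hu]
      · rw [Complex.Gamma_add_one _ (by simp [hu])]
        have hu' : (u : ℂ) ≠ 0 := by exact_mod_cast hu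
        field_simp
    rw [this]
    refine Measurable.div (Continuous.measurable ?_) (by fun_prop)
    refine continuous_iff_continuousAt.2 fun u => ?_
    refine ContinuousAt.comp (f := fun u : ℝ => (Complex.I * u + 1 : ℂ))
      (Complex.differentiableAt_Gamma _ fun m h => ?_).continuousAt (by fun_prop)
    have := congrArg Complex.re h
    simp at this
    linarith [(Nat.cast_nonneg m : (0 : ℝ) ≤ m)]
  unfold spectralMeasure
  rw [integrable_withDensity_iff_integrable_smul' (by fun_prop) (by simp)]
  have hb : Integrable fun u : ℝ => Real.exp (-t * u ^ 2 + (Real.pi + 1) * u) := by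
    have h := (integrable_exp_neg_mul_sq ht).comp_sub_right ((Real.pi + 1) / (2 * t))
    have h' := h.const_mul (Real.exp ((Real.pi + 1) ^ 2 / (4 * t)))
    refine h'.congr (.of_forall fun u => ?_)
    simp only
    rw [← Real.exp_add]
    congr 1
    field_simp
    ring
  refine Integrable.mono' ((hb.const_mul
    (besselK 0 (Real.exp x) * besselK 0 (Real.exp y))).restrict (s := Ioi 0)) ?_ ?_
  · have := hm (Real.exp x)
    have := hm (Real.exp y)
    apply Measurable.aestronglyMeasurable
    fun_prop
  refine (ae_restrict_iff' measurableSet_Ioi).2 (.of_forall fun u hu => ?_)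
  have hu : 0 < u := hu
  rw [ENNReal.toReal_ofReal (by positivity), norm_sq_Gamma_I_mul hu, smul_eq_mul, norm_mul]
  have hs : 0 < Real.sinh (Real.pi * u) := Real.sinh_pos_iff.2 (by positivity)
  rw [Real.norm_of_nonneg (by positivity), norm_mul, norm_mul, Real.norm_eq_abs,
    Real.norm_eq_abs, Real.norm_eq_abs, Real.abs_exp, Real.exp_add]
  have h1 := abs_besselK_le u (Real.exp_pos x)
  have h2 := abs_besselK_le u (Real.exp_pos y)
  have h0 := (abs_nonneg _).trans h1
  have h3 : 2 / Real.pi ^ 2 * u * Real.sinh (Real.pi * u) ≤ Real.exp ((Real.pi + 1) * u) := by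
    have hp : 2 / Real.pi ^ 2 ≤ 1 := by
      rw [div_le_one (by positivity)]; nlinarith [Real.pi_gt_three]
    have hsi : Real.sinh (Real.pi * u) ≤ Real.exp (Real.pi * u) := by
      rw [Real.sinh_eq]
      linarith [Real.exp_pos (Real.pi * u), Real.exp_pos (-(Real.pi * u))]
    have hue : u ≤ Real.exp u := by linarith [Real.add_one_le_exp u]
    calc _ ≤ 1 * Real.exp u * Real.exp (Real.pi * u) := by gcongr
      _ = _ := by rw [one_mul, ← Real.exp_add]; ring_nf
  calc _ ≤ Real.exp ((Real.pi + 1) * u) * (Real.exp (-t * u ^ 2) *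
        besselK 0 (Real.exp x) * besselK 0 (Real.exp y)) := by gcongr
    _ = _ := by ring

end

end Yakubovich

/-!
Two facts about the kernel `p_t` carry the theorem: it is a symmetric nonnegative semigroup, and it
is dominated by a Gaussian. Neither is visible from the oscillating spectral integral.

**Positivity and domination.** Macdonald's product formula
`K_{iu}(e^a) K_{iu}(e^b) = ∫ tri a b c K_{iu}(e^c) dc` (`integral_tri_mul_besselK`) has the positive
symmetric kernel `tri`. Its inversion, `∫ K_{iu}(e^a) K_{iu}(e^b) K_{iu}(e^c) μ(du) = tri a b c`
(`integral_besselK_mul_besselK_mul_besselK`), is obtained without the theory of the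
Kontorovich–Lebedev transform: `e^{θu} K_{iu}(x)` is the Fourier transform of
`w ↦ exp (-x cosh (w + iθ)) / 2` for `|θ| < π / 2`, Parseval's identity evaluates the integral of the
triple product with the weight `u e^{(θ + π/2) u}`, and as `θ → π / 2` this weight becomes `u e^{πu}`
and the exponent becomes purely imaginary, which leaves an ordinary Fourier inversion in `sinh w`.

So the spectral multiplier `stepChar a u = K_{iu}(e^a) / K_0(e^a)` has the positive kernel
`stepKernel a`, which is dominated pointwise by the convolution kernel of the probability density
`stepDensity a` on the line, whose characteristic function is the same `stepChar a`. Domination by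
the free kernel with the same multiplier, nonnegativity, and the eigenfunction relation for `K_{iv}`
(`IsDominated`) survive composition with a step kernel and dominated limits. Powers of `stepChar`
converge to `e^{-tu²}` by the central limit theorem (`tendsto_stepChar_pow`), and the exponential
moments of the steps stay bounded (`stepMoment_le`), so `e^{-tu²}` is in the class
(`isDominated_exp_neg_mul_sq`): `0 ≤ p_t(x, y)`, `p_t(x, y)` is at most the Gaussian density of
variance `2t` at `x - y`, and `∫ p_t(x, z) K_{iv}(e^z) dz = e^{-tv²} K_{iv}(e^x)`. The last relation
gives Chapman–Kolmogorov (`integrable_heatKernel_mul_heatKernel`) and, at `v = 0`, shows that no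
section of `p_t` vanishes (`not_heatKernel_ae_eq_zero`).

**Normalization.** The Gaussian bound controls `x - y`. The decay of `K_{iu}(e^x)` as `x → ∞` gives
`p_t(x, y) = O(e^{-N(x + y)})` for every `N > 0`. The geometric mean of the two bounds
(`exists_heatKernel_le_exp`) makes `e^{ax + cy} p_τ(x, y)` integrable, because `a + c > 0`
supplies the decay for `x + y → -∞`.

**The process.** The prescribed densities are those of a Doob `h`-transform, with entrance density
proportional to `e^{cx}` and harmonic function `h_t(x) = ∫ p_{τ-t}(x, z) e^{az} dz`. For densities of
this kind (`IsMarkovDensity`) Chapman–Kolmogorov and harmonicity yield consistency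
(`lintegral_markovDensity_insert`), the Kolmogorov extension theorem (`exists_isProjectiveLimit`)
yields a law on path space (`exists_measure`), and the coordinate process is Markov
(`isMarkovProcess_eval`) with the given joint densities (`map_eq_withDensity`).
-/


namespace Yakubovich

open Filter Topology

/-! ### The integral representation of the Bessel function -/

lemma one_add_sq_half_le_cosh (w : ℝ) : 1 + w ^ 2 / 2 ≤ Real.cosh w := by
  have h1 : Real.cosh w = 1 + 2 * Real.sinh (w / 2) ^ 2 := by
    have := Real.cosh_two_mul (w / 2)
    rw [mul_div_cancel₀ w two_ne_zero, Real.cosh_sq] at this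
    linarith
  have h2 : (w / 2) ^ 2 ≤ Real.sinh (w / 2) ^ 2 := by
    rcases le_total 0 (w / 2) with h | h
    · exact pow_le_pow_left₀ h (Real.self_le_sinh_iff.2 h) 2
    · have := Real.sinh_le_self_iff.2 h
      nlinarith
  rw [h1]; nlinarith

lemma exp_neg_mul_cosh_add_le {x : ℝ} (hx : 0 < x) (M w : ℝ) :
    Real.exp (-x * Real.cosh w + M * |w|) ≤
      Real.exp (M ^ 2 / x) * Real.exp (-(x / 4) * w ^ 2) := by
  rw [← Real.exp_add]
  apply Real.exp_le_exp.2
  have h1 := one_add_sq_half_le_cosh w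
  have h2 : M * |w| ≤ x / 4 * w ^ 2 + M ^ 2 / x := by
    have : 0 ≤ x * (|w| / 2 - M / x) ^ 2 := by positivity
    have h3 : x * (|w| / 2 - M / x) ^ 2 = x / 4 * w ^ 2 + M ^ 2 / x - M * |w| := by
      rw [← sq_abs w]; field_simp; ring
    linarith
  nlinarith

lemma integrable_exp_neg_mul_cosh_add {x : ℝ} (hx : 0 < x) (M : ℝ) :
    Integrable fun w : ℝ => Real.exp (-x * Real.cosh w + M * |w|) := by
  refine Integrable.mono' ((integrable_exp_neg_mul_sq (b := x / 4) (by positivity)).const_mul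
    (Real.exp (M ^ 2 / x))) (by fun_prop) (.of_forall fun w => ?_)
  rw [Real.norm_of_nonneg (Real.exp_pos _).le]
  exact exp_neg_mul_cosh_add_le hx M w

lemma integrable_exp_neg_mul_cosh {x : ℝ} (hx : 0 < x) :
    Integrable fun w : ℝ => Real.exp (-x * Real.cosh w) := by
  simpa using integrable_exp_neg_mul_cosh_add hx 0

lemma cosh_le_exp_abs (w : ℝ) : Real.cosh w ≤ Real.exp |w| := by
  rw [← Real.cosh_abs, Real.cosh_eq]
  have : Real.exp (-|w|) ≤ Real.exp |w| := Real.exp_le_exp.2 (by linarith [abs_nonneg w])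
  linarith

lemma integrable_cosh_mul_exp_neg_mul_cosh {x : ℝ} (hx : 0 < x) :
    Integrable fun w : ℝ => Real.cosh w * Real.exp (-x * Real.cosh w) := by
  refine Integrable.mono' (integrable_exp_neg_mul_cosh_add hx 1) (by fun_prop)
    (.of_forall fun w => ?_)
  rw [Real.norm_of_nonneg (mul_nonneg (Real.cosh_pos _).le (Real.exp_pos _).le), Real.exp_add,
    mul_comm, one_mul]
  gcongr
  exact cosh_le_exp_abs w

@[simp] lemma besselK_neg (u x : ℝ) : besselK (-u) x = besselK u x := by
  simp [besselK]

/-- The holomorphic function of `z` whose integral along every horizontal line of the strip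
`|Im z| < π / 2` equals `2 K_{iu}(x)`. -/
noncomputable def besselIntegrand (u x : ℝ) (z : ℂ) : ℂ :=
  Complex.exp (-x * Complex.cosh z + Complex.I * u * z)

lemma re_cosh_add_mul_I (w θ : ℝ) :
    (Complex.cosh (w + θ * Complex.I)).re = Real.cosh w * Real.cos θ := by
  rw [Complex.cosh_add, Complex.cosh_mul_I, Complex.sinh_mul_I, ← Complex.ofReal_cosh,
    ← Complex.ofReal_sinh, ← Complex.ofReal_cos, ← Complex.ofReal_sin]
  simp [-Complex.ofReal_cos, -Complex.ofReal_sin, -Complex.ofReal_cosh, -Complex.ofReal_sinh]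

lemma norm_besselIntegrand (u x w θ : ℝ) :
    ‖besselIntegrand u x (w + θ * Complex.I)‖ =
      Real.exp (-x * (Real.cosh w * Real.cos θ) - u * θ) := by
  rw [besselIntegrand, Complex.norm_exp]
  congr 1
  have := re_cosh_add_mul_I w θ
  simp only [Complex.add_re, Complex.mul_re, Complex.neg_re, Complex.neg_im, Complex.ofReal_re,
    Complex.ofReal_im, Complex.I_re, Complex.I_im, this, Complex.add_im, Complex.mul_im]
  ring

lemma norm_sinh_add_mul_I_le (w θ : ℝ) :
    ‖Complex.sinh (w + θ * Complex.I)‖ ≤ Real.cosh w := by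
  have h : ‖Complex.sinh (w + θ * Complex.I)‖ ≤
      (‖Complex.exp (w + θ * Complex.I)‖ + ‖Complex.exp (-(w + θ * Complex.I))‖) / 2 := by
    rw [Complex.sinh, norm_div]
    simp only [RCLike.norm_ofNat]
    gcongr
    exact norm_sub_le _ _
  refine h.trans (le_of_eq ?_)
  rw [Complex.norm_exp, Complex.norm_exp, Real.cosh_eq]
  simp

lemma continuous_besselIntegrand (u x : ℝ) : Continuous (besselIntegrand u x) := by
  unfold besselIntegrand
  have := Complex.continuous_cosh
  fun_prop

lemma integrable_besselIntegrand (u : ℝ) {x θ : ℝ} (hx : 0 < x) (hθ : 0 < Real.cos θ) :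
    Integrable fun w : ℝ => besselIntegrand u x (w + θ * Complex.I) := by
  refine Integrable.mono' ((integrable_exp_neg_mul_cosh (mul_pos hx hθ)).const_mul
    (Real.exp (-u * θ))) ?_ (.of_forall fun w => ?_)
  · have := continuous_besselIntegrand u x
    exact Continuous.aestronglyMeasurable (by fun_prop)
  · rw [norm_besselIntegrand, ← Real.exp_add]
    apply le_of_eq; congr 1; ring

lemma hasDerivAt_besselIntegrand (u x : ℝ) (z : ℂ) :
    HasDerivAt (besselIntegrand u x)
      ((-x * Complex.sinh z + Complex.I * u) * besselIntegrand u x z) z := by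
  unfold besselIntegrand
  have h := (((Complex.hasDerivAt_cosh z).const_mul (-x : ℂ)).add
    ((hasDerivAt_id z).const_mul (Complex.I * u))).cexp
  refine h.congr_deriv ?_
  simp only [Pi.add_apply, id, mul_one]
  ring

/-- The integral of `besselIntegrand` along a horizontal line of the strip has zero derivative in
the height of the line, since the derivative of the integrand is a total derivative. -/
lemma hasDerivAt_integral_besselIntegrand (u : ℝ) {x θ : ℝ} (hx : 0 < x)
    (hθ : θ ∈ Ioo (-(Real.pi / 2)) (Real.pi / 2)) :
    HasDerivAt (fun θ : ℝ => ∫ w : ℝ, besselIntegrand u x (w + θ * Complex.I)) 0 θ := by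
  have hcont := continuous_besselIntegrand u x
  have hcos := Real.cos_pos_of_mem_Ioo hθ
  set c := Real.cos θ / 2 with hc
  have hc0 : 0 < c := by positivity
  have hev : ∀ᶠ t : ℝ in 𝓝 θ, c < Real.cos t ∧ |t - θ| < 1 :=
    ((Real.continuous_cos.tendsto θ).eventually_const_lt (by linarith)).and
      (Metric.ball_mem_nhds θ one_pos)
  obtain ⟨ε, hε, hball⟩ := Metric.eventually_nhds_iff_ball.1 hev
  set g : ℝ → ℝ → ℂ := fun t w => (-x * Complex.sinh (w + t * Complex.I) + Complex.I * u) *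
    besselIntegrand u x (w + t * Complex.I) with hg
  have hgc : ∀ t, Continuous (g t) := by
    intro t
    have := Complex.continuous_sinh
    fun_prop
  have hbound : ∀ t ∈ Metric.ball θ ε, ∀ w : ℝ, ‖g t w‖ ≤
      Real.exp (|u| * (|θ| + 1)) * (x * (Real.cosh w * Real.exp (-(x * c) * Real.cosh w)) +
        |u| * Real.exp (-(x * c) * Real.cosh w)) := by
    intro t ht w
    obtain ⟨h1, h2⟩ := hball t ht
    rw [hg, norm_mul, norm_besselIntegrand]
    have h3 : ‖-(x : ℂ) * Complex.sinh (w + t * Complex.I) + Complex.I * u‖ ≤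
        x * Real.cosh w + |u| := by
      refine (norm_add_le _ _).trans ?_
      simp only [norm_mul, norm_neg, Complex.norm_real, Complex.norm_I, one_mul, Real.norm_eq_abs,
        abs_of_pos hx]
      gcongr
      exact norm_sinh_add_mul_I_le w t
    have h4 : Real.exp (-x * (Real.cosh w * Real.cos t) - u * t) ≤
        Real.exp (-(x * c) * Real.cosh w) * Real.exp (|u| * (|θ| + 1)) := by
      rw [← Real.exp_add]
      apply Real.exp_le_exp.2
      have h5 : -(u * t) ≤ |u| * (|θ| + 1) := by
        have : |t| ≤ |θ| + 1 := by
          have := abs_sub_abs_le_abs_sub t θ; linarith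
        calc -(u * t) ≤ |u * t| := neg_le_abs _
          _ = |u| * |t| := abs_mul _ _
          _ ≤ _ := by gcongr
      have h6 : x * c * Real.cosh w ≤ x * (Real.cosh w * Real.cos t) := by
        have := Real.cosh_pos w
        have : c * Real.cosh w ≤ Real.cosh w * Real.cos t := by nlinarith
        nlinarith
      linarith
    calc _ ≤ (x * Real.cosh w + |u|) * (Real.exp (-(x * c) * Real.cosh w) *
          Real.exp (|u| * (|θ| + 1))) := by gcongr
      _ = _ := by ring
  have hxc : 0 < x * c := by positivity
  have hbi : Integrable fun w : ℝ => Real.exp (|u| * (|θ| + 1)) *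
      (x * (Real.cosh w * Real.exp (-(x * c) * Real.cosh w)) +
        |u| * Real.exp (-(x * c) * Real.cosh w)) :=
    (((integrable_cosh_mul_exp_neg_mul_cosh hxc).const_mul x).add
      ((integrable_exp_neg_mul_cosh hxc).const_mul |u|)).const_mul _
  have hgi : Integrable (g θ) := Integrable.mono' hbi (hgc θ).aestronglyMeasurable
    (.of_forall (hbound θ (Metric.mem_ball_self hε)))
  have key := hasDerivAt_integral_of_dominated_loc_of_deriv_le (μ := volume)
    (F := fun (t w : ℝ) => besselIntegrand u x (w + t * Complex.I))
    (F' := fun t w => g t w * Complex.I) (x₀ := θ) (Metric.ball_mem_nhds θ hε)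
    (.of_forall fun t => Continuous.aestronglyMeasurable (by fun_prop))
    (integrable_besselIntegrand u hx hcos)
    ((hgc θ).mul continuous_const).aestronglyMeasurable
    (.of_forall fun w t ht => by
      rw [norm_mul, Complex.norm_I, mul_one]; exact hbound t ht w) hbi
    (.of_forall fun w t ht => by
      have h := (hasDerivAt_besselIntegrand u x (w + t * Complex.I)).comp (𝕜 := ℝ) t
        (h := fun t : ℝ => (w + t * Complex.I : ℂ))
        (((Complex.ofRealCLM.hasDerivAt (x := t)).mul_const Complex.I).const_add (w : ℂ))
      simpa [hg, Function.comp_def] using h)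
  have hzero : ∫ w, g θ w = 0 := by
    refine integral_eq_zero_of_hasDerivAt_of_integrable
      (f := fun w : ℝ => besselIntegrand u x (w + θ * Complex.I)) (fun w => ?_) hgi
      (integrable_besselIntegrand u hx hcos)
    have h := (hasDerivAt_besselIntegrand u x (w + θ * Complex.I)).comp (𝕜 := ℝ) w
        (h := fun w : ℝ => (w + θ * Complex.I : ℂ))
        ((Complex.ofRealCLM.hasDerivAt (x := w)).add_const (θ * Complex.I))
    simpa [hg, Function.comp_def] using h
  have := key.2
  rwa [integral_mul_const, hzero, zero_mul] at this

lemma integral_besselIntegrand_zero (u : ℝ) {x : ℝ} (hx : 0 < x) :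
    ∫ w : ℝ, besselIntegrand u x w = 2 * besselK u x := by
  have hi : Integrable fun w : ℝ => besselIntegrand u x w := by
    simpa using integrable_besselIntegrand u (θ := 0) hx (by simp)
  have h1 : ∫ w : ℝ, besselIntegrand u x w =
      ∫ w : ℝ, ((besselIntegrand u x w + besselIntegrand u x (-w : ℝ)) / 2) := by
    rw [integral_div, integral_add hi hi.comp_neg,
      integral_neg_eq_self (fun w : ℝ => besselIntegrand u x w)]
    ring
  have h2 : ∀ w : ℝ, (besselIntegrand u x w + besselIntegrand u x (-w : ℝ)) / 2 =
      ((Real.exp (-x * Real.cosh w) * Real.cos (u * w) : ℝ) : ℂ) := by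
    intro w
    simp only [besselIntegrand, Complex.ofReal_neg, Complex.cosh_neg, Complex.exp_add]
    push_cast
    rw [Complex.cos]
    ring_nf
  simp_rw [h1, h2]
  rw [integral_complex_ofReal]
  have h3 : (fun w : ℝ => Real.exp (-x * Real.cosh w) * Real.cos (u * w)) =
      fun w => (fun w => Real.exp (-x * Real.cosh w) * Real.cos (u * w)) |w| := by
    ext w
    rcases abs_choice w with h | h <;> simp [h]
  rw [h3, integral_comp_abs (f := fun w => Real.exp (-x * Real.cosh w) * Real.cos (u * w))]
  rw [besselK]; push_cast; rfl

/-- Moving the line of integration to height `θ` in the integral representation of `K_{iu}`. -/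
lemma integral_besselIntegrand (u : ℝ) {x θ : ℝ} (hx : 0 < x)
    (hθ : θ ∈ Ioo (-(Real.pi / 2)) (Real.pi / 2)) :
    ∫ w : ℝ, besselIntegrand u x (w + θ * Complex.I) = 2 * besselK u x := by
  rw [← integral_besselIntegrand_zero u hx]
  have h0 : (0 : ℝ) ∈ Ioo (-(Real.pi / 2)) (Real.pi / 2) := by
    constructor <;> linarith [Real.pi_pos]
  have := isOpen_Ioo.is_const_of_deriv_eq_zero (𝕜 := ℝ) isPreconnected_Ioo
    (f := fun θ : ℝ => ∫ w : ℝ, besselIntegrand u x (w + θ * Complex.I))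
    (fun t ht => (hasDerivAt_integral_besselIntegrand u hx ht).differentiableAt.differentiableWithinAt)
    (fun t ht => (hasDerivAt_integral_besselIntegrand u hx ht).deriv) hθ h0
  simpa using this

/-- The function `w ↦ exp (-x cosh (w + iθ))`. -/
noncomputable def coshExp (x θ w : ℝ) : ℂ := Complex.exp (-x * Complex.cosh (w + θ * Complex.I))

lemma norm_coshExp (x θ w : ℝ) : ‖coshExp x θ w‖ = Real.exp (-(x * Real.cos θ) * Real.cosh w) := by
  rw [coshExp, Complex.norm_exp]
  have := re_cosh_add_mul_I w θ
  congr 1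
  simp [this]
  ring

lemma continuous_coshExp (x θ : ℝ) : Continuous (coshExp x θ) := by
  unfold coshExp
  have := Complex.continuous_cosh
  fun_prop

lemma integrable_coshExp {x θ : ℝ} (hx : 0 < x) (hθ : 0 < Real.cos θ) :
    Integrable (coshExp x θ) := by
  refine Integrable.mono' (integrable_exp_neg_mul_cosh (mul_pos hx hθ))
    (continuous_coshExp x θ).aestronglyMeasurable (.of_forall fun w => ?_)
  rw [norm_coshExp]

/-- The Fourier transform of `w ↦ exp (-x cosh (w + iθ))` is `u ↦ 2 e^{θu} K_{iu}(x)`. -/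
lemma integral_coshExp_mul (u : ℝ) {x θ : ℝ} (hx : 0 < x)
    (hθ : θ ∈ Ioo (-(Real.pi / 2)) (Real.pi / 2)) :
    ∫ w : ℝ, coshExp x θ w * Complex.exp (Complex.I * u * w) =
      Complex.exp (θ * u) * (2 * besselK u x) := by
  rw [← integral_besselIntegrand u hx hθ, ← integral_const_mul]
  congr 1; ext w
  simp only [coshExp, besselIntegrand]
  rw [← Complex.exp_add, ← Complex.exp_add]
  congr 1
  linear_combination (-(u : ℂ) * θ) * Complex.I_sq

lemma two_mul_besselK_zero {x : ℝ} (hx : 0 < x) :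
    ∫ w : ℝ, Real.exp (-x * Real.cosh w) = 2 * besselK 0 x := by
  have := integral_coshExp_mul 0 (θ := 0) hx (by constructor <;> linarith [Real.pi_pos])
  simp only [coshExp, Complex.ofReal_zero, zero_mul, mul_zero, add_zero, Complex.exp_zero, mul_one,
    one_mul] at this
  have h2 : ∀ w : ℝ, Complex.exp (-x * Complex.cosh w) =
    ((Real.exp (-x * Real.cosh w) : ℝ) : ℂ) := by intro w; push_cast; rfl
  simp_rw [h2] at this
  rw [integral_complex_ofReal] at this
  exact_mod_cast this

lemma besselK_zero_pos {x : ℝ} (hx : 0 < x) : 0 < besselK 0 x := by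
  have := two_mul_besselK_zero hx
  have h2 : 0 < ∫ w : ℝ, Real.exp (-x * Real.cosh w) := by
    have h := integrable_exp_neg_mul_cosh hx
    exact integral_exp_pos h
  linarith

/-- Exponential decay of `K_{iu}(x)` in the index `u`, with rate arbitrarily close to `π / 2`. -/
lemma abs_besselK_le_exp (u : ℝ) {x θ : ℝ} (hx : 0 < x) (h0 : 0 ≤ θ) (hθ : θ < Real.pi / 2) :
    |besselK u x| ≤ Real.exp (-θ * |u|) * besselK 0 (x * Real.cos θ) := by
  have hmem : θ ∈ Ioo (-(Real.pi / 2)) (Real.pi / 2) := ⟨by linarith [Real.pi_pos], hθ⟩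
  have hc := Real.cos_pos_of_mem_Ioo hmem
  have key : ∀ u : ℝ, Real.exp (θ * u) * |besselK u x| ≤ besselK 0 (x * Real.cos θ) := by
    intro u
    have h1 := integral_coshExp_mul u hx hmem
    have h2 : ‖∫ w : ℝ, coshExp x θ w * Complex.exp (Complex.I * u * w)‖ ≤
        ∫ w : ℝ, Real.exp (-(x * Real.cos θ) * Real.cosh w) := by
      refine norm_integral_le_of_norm_le (integrable_exp_neg_mul_cosh (mul_pos hx hc))
        (.of_forall fun w => ?_)
      rw [norm_mul, norm_coshExp, Complex.norm_exp]
      simp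
    rw [h1, two_mul_besselK_zero (mul_pos hx hc), norm_mul, Complex.norm_exp, norm_mul,
      Complex.norm_real, Real.norm_eq_abs] at h2
    simp at h2
    linarith
  have h3 : Real.exp (θ * |u|) * |besselK u x| ≤ besselK 0 (x * Real.cos θ) := by
    rcases abs_choice u with h | h
    · rw [h]; exact key u
    · have := key (-u); rwa [besselK_neg, ← h] at this
  rw [neg_mul, Real.exp_neg, ← div_eq_inv_mul, le_div_iff₀ (Real.exp_pos _)]
  linarith

/-- `K_0(x) = O(x^{-N})` for every `N > 0`, uniformly in `x > 0`. -/
lemma exists_besselK_zero_exp_le {N : ℝ} (hN : 0 < N) :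
    ∃ C, 0 < C ∧ ∀ x, besselK 0 (Real.exp x) ≤ C * Real.exp (-N * x) := by
  obtain ⟨A, hA0, hA⟩ : ∃ A, 0 < A ∧ ∀ y : ℝ, Real.exp (-Real.exp y) ≤ A * Real.exp (-N * y) := by
    refine ⟨Real.exp (N ^ 2 + 1), Real.exp_pos _, fun y => ?_⟩
    rw [← Real.exp_add]
    apply Real.exp_le_exp.2
    have h1 := Real.add_one_le_exp y
    have h2 : N * (y - N) ≤ Real.exp y := by
      rcases le_total y N with h | h
      · exact (mul_nonpos_of_nonneg_of_nonpos hN.le (by linarith)).trans (Real.exp_pos _).le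
      · have h3 : N ≤ Real.exp N := by linarith [Real.add_one_le_exp N]
        have h4 : y - N ≤ Real.exp (y - N) := by linarith [Real.add_one_le_exp (y - N)]
        calc N * (y - N) ≤ Real.exp N * Real.exp (y - N) := by
              apply mul_le_mul h3 h4 (by linarith) (Real.exp_pos _).le
          _ = Real.exp y := by rw [← Real.exp_add]; congr 1; ring
    nlinarith
  have hint : IntegrableOn (fun w : ℝ => Real.exp (-N * w)) (Ioi 0) :=
    integrableOn_exp_mul_Ioi (by linarith) 0
  refine ⟨A * Real.exp (N * Real.log 2) * (∫ w in Ioi (0 : ℝ), Real.exp (-N * w)), ?_, fun x => ?_⟩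
  · have : (0 : ℝ) < ∫ w in Ioi (0 : ℝ), Real.exp (-N * w) := by
      rw [integral_exp_mul_Ioi (by linarith)]
      simp [hN]
    positivity
  · rw [besselK, mul_right_comm, ← integral_const_mul]
    refine setIntegral_mono_on (by simpa using integrableOn_besselK 0 (Real.exp_pos x))
      (hint.const_mul _) measurableSet_Ioi fun w _ => ?_
    simp only [zero_mul, Real.cos_zero, mul_one]
    -- `cosh w ≥ e^w / 2`
    have h1 : Real.exp (w - Real.log 2) ≤ Real.cosh w := by
      rw [Real.exp_sub, Real.exp_log two_pos, Real.cosh_eq]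
      have := Real.exp_pos (-w); linarith
    calc Real.exp (-Real.exp x * Real.cosh w)
        ≤ Real.exp (-Real.exp (x + (w - Real.log 2))) := by
          apply Real.exp_le_exp.2
          rw [Real.exp_add]
          have := Real.exp_pos x; nlinarith
      _ ≤ A * Real.exp (-N * (x + (w - Real.log 2))) := hA _
      _ = _ := by
          rw [show -N * (x + (w - Real.log 2)) = N * Real.log 2 + -N * x + -N * w by ring,
            Real.exp_add, Real.exp_add]; ring

/-! ### The product formula -/

/-- The symmetric positive kernel of the product formula for the functions `K_{iu}`, in logarithmic
coordinates. -/
noncomputable def tri (a b c : ℝ) : ℝ :=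
  1 / 2 * Real.exp (-(Real.exp (a + b - c) + Real.exp (c + a - b) + Real.exp (c + b - a)) / 2)

lemma tri_pos (a b c : ℝ) : 0 < tri a b c := by unfold tri; positivity

lemma continuous_tri (a b : ℝ) : Continuous (tri a b) := by unfold tri; fun_prop

/-- Doubly exponential decay at both ends; it beats every exponential weight used below. -/
lemma exists_tri_le (a b : ℝ) : ∃ κ, 0 < κ ∧ ∀ c, tri a b c ≤ Real.exp (-κ * Real.cosh c) := by
  refine ⟨min (Real.exp (a + b)) (Real.exp (a - b)), lt_min (Real.exp_pos _) (Real.exp_pos _),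
    fun c => ?_⟩
  set κ := min (Real.exp (a + b)) (Real.exp (a - b))
  have h1 : κ * Real.exp (-c) ≤ Real.exp (a + b - c) := by
    rw [sub_eq_add_neg (a + b), Real.exp_add]; gcongr; exact min_le_left _ _
  have h2 : κ * Real.exp c ≤ Real.exp (c + a - b) := by
    rw [show c + a - b = (a - b) + c by ring, Real.exp_add (a - b)]; gcongr
    exact min_le_right _ _
  have h3 := Real.exp_pos (c + b - a)
  have h4 : Real.exp (-(Real.exp (a + b - c) + Real.exp (c + a - b) + Real.exp (c + b - a)) / 2) ≤
      Real.exp (-κ * Real.cosh c) := by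
    apply Real.exp_le_exp.2
    rw [Real.cosh_eq]
    linarith
  have h5 := Real.exp_pos (-(Real.exp (a + b - c) + Real.exp (c + a - b) + Real.exp (c + b - a)) / 2)
  unfold tri
  linarith

lemma integrable_tri_mul_exp (a b M : ℝ) :
    Integrable fun c => tri a b c * Real.exp (M * |c|) := by
  obtain ⟨κ, hκ, h⟩ := exists_tri_le a b
  refine Integrable.mono' (integrable_exp_neg_mul_cosh_add hκ M) ?_ (.of_forall fun c => ?_)
  · have := continuous_tri a b
    exact Continuous.aestronglyMeasurable (by fun_prop)
  · rw [Real.norm_of_nonneg (mul_nonneg (tri_pos _ _ _).le (Real.exp_pos _).le), Real.exp_add]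
    gcongr
    exact h c

lemma measurable_besselK : Measurable (Function.uncurry besselK) := by
  have : Function.uncurry besselK = fun p : ℝ × ℝ => ∫ w in Ioi (0 : ℝ),
      (fun (q : (ℝ × ℝ) × ℝ) => Real.exp (-q.1.2 * Real.cosh q.2) * Real.cos (q.1.1 * q.2)) (p, w) := by
    ext p; rfl
  rw [this]
  exact (StronglyMeasurable.integral_prod_right (f := fun (p : ℝ × ℝ) (w : ℝ) =>
    Real.exp (-p.2 * Real.cosh w) * Real.cos (p.1 * w))
      (by apply Continuous.stronglyMeasurable; unfold Function.uncurry; fun_prop)).measurable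

lemma _root_.Measurable.besselK {α : Type*} [MeasurableSpace α] {f g : α → ℝ} (hf : Measurable f)
    (hg : Measurable g) : Measurable fun a => besselK (f a) (g a) :=
  measurable_besselK.comp (hf.prodMk hg)

lemma besselK_zero_exp_nonneg (x : ℝ) : 0 ≤ besselK 0 (Real.exp x) :=
  (besselK_zero_pos (Real.exp_pos x)).le

lemma abs_besselK_exp_le (u x : ℝ) : |besselK u (Real.exp x)| ≤ besselK 0 (Real.exp x) :=
  abs_besselK_le u (Real.exp_pos x)

lemma integrable_tri_mul_besselK_zero (a b : ℝ) :
    Integrable fun c => tri a b c * besselK 0 (Real.exp c) := by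
  obtain ⟨C, hC, hK⟩ := exists_besselK_zero_exp_le (N := 1) one_pos
  refine Integrable.mono' ((integrable_tri_mul_exp a b 1).const_mul C) ?_ (.of_forall fun c => ?_)
  · have := continuous_tri a b
    exact (this.measurable.mul (measurable_const.besselK Real.measurable_exp)).aestronglyMeasurable
  · rw [Real.norm_of_nonneg (mul_nonneg (tri_pos _ _ _).le (besselK_zero_exp_nonneg c))]
    have h1 : Real.exp (-1 * c) ≤ Real.exp (1 * |c|) := Real.exp_le_exp.2 (by
      have := neg_le_abs c; linarith)
    calc tri a b c * besselK 0 (Real.exp c) ≤ tri a b c * (C * Real.exp (1 * |c|)) := by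
          gcongr
          · exact (tri_pos _ _ _).le
          · exact (hK c).trans (by gcongr)
      _ = _ := by ring

lemma integral_norm_coshExp {x θ : ℝ} (hx : 0 < x) (hθ : 0 < Real.cos θ) :
    ∫ w, ‖coshExp x θ w‖ = 2 * besselK 0 (x * Real.cos θ) := by
  simp_rw [norm_coshExp]
  exact two_mul_besselK_zero (mul_pos hx hθ)

lemma coshExp_zero (x w : ℝ) : coshExp x 0 w = ((Real.exp (-x * Real.cosh w) : ℝ) : ℂ) := by
  simp [coshExp]

/-- For each frequency variable `w`, the two sides of the product formula differ by a translation
of the integration variable. -/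
lemma integral_coshExp_mul_coshExp_sub (a b w : ℝ) :
    ∫ α, coshExp (Real.exp a) 0 α * coshExp (Real.exp b) 0 (w - α) =
      2 * ∫ c, (tri a b c : ℂ) * coshExp (Real.exp c) 0 w := by
  simp_rw [coshExp_zero, ← Complex.ofReal_mul]
  rw [integral_complex_ofReal, integral_complex_ofReal]
  norm_cast
  -- The shift `κ` below is the one for which `e^{a+b-c}` turns into `(e^a + e^{b+w}) e^{-α}`.
  rw [← integral_add_right_eq_self (μ := volume)
    (fun c => tri a b c * Real.exp (-Real.exp c * Real.cosh w))
    (a + b - Real.log (Real.exp a + Real.exp (b + w))), ← integral_const_mul]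
  congr 1; ext α
  set κ := a + b - Real.log (Real.exp a + Real.exp (b + w)) with hκ
  have hpos : 0 < Real.exp a + Real.exp (b + w) := by positivity
  have e1 : Real.exp κ * (Real.exp a + Real.exp (b + w)) = Real.exp (a + b) := by
    rw [hκ, Real.exp_sub, Real.exp_log hpos]; field_simp
  have e2 : Real.exp (a + b - (α + κ)) = (Real.exp a + Real.exp (b + w)) * Real.exp (-α) := by
    rw [show a + b - (α + κ) = Real.log (Real.exp a + Real.exp (b + w)) + -α by rw [hκ]; ring,
      Real.exp_add, Real.exp_log hpos]
  have e3 : Real.exp κ * (Real.exp (a - b) + Real.exp (b - a) + Real.exp w + Real.exp (-w)) =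
      Real.exp a + Real.exp (b - w) := by
    have : (Real.exp κ * (Real.exp (a - b) + Real.exp (b - a) + Real.exp w + Real.exp (-w))) *
        (Real.exp a + Real.exp (b + w)) = (Real.exp a + Real.exp (b - w)) *
        (Real.exp a + Real.exp (b + w)) := by
      rw [mul_right_comm, e1]
      simp only [Real.exp_add, Real.exp_sub, Real.exp_neg]
      field_simp
      ring
    exact mul_right_cancel₀ hpos.ne' this
  unfold tri
  rw [← mul_assoc, ← mul_assoc, show (2 : ℝ) * (1 / 2) = 1 by norm_num, one_mul, ← Real.exp_add,
    ← Real.exp_add]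
  congr 1
  have e4 : Real.exp (α + κ + a - b) + Real.exp (α + κ + b - a) +
      Real.exp (α + κ) * (Real.exp w + Real.exp (-w)) =
      Real.exp α * (Real.exp a + Real.exp (b - w)) := by
    rw [← e3, show α + κ + a - b = α + κ + (a - b) by ring,
      show α + κ + b - a = α + κ + (b - a) by ring, Real.exp_add (α + κ), Real.exp_add (α + κ),
      Real.exp_add α κ]
    ring
  rw [e2, Real.cosh_eq, Real.cosh_eq, Real.cosh_eq]
  have e5 : Real.exp b * (Real.exp (w - α) + Real.exp (-(w - α))) =
      Real.exp (b + w) * Real.exp (-α) + Real.exp (b - w) * Real.exp α := by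
    rw [mul_add, ← Real.exp_add, ← Real.exp_add, ← Real.exp_add, ← Real.exp_add]
    ring_nf
  linear_combination (-1 / 2) * e5 + (1 / 2) * e4

/-- The product formula `∫ tri a b c K_{iu}(e^c) dc = K_{iu}(e^a) K_{iu}(e^b)`. -/
lemma integral_tri_mul_besselK (a b u : ℝ) :
    ∫ c, tri a b c * besselK u (Real.exp c) =
      besselK u (Real.exp a) * besselK u (Real.exp b) := by
  have h0 : (0 : ℝ) ∈ Ioo (-(Real.pi / 2)) (Real.pi / 2) := by
    constructor <;> linarith [Real.pi_pos]
  have hc0 : 0 < Real.cos 0 := by simp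
  set e : ℝ → ℂ := fun w => Complex.exp (Complex.I * u * w) with he
  have hne : ∀ w, ‖e w‖ = 1 := by intro w; rw [he, Complex.norm_exp]; simp
  have hec : Continuous e := by rw [he]; fun_prop
  have hK : ∀ c, ∫ w, coshExp (Real.exp c) 0 w * e w = 2 * besselK u (Real.exp c) := by
    intro c
    simpa using integral_coshExp_mul u (Real.exp_pos c) h0
  have hI : ∀ c, Integrable fun w => coshExp (Real.exp c) 0 w * e w := by
    intro c
    exact (integrable_coshExp (Real.exp_pos c) hc0).mul_bdd (c := 1) hec.aestronglyMeasurable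
      (.of_forall fun w => (hne w).le)
  -- the left-hand side
  have hL : ∫ c, (tri a b c : ℂ) * (2 * besselK u (Real.exp c)) =
      ∫ w, e w * ∫ c, (tri a b c : ℂ) * coshExp (Real.exp c) 0 w := by
    have hF : Integrable (Function.uncurry fun c w : ℝ =>
        (tri a b c : ℂ) * (coshExp (Real.exp c) 0 w * e w)) (volume.prod volume) := by
      refine (integrable_prod_iff ?_).2 ⟨.of_forall fun c => (hI c).const_mul (tri a b c : ℂ), ?_⟩
      · have h1 := continuous_tri a b
        have h2 := Complex.continuous_cosh
        apply Continuous.aestronglyMeasurable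
        unfold Function.uncurry coshExp
        fun_prop
      · have : ∀ c, ∫ w, ‖(tri a b c : ℂ) * (coshExp (Real.exp c) 0 w * e w)‖ =
            tri a b c * (2 * besselK 0 (Real.exp c)) := by
          intro c
          simp_rw [norm_mul, hne, mul_one]
          rw [integral_const_mul, integral_norm_coshExp (Real.exp_pos c) hc0]
          simp [abs_of_pos (tri_pos a b c)]
        simp only [Function.uncurry_apply_pair, this]
        exact ((integrable_tri_mul_besselK_zero a b).const_mul 2).congr
          (.of_forall fun c => by simp; ring)
    simp_rw [← hK, ← integral_const_mul]
    rw [integral_integral_swap hF]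
    congr 1; ext w
    congr 1; ext c; ring
  -- the right-hand side
  have hR : (∫ α, coshExp (Real.exp a) 0 α * e α) * (∫ β, coshExp (Real.exp b) 0 β * e β) =
      ∫ w, e w * ∫ α, coshExp (Real.exp a) 0 α * coshExp (Real.exp b) 0 (w - α) := by
    have hF := (hI a).convolution_integrand (ContinuousLinearMap.mul ℝ ℂ) (hI b)
    have hF' : Integrable (Function.uncurry fun α w : ℝ => (coshExp (Real.exp a) 0 α * e α) *
        (coshExp (Real.exp b) 0 (w - α) * e (w - α))) (volume.prod volume) := hF.swap
    have h1 : (∫ α, coshExp (Real.exp a) 0 α * e α) * (∫ β, coshExp (Real.exp b) 0 β * e β) =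
        ∫ α, ∫ w, (coshExp (Real.exp a) 0 α * e α) * (coshExp (Real.exp b) 0 (w - α) * e (w - α)) := by
      rw [← integral_mul_const]
      congr 1; ext α
      rw [integral_const_mul,
        integral_sub_right_eq_self (fun β => coshExp (Real.exp b) 0 β * e β) α]
    rw [h1, integral_integral_swap hF']
    congr 1; ext w
    rw [← integral_const_mul]
    congr 1; ext α
    have : e w = e α * e (w - α) := by
      simp only [he]; rw [← Complex.exp_add]; congr 1; push_cast; ring
    rw [this]; ring
  simp_rw [integral_coshExp_mul_coshExp_sub, mul_left_comm _ (2 : ℂ)] at hR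
  rw [integral_const_mul, ← hL, hK, hK] at hR
  have h3 : ∀ c, (tri a b c : ℂ) * (2 * besselK u (Real.exp c)) =
      ((2 * (tri a b c * besselK u (Real.exp c)) : ℝ) : ℂ) := by intro c; push_cast; ring
  simp_rw [h3] at hR
  rw [integral_complex_ofReal, integral_const_mul] at hR
  have h4 : 2 * besselK u (Real.exp a) * (2 * besselK u (Real.exp b)) =
      2 * (2 * ∫ c, tri a b c * besselK u (Real.exp c)) := by exact_mod_cast hR
  linarith

/-! ### Fourier inversion for the Bessel function -/

open FourierTransform in
/-- Fourier inversion at a point of continuity, for the convention `f ↦ ∫ f(w) e^{iuw} dw`. -/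
lemma integral_fourier_mul_exp {f : ℝ → ℂ} (hf : Integrable f)
    (hF : Integrable fun u : ℝ => ∫ w, f w * Complex.exp (Complex.I * u * w)) {w : ℝ}
    (hw : ContinuousAt f w) :
    ∫ u : ℝ, (∫ w, f w * Complex.exp (Complex.I * u * w)) * Complex.exp (-(Complex.I * u * w)) =
      2 * Real.pi * f w := by
  set F : ℝ → ℂ := fun u : ℝ => ∫ w, f w * Complex.exp (Complex.I * u * w) with hFdef
  have h1 : 𝓕 f = fun ξ : ℝ => F (-(2 * Real.pi) * ξ) := by
    ext ξ
    rw [Real.fourier_real_eq_integral_exp_smul, hFdef]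
    congr 1; ext v
    rw [smul_eq_mul, mul_comm]
    congr 2
    push_cast
    ring
  have hne : -(2 * Real.pi) ≠ 0 := by have := Real.pi_pos; linarith
  have h2 : Integrable (𝓕 f) := by
    rw [h1]; exact hF.comp_mul_left' hne
  have h3 := hf.fourierInv_fourier_eq h2 hw
  rw [Real.fourierInv_eq', h1] at h3
  have h4 := Measure.integral_comp_mul_left
    (fun u : ℝ => F u * Complex.exp (-(Complex.I * u * w))) (-(2 * Real.pi))
  have h5 : ∫ v : ℝ, Complex.exp (↑(2 * Real.pi * inner ℝ v w) * Complex.I) •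
      F (-(2 * Real.pi) * v) =
      ∫ x : ℝ, F (-(2 * Real.pi) * x) *
        Complex.exp (-(Complex.I * ((-(2 * Real.pi) * x : ℝ) : ℂ) * w)) := by
    congr 1; ext v
    rw [smul_eq_mul, mul_comm]
    congr 2
    simp
    ring
  rw [h5, h4] at h3
  rw [← h3, inv_neg, abs_neg, abs_of_pos (by have := Real.pi_pos; positivity), Complex.real_smul]
  have := Real.pi_pos.ne'
  change (∫ u : ℝ, F u * Complex.exp (-(Complex.I * u * w))) = _
  generalize (∫ u : ℝ, F u * Complex.exp (-(Complex.I * u * w))) = J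
  push_cast
  field_simp

lemma integrable_exp_neg_mul_abs {δ : ℝ} (hδ : 0 < δ) :
    Integrable fun u : ℝ => Real.exp (-δ * |u|) := by
  rw [← integrableOn_univ, ← Iic_union_Ioi (a := (0 : ℝ))]
  refine IntegrableOn.union ?_ ?_
  · refine (integrableOn_exp_mul_Iic hδ 0).congr_fun (fun u hu => ?_) measurableSet_Iic
    simp only [abs_of_nonpos (show u ≤ 0 from hu)]; ring_nf
  · refine (integrableOn_exp_mul_Ioi (neg_lt_zero.2 hδ) 0).congr_fun (fun u hu => ?_)
      measurableSet_Ioi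
    simp only [abs_of_pos (show 0 < u from hu)]

lemma abs_mul_exp_neg_le {δ : ℝ} (hδ : 0 < δ) (u : ℝ) :
    |u| * Real.exp (-δ * |u|) ≤ 2 / δ * Real.exp (-(δ / 2) * |u|) := by
  have h1 : δ / 2 * |u| ≤ Real.exp (δ / 2 * |u|) := by
    linarith [Real.add_one_le_exp (δ / 2 * |u|)]
  have h2 : Real.exp (-δ * |u|) = Real.exp (-(δ / 2) * |u|) * Real.exp (-(δ / 2 * |u|)) := by
    rw [← Real.exp_add]; congr 1; ring
  have h3 : |u| * Real.exp (-(δ / 2 * |u|)) ≤ 2 / δ := by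
    rw [Real.exp_neg, ← div_eq_mul_inv, div_le_div_iff₀ (Real.exp_pos _) hδ]
    linarith
  rw [h2]
  calc _ = |u| * Real.exp (-(δ / 2 * |u|)) * Real.exp (-(δ / 2) * |u|) := by ring
    _ ≤ _ := by gcongr

lemma integrable_abs_mul_exp_neg_mul_abs {δ : ℝ} (hδ : 0 < δ) :
    Integrable fun u : ℝ => |u| * Real.exp (-δ * |u|) := by
  refine Integrable.mono' ((integrable_exp_neg_mul_abs (half_pos hδ)).const_mul (2 / δ))
    (by fun_prop) (.of_forall fun u => ?_)
  rw [Real.norm_of_nonneg (by positivity)]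
  exact abs_mul_exp_neg_le hδ u

lemma exists_angle_gt {θ : ℝ} (hθ : θ ∈ Ioo (-(Real.pi / 2)) (Real.pi / 2)) :
    ∃ θ', |θ| < θ' ∧ 0 ≤ θ' ∧ θ' < Real.pi / 2 := by
  have : |θ| < Real.pi / 2 := abs_lt.2 hθ
  obtain ⟨t, h1, h2⟩ := exists_between this
  exact ⟨t, h1, (abs_nonneg θ).trans h1.le, h2⟩

lemma norm_exp_mul_besselK_le {u x θ θ' : ℝ} (hx : 0 < x) (h0 : 0 ≤ θ') (h1 : θ' < Real.pi / 2) :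
    ‖Complex.exp (θ * u) * besselK u x‖ ≤
      Real.exp (-(θ' - |θ|) * |u|) * besselK 0 (x * Real.cos θ') := by
  rw [norm_mul, Complex.norm_exp, Complex.norm_real, Real.norm_eq_abs]
  have h2 := abs_besselK_le_exp u hx h0 h1
  have h3 : (θ * u : ℂ).re ≤ |θ| * |u| := by
    rw [← Complex.ofReal_mul, Complex.ofReal_re, ← abs_mul]; exact le_abs_self _
  calc _ ≤ Real.exp (|θ| * |u|) * (Real.exp (-θ' * |u|) * besselK 0 (x * Real.cos θ')) := by
        gcongr
    _ = _ := by rw [← mul_assoc, ← Real.exp_add]; congr 2; ring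

lemma aestronglyMeasurable_exp_mul_besselK (x θ : ℝ) :
    AEStronglyMeasurable (fun u : ℝ => Complex.exp (θ * u) * besselK u x) := by
  have : Measurable fun u : ℝ => besselK u x := measurable_id.besselK measurable_const
  apply Measurable.aestronglyMeasurable
  fun_prop

lemma integrable_exp_mul_besselK {x θ : ℝ} (hx : 0 < x)
    (hθ : θ ∈ Ioo (-(Real.pi / 2)) (Real.pi / 2)) :
    Integrable fun u : ℝ => Complex.exp (θ * u) * besselK u x := by
  obtain ⟨θ', h1, h2, h3⟩ := exists_angle_gt hθ
  exact Integrable.mono' ((integrable_exp_neg_mul_abs (sub_pos.2 h1)).mul_const _)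
    (aestronglyMeasurable_exp_mul_besselK x θ)
    (.of_forall fun u => norm_exp_mul_besselK_le hx h2 h3)

lemma integrable_id_mul_exp_mul_besselK {x θ : ℝ} (hx : 0 < x)
    (hθ : θ ∈ Ioo (-(Real.pi / 2)) (Real.pi / 2)) :
    Integrable fun u : ℝ => (u : ℂ) * (Complex.exp (θ * u) * besselK u x) := by
  obtain ⟨θ', h1, h2, h3⟩ := exists_angle_gt hθ
  refine Integrable.mono' ((integrable_abs_mul_exp_neg_mul_abs (sub_pos.2 h1)).mul_const
    (besselK 0 (x * Real.cos θ')))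
    (Complex.measurable_ofReal.aestronglyMeasurable.mul (aestronglyMeasurable_exp_mul_besselK x θ))
    (.of_forall fun u => ?_)
  rw [norm_mul, Complex.norm_real, Real.norm_eq_abs, mul_assoc]
  gcongr
  exact norm_exp_mul_besselK_le hx h2 h3

/-- Fourier inversion of the integral representation of `K_{iu}`. -/
lemma integral_exp_mul_besselK {x θ : ℝ} (hx : 0 < x)
    (hθ : θ ∈ Ioo (-(Real.pi / 2)) (Real.pi / 2)) (w : ℝ) :
    ∫ u : ℝ, Complex.exp (θ * u) * besselK u x * Complex.exp (Complex.I * u * w) =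
      Real.pi * coshExp x θ (-w) := by
  have hI := integrable_exp_mul_besselK hx hθ
  have h := integral_fourier_mul_exp (f := coshExp x θ) (w := -w)
    (integrable_coshExp hx (Real.cos_pos_of_mem_Ioo hθ))
    (by
      simp_rw [integral_coshExp_mul _ hx hθ]
      exact (hI.const_mul 2).congr (.of_forall fun u => by simp only []; ring))
    (continuous_coshExp x θ).continuousAt
  simp_rw [integral_coshExp_mul _ hx hθ] at h
  have h2 : (2 : ℂ) * ∫ u : ℝ, Complex.exp (θ * u) * besselK u x *
      Complex.exp (Complex.I * u * w) = 2 * (Real.pi * coshExp x θ (-w)) := by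
    rw [← integral_const_mul, ← mul_assoc, ← h]
    congr 1; ext u
    push_cast
    rw [mul_neg, neg_neg]; ring
  exact mul_left_cancel₀ two_ne_zero h2

lemma hasDerivAt_coshExp (x θ w : ℝ) :
    HasDerivAt (coshExp x θ) (-x * Complex.sinh (w + θ * Complex.I) * coshExp x θ w) w := by
  have h1 := (((Complex.hasDerivAt_cosh (w + θ * Complex.I)).const_mul (-x : ℂ)).cexp).comp
    (𝕜 := ℝ) w (h := fun w : ℝ => (w + θ * Complex.I : ℂ))
    ((Complex.ofRealCLM.hasDerivAt (x := w)).add_const (θ * Complex.I))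
  refine HasDerivAt.congr_deriv h1 ?_
  simp [coshExp]
  ring

/-- The derivative in `w` of `integral_exp_mul_besselK`. -/
lemma integral_id_mul_exp_mul_besselK {x θ : ℝ} (hx : 0 < x)
    (hθ : θ ∈ Ioo (-(Real.pi / 2)) (Real.pi / 2)) (w : ℝ) :
    ∫ u : ℝ, (u : ℂ) * (Complex.exp (θ * u) * besselK u x) * Complex.exp (Complex.I * u * w) =
      -Complex.I * Real.pi * x * Complex.sinh (-w + θ * Complex.I) * coshExp x θ (-w) := by
  have hnorm : ∀ u w : ℝ, ‖Complex.exp (Complex.I * u * w)‖ = 1 := by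
    intro u w; rw [Complex.norm_exp]; simp
  have hI := integrable_exp_mul_besselK hx hθ
  have hJ := integrable_id_mul_exp_mul_besselK hx hθ
  have key := hasDerivAt_integral_of_dominated_loc_of_deriv_le (μ := volume) (x₀ := w)
    (F := fun (w u : ℝ) => Complex.exp (θ * u) * besselK u x * Complex.exp (Complex.I * u * w))
    (F' := fun (w u : ℝ) => Complex.I * ((u : ℂ) * (Complex.exp (θ * u) * besselK u x) *
      Complex.exp (Complex.I * u * w))) (univ_mem)
    (.of_forall fun w => hI.aestronglyMeasurable.mul (by fun_prop))
    (hI.mul_bdd (c := 1) (by fun_prop) (.of_forall fun u => (hnorm u w).le))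
    ((hJ.aestronglyMeasurable.mul (by fun_prop)).const_mul _)
    (.of_forall fun u w _ => by
      rw [norm_mul, norm_mul, hnorm, Complex.norm_I, one_mul, mul_one]) hJ.norm
    (.of_forall fun u w _ => by
      have h1 : HasDerivAt (fun w : ℝ => Complex.exp (Complex.I * u * w))
          (Complex.exp (Complex.I * u * w) * (Complex.I * u)) w := by
        have := ((hasDerivAt_id (w : ℂ)).const_mul (Complex.I * u)).cexp.comp_ofReal
        simpa using this
      refine (h1.const_mul (Complex.exp (θ * u) * besselK u x)).congr_deriv ?_
      ring)
  have h2 : HasDerivAt (fun w : ℝ => ∫ u : ℝ, Complex.exp (θ * u) * besselK u x *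
      Complex.exp (Complex.I * u * w))
      (Real.pi * (x * Complex.sinh (-w + θ * Complex.I) * coshExp x θ (-w))) w := by
    simp_rw [integral_exp_mul_besselK hx hθ]
    have h3 := ((hasDerivAt_coshExp x θ (-w)).scomp w (hasDerivAt_neg w)).const_mul
      (Real.pi : ℂ)
    refine HasDerivAt.congr_deriv h3 ?_
    simp
  have h4 := key.2.unique h2
  rw [integral_const_mul] at h4
  have h5 := congrArg (fun z => -Complex.I * z) h4
  simp only [← mul_assoc, neg_mul, Complex.I_mul_I, neg_neg, one_mul] at h5
  simp only [← mul_assoc, neg_mul]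
  exact h5

/-! ### The Fourier transform of the product kernel -/

/-- The Fourier transform `ξ ↦ ∫ tri a b (log s) e^{iξs} ds` over `s > 0`, written in the variable
`c = log s`. -/
noncomputable def triHat (a b ξ : ℝ) : ℂ :=
  ∫ c : ℝ, ((Real.exp c * tri a b c : ℝ) : ℂ) * Complex.exp (Complex.I * ξ * Real.exp c)

lemma integrable_exp_mul_mul_tri (a b M : ℝ) : Integrable fun c => Real.exp (M * c) * tri a b c := by
  refine Integrable.mono' (integrable_tri_mul_exp a b |M|) ?_ (.of_forall fun c => ?_)
  · have := continuous_tri a b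
    exact Continuous.aestronglyMeasurable (by fun_prop)
  · rw [Real.norm_of_nonneg (mul_nonneg (Real.exp_pos _).le (tri_pos _ _ _).le), mul_comm]
    refine mul_le_mul_of_nonneg_left (Real.exp_le_exp.2 ?_) (tri_pos _ _ _).le
    rw [← abs_mul]; exact le_abs_self _

lemma norm_exp_I_mul_mul (ξ s : ℝ) : ‖Complex.exp (Complex.I * ξ * s)‖ = 1 := by
  rw [Complex.norm_exp]; simp

/-- Integration by parts against `c ↦ exp (iξ e^c)`. -/
lemma integral_exp_mul_mul_exp_I {F F' : ℝ → ℝ} (hF : ∀ c, HasDerivAt F (F' c) c)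
    (h1 : Integrable F) (h2 : Integrable fun c => Real.exp c * F c) (h3 : Integrable F') (ξ : ℝ) :
    Complex.I * ξ * ∫ c : ℝ, ((Real.exp c * F c : ℝ) : ℂ) * Complex.exp (Complex.I * ξ * Real.exp c) =
      -∫ c : ℝ, (F' c : ℂ) * Complex.exp (Complex.I * ξ * Real.exp c) := by
  have hm : AEStronglyMeasurable (fun c : ℝ => Complex.exp (Complex.I * ξ * Real.exp c)) := by
    apply Continuous.aestronglyMeasurable; fun_prop
  have hI : ∀ {G : ℝ → ℝ}, Integrable G →
      Integrable fun c : ℝ => (G c : ℂ) * Complex.exp (Complex.I * ξ * Real.exp c) := fun hG =>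
    hG.ofReal.mul_bdd (c := 1) hm (.of_forall fun c => (norm_exp_I_mul_mul ξ _).le)
  have hd : ∀ c : ℝ, HasDerivAt
      (fun c : ℝ => (F c : ℂ) * Complex.exp (Complex.I * ξ * Real.exp c))
      ((F' c : ℂ) * Complex.exp (Complex.I * ξ * Real.exp c) +
        Complex.I * ξ * (((Real.exp c * F c : ℝ) : ℂ) *
          Complex.exp (Complex.I * ξ * Real.exp c))) c := by
    intro c
    have e1 := (((Real.hasDerivAt_exp c).ofReal_comp).const_mul (Complex.I * ξ)).cexp
    refine ((hF c).ofReal_comp.mul e1).congr_deriv ?_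
    push_cast; ring
  have h0 := integral_eq_zero_of_hasDerivAt_of_integrable hd
    ((hI h3).add ((hI h2).const_mul _)) (hI h1)
  rw [integral_add (hI h3) ((hI h2).const_mul _), integral_const_mul] at h0
  linear_combination h0

lemma hasDerivAt_tri (a b c : ℝ) :
    HasDerivAt (tri a b) (tri a b c * ((Real.exp (a + b) * Real.exp (-c) -
      (Real.exp (a - b) + Real.exp (b - a)) * Real.exp c) / 2)) c := by
  have h1 : HasDerivAt (fun c : ℝ => a + b - c) (-1) c := by
    simpa using (hasDerivAt_id c).const_sub (a + b)
  have h2 : HasDerivAt (fun c : ℝ => c + a - b) 1 c :=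
    ((hasDerivAt_id c).add_const a).sub_const b
  have h3 : HasDerivAt (fun c : ℝ => c + b - a) 1 c :=
    ((hasDerivAt_id c).add_const b).sub_const a
  have h4 := ((((h1.exp.add h2.exp).add h3.exp).neg.div_const 2).exp).const_mul (1 / 2)
  refine HasDerivAt.congr_deriv h4 ?_
  unfold tri
  simp only [Pi.add_apply, Pi.neg_apply]
  rw [show a + b - c = a + b + -c by ring, show c + a - b = a - b + c by ring,
    show c + b - a = b - a + c by ring]
  simp only [Real.exp_add]
  ring

/-- Two integrations by parts give quadratic decay of `triHat`, hence its integrability. -/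
lemma integrable_triHat (a b : ℝ) : Integrable (triHat a b) := by
  set p := Real.exp (a + b) with hp
  set q := Real.exp (a - b) + Real.exp (b - a) with hq
  set F2 : ℝ → ℝ := fun c => tri a b c * ((p * Real.exp (-2 * c) - q) / 2) with hF2
  set F3 : ℝ → ℝ := fun c => tri a b c * (((p * Real.exp (-c) - q * Real.exp c) / 2) *
    ((p * Real.exp (-2 * c) - q) / 2) - p * Real.exp (-2 * c)) with hF3
  have hE : ∀ M, Integrable fun c => Real.exp (M * c) * tri a b c :=
    integrable_exp_mul_mul_tri a b
  have hT : Integrable (tri a b) := by simpa using hE 0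
  have hd1 : ∀ c, HasDerivAt (tri a b) (Real.exp c * F2 c) c := by
    intro c
    refine (hasDerivAt_tri a b c).congr_deriv ?_
    have : Real.exp (-c) = Real.exp c * Real.exp (-2 * c) := by rw [← Real.exp_add]; ring_nf
    rw [hF2, this]; ring
  have hd2 : ∀ c, HasDerivAt F2 (F3 c) c := by
    intro c
    have e1 : HasDerivAt (fun c : ℝ => Real.exp (-2 * c)) (Real.exp (-2 * c) * -2) c := by
      simpa using ((hasDerivAt_id c).const_mul (-2 : ℝ)).exp
    refine ((hasDerivAt_tri a b c).mul (((e1.const_mul p).sub_const q).div_const 2)).congr_deriv ?_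
    simp only [hF3]; ring
  have hI1 : Integrable fun c => Real.exp c * tri a b c := by simpa using hE 1
  have hI2 : Integrable F2 := by
    refine (((hE (-2)).const_mul (p / 2)).sub (hT.const_mul (q / 2))).congr
      (.of_forall fun c => ?_)
    simp only [hF2, Pi.sub_apply]; ring
  have hI3 : Integrable fun c => Real.exp c * F2 c := by
    refine (((hE (-1)).const_mul (p / 2)).sub ((hE 1).const_mul (q / 2))).congr
      (.of_forall fun c => ?_)
    simp only [hF2, Pi.sub_apply]
    have : Real.exp (-1 * c) = Real.exp c * Real.exp (-2 * c) := by rw [← Real.exp_add]; ring_nf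
    rw [this, one_mul]; ring
  have hI4 : Integrable F3 := by
    refine (((((hE (-3)).const_mul (p * p / 4)).sub ((hE (-1)).const_mul (p * q / 2))).add
      ((hE 1).const_mul (q * q / 4))).sub ((hE (-2)).const_mul p)).congr (.of_forall fun c => ?_)
    simp only [hF3, Pi.sub_apply, Pi.add_apply]
    have e1 : Real.exp (-3 * c) = Real.exp (-c) * Real.exp (-2 * c) := by
      rw [← Real.exp_add]; ring_nf
    have e2 : Real.exp (-1 * c) = Real.exp (-c) := by ring_nf
    have e3 : Real.exp c * Real.exp (-2 * c) = Real.exp (-c) := by rw [← Real.exp_add]; ring_nf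
    rw [e1, e2, one_mul]
    linear_combination (tri a b c * p * q / 4) * e3
  set A := ∫ c, ‖Real.exp c * tri a b c‖
  set B := ∫ c, ‖F3 c‖
  have hb1 : ∀ ξ, ‖triHat a b ξ‖ ≤ A := by
    intro ξ
    refine (norm_integral_le_integral_norm _).trans (le_of_eq ?_)
    congr 1; ext c
    rw [norm_mul, norm_exp_I_mul_mul, mul_one, Complex.norm_real]
  have hb2 : ∀ ξ, ξ ^ 2 * ‖triHat a b ξ‖ ≤ B := by
    intro ξ
    have h1 := integral_exp_mul_mul_exp_I hd1 hT hI1 hI3 ξ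
    have h2 := integral_exp_mul_mul_exp_I hd2 hI2 hI3 hI4 ξ
    have h3 : Complex.I * ξ * (Complex.I * ξ * triHat a b ξ) =
        ∫ c : ℝ, (F3 c : ℂ) * Complex.exp (Complex.I * ξ * Real.exp c) := by
      rw [triHat, h1, mul_neg, h2, neg_neg]
    have h4 := congrArg norm h3
    simp only [norm_mul, Complex.norm_I, Complex.norm_real, Real.norm_eq_abs, one_mul] at h4
    rw [← mul_assoc, ← pow_two, sq_abs] at h4
    rw [h4]
    refine (norm_integral_le_integral_norm _).trans (le_of_eq ?_)
    congr 1; ext c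
    rw [norm_mul, norm_exp_I_mul_mul, mul_one, Complex.norm_real]
  have hmeas : AEStronglyMeasurable (triHat a b) := by
    have hc := continuous_tri a b
    exact (StronglyMeasurable.integral_prod_right (f := fun (ξ c : ℝ) =>
      ((Real.exp c * tri a b c : ℝ) : ℂ) * Complex.exp (Complex.I * ξ * Real.exp c))
      (by apply Continuous.stronglyMeasurable; unfold Function.uncurry; fun_prop)).aestronglyMeasurable
  refine Integrable.mono' (integrable_inv_one_add_sq.const_mul (A + B)) hmeas
    (.of_forall fun ξ => ?_)
  rw [← div_eq_mul_inv, le_div_iff₀ (by positivity)]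
  linarith [hb1 ξ, hb2 ξ]

/-- Fourier inversion recovers `tri a b` from `triHat a b`. -/
lemma integral_triHat_mul_exp (a b z : ℝ) :
    ∫ ξ : ℝ, triHat a b ξ * Complex.exp (-(Complex.I * ξ * Real.exp z)) =
      2 * Real.pi * tri a b z := by
  set f : ℝ → ℂ := (Ioi (0 : ℝ)).indicator fun s => (tri a b (Real.log s) : ℂ) with hf
  have himg : Real.exp '' univ = Ioi 0 := by rw [image_univ, Real.range_exp]
  have hder : ∀ x ∈ (univ : Set ℝ), HasDerivWithinAt Real.exp (Real.exp x) univ x :=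
    fun x _ => (Real.hasDerivAt_exp x).hasDerivWithinAt
  have hcomp : ∀ g : ℝ → ℂ, ∫ s in Ioi (0 : ℝ), g s = ∫ c : ℝ, (Real.exp c : ℂ) * g (Real.exp c) := by
    intro g
    rw [← himg, integral_image_eq_integral_abs_deriv_smul MeasurableSet.univ hder
      Real.exp_injective.injOn, setIntegral_univ]
    congr 1; ext c; rw [abs_of_pos (Real.exp_pos c), Complex.real_smul]
  have hfi : Integrable f := by
    rw [hf, integrable_indicator_iff measurableSet_Ioi, ← himg,
      integrableOn_image_iff_integrableOn_abs_deriv_smul MeasurableSet.univ hder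
      Real.exp_injective.injOn, integrableOn_univ]
    have := (integrable_exp_mul_mul_tri a b 1).ofReal (𝕜 := ℂ)
    refine this.congr (.of_forall fun c => ?_)
    simp [abs_of_pos (Real.exp_pos c)]
  have hF : ∀ ξ : ℝ, ∫ s, f s * Complex.exp (Complex.I * ξ * s) = triHat a b ξ := by
    intro ξ
    have : (fun s : ℝ => f s * Complex.exp (Complex.I * ξ * s)) = (Ioi (0 : ℝ)).indicator
        fun s => (tri a b (Real.log s) : ℂ) * Complex.exp (Complex.I * ξ * s) := by
      ext s
      rw [hf, indicator_mul_left]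
    rw [this, integral_indicator measurableSet_Ioi, hcomp, triHat]
    congr 1; ext c
    rw [Real.log_exp]; push_cast; ring
  have hz : 0 < Real.exp z := Real.exp_pos z
  have hcont : ContinuousAt f (Real.exp z) := by
    have h1 : ContinuousAt (fun s : ℝ => (tri a b (Real.log s) : ℂ)) (Real.exp z) :=
      Complex.continuous_ofReal.continuousAt.comp
        (((continuous_tri a b).continuousAt).comp (Real.continuousAt_log hz.ne'))
    refine h1.congr ?_
    filter_upwards [Ioi_mem_nhds hz] with s hs
    rw [hf, indicator_of_mem hs]
  have h := integral_fourier_mul_exp hfi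
    (by simp_rw [hF]; exact integrable_triHat a b) hcont
  simp_rw [hF] at h
  rw [h, hf, indicator_of_mem (show Real.exp z ∈ Ioi (0:ℝ) from hz), Real.log_exp]

/-! ### Products of two Bessel functions at the edge of the strip -/

/-- A bound for `e^{11|u|/10} |K_{iu}(e^z)|` that is uniform in `u`. The rate `11/10` is below `π/2`
while three times the rate exceeds `π`. -/
noncomputable def besselBound (z : ℝ) : ℝ := besselK 0 (Real.exp z * Real.cos (11 / 10))

lemma eleven_tenths_lt : (11 / 10 : ℝ) < Real.pi / 2 := by linarith [Real.pi_gt_d2]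

lemma cos_eleven_tenths_pos : 0 < Real.cos (11 / 10) :=
  Real.cos_pos_of_mem_Ioo ⟨by linarith [Real.pi_pos], eleven_tenths_lt⟩

lemma besselBound_pos (z : ℝ) : 0 < besselBound z :=
  besselK_zero_pos (mul_pos (Real.exp_pos z) cos_eleven_tenths_pos)

lemma abs_besselK_le_besselBound (u z : ℝ) :
    |besselK u (Real.exp z)| ≤ Real.exp (-(11 / 10) * |u|) * besselBound z :=
  abs_besselK_le_exp u (Real.exp_pos z) (by norm_num) eleven_tenths_lt

lemma exists_besselK_zero_mul_le {N c : ℝ} (hN : 0 < N) (hc : 0 < c) :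
    ∃ C, 0 < C ∧ ∀ x, besselK 0 (Real.exp x * c) ≤ C * Real.exp (-N * x) := by
  obtain ⟨C, hC, h⟩ := exists_besselK_zero_exp_le hN
  refine ⟨C * Real.exp (-N * Real.log c), by positivity, fun x => ?_⟩
  have := h (x + Real.log c)
  rw [Real.exp_add, Real.exp_log hc, mul_add, Real.exp_add] at this
  linarith

lemma integrable_tri_mul_besselK_zero_mul (a b : ℝ) {k : ℝ} (hk : 0 < k) :
    Integrable fun c => tri a b c * besselK 0 (Real.exp c * k) := by
  obtain ⟨C, hC, hK⟩ := exists_besselK_zero_mul_le one_pos hk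
  refine Integrable.mono' ((integrable_exp_mul_mul_tri a b (-1)).const_mul C) ?_
    (.of_forall fun c => ?_)
  · exact ((continuous_tri a b).measurable.mul (measurable_const.besselK
      (Real.measurable_exp.mul_const k))).aestronglyMeasurable
  · rw [Real.norm_of_nonneg (mul_nonneg (tri_pos _ _ _).le
      (besselK_zero_pos (mul_pos (Real.exp_pos c) hk)).le)]
    have := mul_le_mul_of_nonneg_left (hK c) (tri_pos a b c).le
    linarith

lemma continuous_coshExp_angle (x w : ℝ) : Continuous fun θ => coshExp x θ w := by
  unfold coshExp
  have := Complex.continuous_cosh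
  fun_prop

lemma eventually_mem_Ioo_nhdsLT_pi_div_two :
    ∀ᶠ θ in 𝓝[<] (Real.pi / 2), θ ∈ Ioo (0 : ℝ) (Real.pi / 2) :=
  Ioo_mem_nhdsLT (by have := Real.pi_pos; positivity)

/-- The product formula averages the Fourier transform of `u e^{θu} K_{iu}(e^c)` over `c`, which gives
the Fourier transform of `u e^{θu} K_{iu}(e^a) K_{iu}(e^b)` for `|θ| < π / 2`. -/
lemma integral_id_mul_exp_mul_besselK_mul_besselK (a b w : ℝ) {θ : ℝ}
    (hθ : θ ∈ Ioo (-(Real.pi / 2)) (Real.pi / 2)) :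
    ∫ u : ℝ, (u : ℂ) * (Complex.exp (θ * u) * ((besselK u (Real.exp a) * besselK u (Real.exp b) : ℝ)
      : ℂ)) * Complex.exp (Complex.I * u * w) =
    ∫ c : ℝ, (tri a b c : ℂ) * (-Complex.I * Real.pi * Real.exp c *
      Complex.sinh (-w + θ * Complex.I) * coshExp (Real.exp c) θ (-w)) := by
  obtain ⟨θ', h1, h2, h3⟩ := exists_angle_gt hθ
  have hc' : 0 < Real.cos θ' := Real.cos_pos_of_mem_Ioo ⟨by linarith [Real.pi_pos], h3⟩
  have hnorm : ∀ u w : ℝ, ‖Complex.exp (Complex.I * u * w)‖ = 1 := by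
    intro u w; rw [Complex.norm_exp]; simp
  have hF : Integrable (Function.uncurry fun u c : ℝ => (tri a b c : ℂ) *
      ((u : ℂ) * (Complex.exp (θ * u) * besselK u (Real.exp c)) *
        Complex.exp (Complex.I * u * w))) (volume.prod volume) := by
    refine Integrable.mono' ((integrable_abs_mul_exp_neg_mul_abs (sub_pos.2 h1)).mul_prod
      (integrable_tri_mul_besselK_zero_mul a b hc')) ?_ (.of_forall fun p => ?_)
    · have e1 : Measurable fun p : ℝ × ℝ => besselK p.1 (Real.exp p.2) :=
        measurable_fst.besselK (Real.measurable_exp.comp measurable_snd)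
      have e2 := (continuous_tri a b).measurable
      apply Measurable.aestronglyMeasurable
      unfold Function.uncurry
      fun_prop
    · obtain ⟨u, c⟩ := p
      simp only [Function.uncurry_apply_pair]
      rw [norm_mul, norm_mul, hnorm, mul_one, norm_mul (u : ℂ), Complex.norm_real, Complex.norm_real,
        Real.norm_eq_abs, Real.norm_eq_abs, abs_of_pos (tri_pos a b c)]
      have := norm_exp_mul_besselK_le (u := u) (θ := θ) (Real.exp_pos c) h2 h3
      have ht := (tri_pos a b c).le
      calc _ ≤ tri a b c * (|u| * (Real.exp (-(θ' - |θ|) * |u|) *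
            besselK 0 (Real.exp c * Real.cos θ'))) := by gcongr
        _ = _ := by ring
  have hR : ∀ c : ℝ, (tri a b c : ℂ) * (-Complex.I * Real.pi * Real.exp c *
      Complex.sinh (-w + θ * Complex.I) * coshExp (Real.exp c) θ (-w)) =
      ∫ u : ℝ, (tri a b c : ℂ) * ((u : ℂ) * (Complex.exp (θ * u) * besselK u (Real.exp c)) *
        Complex.exp (Complex.I * u * w)) := by
    intro c
    rw [integral_const_mul, integral_id_mul_exp_mul_besselK (Real.exp_pos c) hθ]
  simp_rw [hR]
  rw [← integral_integral_swap hF]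
  congr 1; ext u
  rw [← integral_tri_mul_besselK, ← integral_complex_ofReal, ← integral_const_mul,
    ← integral_const_mul, ← integral_mul_const]
  congr 1; ext c
  push_cast; ring

/-- The two factors `K` together decay at the rate `11 / 5 > π / 2`, so the bound is integrable and
holds up to the edge of the strip. -/
lemma norm_mul_exp_mul_besselK_mul_besselK_le (a b w u : ℝ) {θ : ℝ}
    (hθ : θ ∈ Icc 0 (Real.pi / 2)) :
    ‖(u : ℂ) * (Complex.exp (θ * u) * ((besselK u (Real.exp a) * besselK u (Real.exp b) : ℝ) : ℂ)) *
      Complex.exp (Complex.I * u * w)‖ ≤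
    |u| * Real.exp (-(11 / 5 - Real.pi / 2) * |u|) * (besselBound a * besselBound b) := by
  have hnorm : ‖Complex.exp (Complex.I * u * w)‖ = 1 := by
    rw [Complex.norm_exp]; simp
  rw [norm_mul, hnorm, mul_one, norm_mul, norm_mul, Complex.norm_real, Complex.norm_real,
    Real.norm_eq_abs, Real.norm_eq_abs, abs_mul, Complex.norm_exp]
  have h3 : (θ * u : ℂ).re ≤ Real.pi / 2 * |u| := by
    rw [← Complex.ofReal_mul, Complex.ofReal_re]
    calc θ * u ≤ θ * |u| := mul_le_mul_of_nonneg_left (le_abs_self u) hθ.1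
      _ ≤ _ := mul_le_mul_of_nonneg_right hθ.2 (abs_nonneg u)
  have ha := abs_besselK_le_besselBound u a
  have hb := abs_besselK_le_besselBound u b
  calc _ ≤ |u| * (Real.exp (Real.pi / 2 * |u|) * ((Real.exp (-(11 / 10) * |u|) * besselBound a) *
        (Real.exp (-(11 / 10) * |u|) * besselBound b))) := by
        gcongr
        exact mul_nonneg (Real.exp_pos _).le (besselBound_pos a).le
    _ = |u| * (Real.exp (Real.pi / 2 * |u|) * Real.exp (-(11 / 10) * |u|) *
        Real.exp (-(11 / 10) * |u|)) * (besselBound a * besselBound b) := by ring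
    _ = _ := by rw [← Real.exp_add, ← Real.exp_add]; ring_nf

lemma aestronglyMeasurable_mul_exp_mul_besselK_mul_besselK (a b w θ : ℝ) :
    AEStronglyMeasurable fun u : ℝ => (u : ℂ) * (Complex.exp (θ * u) *
      ((besselK u (Real.exp a) * besselK u (Real.exp b) : ℝ) : ℂ)) *
      Complex.exp (Complex.I * u * w) := by
  have e1 : ∀ a, Measurable fun u : ℝ => besselK u (Real.exp a) := fun a =>
    measurable_id.besselK measurable_const
  have e2 := e1 a
  have e3 := e1 b
  apply Measurable.aestronglyMeasurable
  fun_prop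

/-- The limit `θ → π / 2` of `integral_id_mul_exp_mul_besselK_mul_besselK`. At the edge of the strip
`cosh (w + iπ/2) = i sinh w`, so the right side becomes a Fourier transform in the variable
`sinh w`. -/
lemma integral_id_mul_exp_pi_div_two (a b w : ℝ) :
    ∫ u : ℝ, (u : ℂ) * (Complex.exp ((Real.pi / 2 : ℝ) * u) *
      ((besselK u (Real.exp a) * besselK u (Real.exp b) : ℝ) : ℂ)) * Complex.exp (Complex.I * u * w) =
    Real.pi * Real.cosh w * triHat a b (Real.sinh w) := by
  have hpi := Real.pi_pos
  have hδ : 0 < 11 / 5 - Real.pi / 2 := by linarith [Real.pi_lt_d2]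
  have hL := tendsto_integral_filter_of_dominated_convergence (μ := volume)
    (l := 𝓝[<] (Real.pi / 2))
    (F := fun (θ u : ℝ) => (u : ℂ) * (Complex.exp (θ * u) *
      ((besselK u (Real.exp a) * besselK u (Real.exp b) : ℝ) : ℂ)) * Complex.exp (Complex.I * u * w))
    (f := fun u : ℝ => (u : ℂ) * (Complex.exp ((Real.pi / 2 : ℝ) * u) *
      ((besselK u (Real.exp a) * besselK u (Real.exp b) : ℝ) : ℂ)) * Complex.exp (Complex.I * u * w))
    _ (.of_forall fun θ => aestronglyMeasurable_mul_exp_mul_besselK_mul_besselK a b w θ)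
    (eventually_mem_Ioo_nhdsLT_pi_div_two.mono fun θ hθ => .of_forall fun u =>
      norm_mul_exp_mul_besselK_mul_besselK_le a b w u ⟨hθ.1.le, hθ.2.le⟩)
    ((integrable_abs_mul_exp_neg_mul_abs hδ).mul_const _)
    (.of_forall fun u => by
      have h1 : Continuous fun θ : ℝ => (u : ℂ) * (Complex.exp (θ * u) *
        ((besselK u (Real.exp a) * besselK u (Real.exp b) : ℝ) : ℂ)) *
          Complex.exp (Complex.I * u * w) := by fun_prop
      exact (h1.tendsto _).mono_left nhdsWithin_le_nhds)
  have hR := tendsto_integral_filter_of_dominated_convergence (μ := volume)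
    (l := 𝓝[<] (Real.pi / 2))
    (F := fun (θ c : ℝ) => (tri a b c : ℂ) * (-Complex.I * Real.pi * Real.exp c *
      Complex.sinh (-w + θ * Complex.I) * coshExp (Real.exp c) θ (-w)))
    (f := fun c : ℝ => (tri a b c : ℂ) * (-Complex.I * Real.pi * Real.exp c *
      Complex.sinh (-w + (Real.pi / 2 : ℝ) * Complex.I) *
        coshExp (Real.exp c) (Real.pi / 2) (-w)))
    (fun c => Real.pi * Real.cosh w * (Real.exp (1 * c) * tri a b c)) (.of_forall fun θ => by
      have e2 := (continuous_tri a b)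
      have e3 := Complex.continuous_cosh
      apply Continuous.aestronglyMeasurable
      unfold coshExp
      fun_prop)
    (eventually_mem_Ioo_nhdsLT_pi_div_two.mono fun θ hθ => .of_forall fun c => by
      have hcos : 0 < Real.cos θ := Real.cos_pos_of_mem_Ioo ⟨by linarith [hθ.1], hθ.2⟩
      have e1 := norm_sinh_add_mul_I_le (-w) θ
      rw [Real.cosh_neg, Complex.ofReal_neg] at e1
      have e2 : ‖coshExp (Real.exp c) θ (-w)‖ ≤ 1 := by
        rw [norm_coshExp, Real.exp_le_one_iff]
        have := mul_pos (mul_pos (Real.exp_pos c) hcos) (Real.cosh_pos (-w))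
        linarith
      simp only [norm_mul, norm_neg, Complex.norm_I, Complex.norm_real, Real.norm_eq_abs,
        abs_of_pos (tri_pos a b c), abs_of_pos hpi, abs_of_pos (Real.exp_pos c), one_mul]
      have ht := (tri_pos a b c).le
      calc _ ≤ tri a b c * (Real.pi * Real.exp c * Real.cosh w * 1) := by gcongr
        _ = _ := by ring)
    ((integrable_exp_mul_mul_tri a b 1).const_mul _)
    (.of_forall fun c => by
      have e1 := continuous_coshExp_angle (Real.exp c) (-w)
      have e3 := Complex.continuous_sinh
      have h1 : Continuous fun θ : ℝ => (tri a b c : ℂ) * (-Complex.I * Real.pi * Real.exp c *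
        Complex.sinh (-w + θ * Complex.I) * coshExp (Real.exp c) θ (-w)) := by fun_prop
      exact (h1.tendsto _).mono_left nhdsWithin_le_nhds)
  have heq := tendsto_nhds_unique (hL.congr' (eventually_mem_Ioo_nhdsLT_pi_div_two.mono
    fun θ hθ => integral_id_mul_exp_mul_besselK_mul_besselK a b w ⟨by linarith [hθ.1], hθ.2⟩)) hR
  rw [heq, triHat, ← integral_const_mul]
  congr 1; ext c
  have e1 : Complex.sinh (-w + (Real.pi / 2 : ℝ) * Complex.I) = Complex.I * Real.cosh w := by
    rw [Complex.sinh_add, Complex.cosh_mul_I, Complex.sinh_mul_I, Complex.cosh_neg]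
    push_cast
    rw [Complex.cos_pi_div_two, Complex.sin_pi_div_two]; ring
  have e2 : Complex.cosh (-w + (Real.pi / 2 : ℝ) * Complex.I) = -(Complex.I * Real.sinh w) := by
    rw [Complex.cosh_add, Complex.cosh_mul_I, Complex.sinh_mul_I, Complex.sinh_neg]
    push_cast
    rw [Complex.cos_pi_div_two, Complex.sin_pi_div_two]; ring
  rw [e1, coshExp, Complex.ofReal_neg, e2]
  have e3 : -((Real.exp c : ℝ) : ℂ) * -(Complex.I * Real.sinh w) =
    Complex.I * Real.sinh w * Real.exp c := by ring
  rw [e3]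
  push_cast
  linear_combination (-(tri a b c : ℂ) * Real.pi * Complex.exp c * Complex.cosh w *
    Complex.exp (Complex.I * Complex.sinh w * Complex.exp c)) * Complex.I_sq

/-- Substitution `ξ = sinh w` over the whole line. -/
lemma integrable_cosh_mul_comp_sinh {g : ℝ → ℂ} :
    Integrable (fun w => (Real.cosh w : ℂ) * g (Real.sinh w)) ↔ Integrable g := by
  have himg : Real.sinh '' univ = univ := by rw [image_univ, Real.sinh_surjective.range_eq]
  have := integrableOn_image_iff_integrableOn_abs_deriv_smul MeasurableSet.univ
    (fun x _ => (Real.hasDerivAt_sinh x).hasDerivWithinAt) Real.sinh_injective.injOn g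
  rw [himg, integrableOn_univ, integrableOn_univ] at this
  rw [this]
  refine integrable_congr (.of_forall fun w => ?_)
  simp only [abs_of_pos (Real.cosh_pos w), Complex.real_smul]

lemma integral_cosh_mul_comp_sinh (g : ℝ → ℂ) :
    ∫ w, (Real.cosh w : ℂ) * g (Real.sinh w) = ∫ ξ, g ξ := by
  have himg : Real.sinh '' univ = univ := by rw [image_univ, Real.sinh_surjective.range_eq]
  have := integral_image_eq_integral_abs_deriv_smul MeasurableSet.univ
    (fun x _ => (Real.hasDerivAt_sinh x).hasDerivWithinAt) Real.sinh_injective.injOn g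
  rw [himg, setIntegral_univ, setIntegral_univ] at this
  rw [this]
  congr 1; ext w
  rw [abs_of_pos (Real.cosh_pos w), Complex.real_smul]

/-! ### Spectral integrals of triple products -/

/-- The evaluation of the triple product over the whole line: Parseval's identity with the factor
`e^{θu} K_{iu}(e^z)`, in the limit `θ → π / 2`. -/
lemma integral_id_mul_exp_pi_mul_besselK (a b z : ℝ) :
    ∫ u : ℝ, u * Real.exp (Real.pi * u) * (besselK u (Real.exp a) * besselK u (Real.exp b) *
      besselK u (Real.exp z)) = Real.pi ^ 2 * tri a b z := by
  have hpi := Real.pi_pos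
  set U : ℝ → ℂ := fun u => (u : ℂ) * (Complex.exp ((Real.pi / 2 : ℝ) * u) *
      ((besselK u (Real.exp a) * besselK u (Real.exp b) : ℝ) : ℂ)) with hU
  have hUm : AEStronglyMeasurable U := by
    simpa only [mul_zero, Complex.ofReal_zero, Complex.exp_zero, mul_one] using
      aestronglyMeasurable_mul_exp_mul_besselK_mul_besselK a b 0 (Real.pi / 2)
  have hUb : ∀ u, ‖U u‖ ≤
      |u| * Real.exp (-(11 / 5 - Real.pi / 2) * |u|) * (besselBound a * besselBound b) := by
    intro u
    simpa only [mul_zero, Complex.ofReal_zero, Complex.exp_zero, mul_one] using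
      norm_mul_exp_mul_besselK_mul_besselK_le a b 0 u
      (θ := Real.pi / 2) ⟨by positivity, le_rfl⟩
  have hUi : Integrable U := Integrable.mono' ((integrable_abs_mul_exp_neg_mul_abs
    (by linarith [Real.pi_lt_d2] : 0 < 11 / 5 - Real.pi / 2)).mul_const
      (besselBound a * besselBound b)) hUm (.of_forall hUb)
  have hnorm : ∀ u w : ℝ, ‖Complex.exp (Complex.I * u * w)‖ = 1 := by
    intro u w; rw [Complex.norm_exp]; simp
  set V : ℝ → ℂ := fun w => Real.pi * Real.cosh w * triHat a b (Real.sinh w) with hV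
  have hVU : ∀ w : ℝ, ∫ u : ℝ, U u * Complex.exp (Complex.I * u * w) = V w := fun w =>
    integral_id_mul_exp_pi_div_two a b w
  have hVi : Integrable V := by
    refine ((integrable_cosh_mul_comp_sinh.2 (integrable_triHat a b)).const_mul
      (Real.pi : ℂ)).congr (.of_forall fun w => ?_)
    simp only [hV]; ring
  -- Parseval's identity inside the strip
  have hP : ∀ θ ∈ Ioo (0 : ℝ) (Real.pi / 2),
      ∫ u : ℝ, U u * (Complex.exp (θ * u) * (2 * besselK u (Real.exp z))) =
      ∫ w : ℝ, coshExp (Real.exp z) θ w * V w := by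
    intro θ hθ
    have hmem : θ ∈ Ioo (-(Real.pi / 2)) (Real.pi / 2) := ⟨by linarith [hθ.1], hθ.2⟩
    have hc := integrable_coshExp (Real.exp_pos z) (Real.cos_pos_of_mem_Ioo hmem)
    have hF : Integrable (Function.uncurry fun u w : ℝ => U u * coshExp (Real.exp z) θ w *
        Complex.exp (Complex.I * u * w)) (volume.prod volume) := by
      refine (hUi.mul_prod hc).mul_bdd (c := 1) ?_ (.of_forall fun p => (hnorm p.1 p.2).le)
      apply Continuous.aestronglyMeasurable
      fun_prop
    calc _ = ∫ u : ℝ, ∫ w : ℝ, U u * coshExp (Real.exp z) θ w *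
          Complex.exp (Complex.I * u * w) := by
          congr 1; ext u
          rw [← integral_coshExp_mul u (Real.exp_pos z) hmem, ← integral_const_mul]
          congr 1; ext w; ring
      _ = _ := by
          rw [integral_integral_swap hF]
          congr 1; ext w
          rw [← hVU, ← integral_const_mul]
          congr 1; ext u; ring
  have hδ : 0 < 33 / 10 - Real.pi := by linarith [Real.pi_lt_d2]
  have hKm : Measurable fun u : ℝ => besselK u (Real.exp z) := measurable_id.besselK measurable_const
  have hL := tendsto_integral_filter_of_dominated_convergence (μ := volume)
    (l := 𝓝[<] (Real.pi / 2))
    (F := fun (θ u : ℝ) => U u * (Complex.exp (θ * u) * (2 * besselK u (Real.exp z))))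
    (f := fun u : ℝ => U u * (Complex.exp ((Real.pi / 2 : ℝ) * u) * (2 * besselK u (Real.exp z))))
    (fun u => |u| * Real.exp (-(33 / 10 - Real.pi) * |u|) *
      (2 * (besselBound a * besselBound b * besselBound z)))
    (.of_forall fun θ => hUm.mul (Measurable.aestronglyMeasurable (by fun_prop)))
    (eventually_mem_Ioo_nhdsLT_pi_div_two.mono fun θ hθ => .of_forall fun u => by
      have h1 := abs_besselK_le_besselBound u z
      have h3 : (θ * u : ℂ).re ≤ Real.pi / 2 * |u| := by
        rw [← Complex.ofReal_mul, Complex.ofReal_re]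
        calc θ * u ≤ θ * |u| := mul_le_mul_of_nonneg_left (le_abs_self u) hθ.1.le
          _ ≤ _ := mul_le_mul_of_nonneg_right hθ.2.le (abs_nonneg u)
      have e2 : ‖(2 : ℂ)‖ = 2 := by simp
      simp only [norm_mul, Complex.norm_exp, Complex.norm_real, Real.norm_eq_abs, e2]
      have hba := besselBound_pos a
      have hbb := besselBound_pos b
      calc _ ≤ |u| * Real.exp (-(11 / 5 - Real.pi / 2) * |u|) * (besselBound a * besselBound b) *
            (Real.exp (Real.pi / 2 * |u|) * (2 * (Real.exp (-(11 / 10) * |u|) * besselBound z))) := by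
            gcongr
            exact hUb u
        _ = |u| * (Real.exp (-(11 / 5 - Real.pi / 2) * |u|) * Real.exp (Real.pi / 2 * |u|) *
            Real.exp (-(11 / 10) * |u|)) *
            (2 * (besselBound a * besselBound b * besselBound z)) := by ring
        _ = _ := by rw [← Real.exp_add, ← Real.exp_add]; ring_nf)
    ((integrable_abs_mul_exp_neg_mul_abs hδ).mul_const _)
    (.of_forall fun u => by
      have h1 : Continuous fun θ : ℝ => U u * (Complex.exp (θ * u) *
        (2 * besselK u (Real.exp z))) := by fun_prop
      exact (h1.tendsto _).mono_left nhdsWithin_le_nhds)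
  have hR := tendsto_integral_filter_of_dominated_convergence (μ := volume)
    (l := 𝓝[<] (Real.pi / 2))
    (F := fun (θ w : ℝ) => coshExp (Real.exp z) θ w * V w)
    (f := fun w : ℝ => coshExp (Real.exp z) (Real.pi / 2) w * V w)
    (fun w => ‖V w‖)
    (.of_forall fun θ => (continuous_coshExp _ θ).aestronglyMeasurable.mul hVi.aestronglyMeasurable)
    (eventually_mem_Ioo_nhdsLT_pi_div_two.mono fun θ hθ => .of_forall fun w => by
      have hcos : 0 < Real.cos θ := Real.cos_pos_of_mem_Ioo ⟨by linarith [hθ.1], hθ.2⟩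
      have e2 : ‖coshExp (Real.exp z) θ w‖ ≤ 1 := by
        rw [norm_coshExp, Real.exp_le_one_iff]
        have := mul_pos (mul_pos (Real.exp_pos z) hcos) (Real.cosh_pos w)
        linarith
      rw [norm_mul]
      exact mul_le_of_le_one_left (norm_nonneg _) e2)
    hVi.norm
    (.of_forall fun w => by
      have e1 := continuous_coshExp_angle (Real.exp z) w
      have h1 : Continuous fun θ : ℝ => coshExp (Real.exp z) θ w * V w := by fun_prop
      exact (h1.tendsto _).mono_left nhdsWithin_le_nhds)
  have heq := tendsto_nhds_unique (hL.congr' (eventually_mem_Ioo_nhdsLT_pi_div_two.mono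
    fun θ hθ => hP θ hθ)) hR
  -- At `θ = π / 2` the substitution `ξ = sinh w` reduces the right side to Fourier inversion.
  have hright : ∫ w : ℝ, coshExp (Real.exp z) (Real.pi / 2) w * V w =
      2 * (Real.pi ^ 2 * tri a b z) := by
    have h1 : ∀ w : ℝ, coshExp (Real.exp z) (Real.pi / 2) w * V w = Real.pi * ((Real.cosh w : ℂ) *
        (fun ξ : ℝ => triHat a b ξ * Complex.exp (-(Complex.I * ξ * Real.exp z))) (Real.sinh w)) := by
      intro w
      have e2 : Complex.cosh (w + (Real.pi / 2 : ℝ) * Complex.I) = Complex.I * Real.sinh w := by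
        rw [Complex.cosh_add, Complex.cosh_mul_I, Complex.sinh_mul_I]
        push_cast
        rw [Complex.cos_pi_div_two, Complex.sin_pi_div_two]; ring
      rw [coshExp, e2]
      have e3 : -((Real.exp z : ℝ) : ℂ) * (Complex.I * Real.sinh w) =
        -(Complex.I * Real.sinh w * Real.exp z) := by ring
      rw [e3]
      simp only [hV]
      ring
    refine (integral_congr_ae (.of_forall h1)).trans ?_
    rw [integral_const_mul, integral_cosh_mul_comp_sinh (fun ξ : ℝ =>
      triHat a b ξ * Complex.exp (-(Complex.I * ξ * Real.exp z))), integral_triHat_mul_exp]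
    ring
  rw [hright] at heq
  have h2 : ∀ u : ℝ, U u * (Complex.exp ((Real.pi / 2 : ℝ) * u) * (2 * besselK u (Real.exp z))) =
      ((2 * (u * Real.exp (Real.pi * u) * (besselK u (Real.exp a) * besselK u (Real.exp b) *
        besselK u (Real.exp z))) : ℝ) : ℂ) := by
    intro u
    have e1 : Complex.exp (Real.pi * u) = Complex.exp ((Real.pi / 2 : ℝ) * u) *
        Complex.exp ((Real.pi / 2 : ℝ) * u) := by
      rw [← Complex.exp_add]; congr 1; push_cast; ring
    push_cast
    rw [e1]
    simp only [hU]
    push_cast; ring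
  simp_rw [h2] at heq
  rw [integral_complex_ofReal, integral_const_mul] at heq
  have h3 : 2 * ∫ u : ℝ, u * Real.exp (Real.pi * u) * (besselK u (Real.exp a) *
      besselK u (Real.exp b) * besselK u (Real.exp z)) = 2 * (Real.pi ^ 2 * tri a b z) := by
    exact_mod_cast heq
  linarith

/-- The density of the spectral measure: `1 / |Γ(iu)|² = u sinh(πu) / π`. -/
noncomputable def spectralDensity (u : ℝ) : ℝ := 2 / Real.pi ^ 2 * u * Real.sinh (Real.pi * u)

lemma spectralDensity_nonneg {u : ℝ} (hu : 0 < u) : 0 ≤ spectralDensity u := by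
  have hs : 0 < Real.sinh (Real.pi * u) := Real.sinh_pos_iff.2 (mul_pos Real.pi_pos hu)
  unfold spectralDensity; positivity

lemma spectralDensity_le {u : ℝ} (hu : 0 < u) :
    spectralDensity u ≤ u * Real.exp (Real.pi * u) := by
  have hp : 2 / Real.pi ^ 2 ≤ 1 := by
    rw [div_le_one (by positivity)]; nlinarith [Real.pi_gt_three]
  have hsi : Real.sinh (Real.pi * u) ≤ Real.exp (Real.pi * u) := by
    rw [Real.sinh_eq]
    linarith [Real.exp_pos (Real.pi * u), Real.exp_pos (-(Real.pi * u))]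
  have hs : 0 < Real.sinh (Real.pi * u) := Real.sinh_pos_iff.2 (mul_pos Real.pi_pos hu)
  calc spectralDensity u ≤ 1 * u * Real.exp (Real.pi * u) := by unfold spectralDensity; gcongr
    _ = _ := by rw [one_mul]

lemma spectralMeasure_eq : spectralMeasure = (volume.restrict (Ioi (0 : ℝ))).withDensity
    fun u => ENNReal.ofReal (spectralDensity u) := by
  refine withDensity_congr_ae ((ae_restrict_iff' measurableSet_Ioi).2 (.of_forall fun u hu => ?_))
  simp only []
  rw [norm_sq_Gamma_I_mul hu, spectralDensity]

lemma measurable_spectralDensity : Measurable spectralDensity := by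
  unfold spectralDensity; fun_prop

lemma integral_spectralMeasure (φ : ℝ → ℝ) :
    ∫ u, φ u ∂spectralMeasure = ∫ u in Ioi (0 : ℝ), spectralDensity u * φ u := by
  rw [spectralMeasure_eq, integral_withDensity_eq_integral_toReal_smul
    measurable_spectralDensity.ennreal_ofReal (by simp)]
  refine setIntegral_congr_fun measurableSet_Ioi fun u hu => ?_
  simp only [ENNReal.toReal_ofReal (spectralDensity_nonneg hu), smul_eq_mul]

lemma integrable_spectralMeasure_iff (φ : ℝ → ℝ) :
    Integrable φ spectralMeasure ↔ IntegrableOn (fun u => spectralDensity u * φ u) (Ioi 0) := by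
  rw [spectralMeasure_eq, integrable_withDensity_iff_integrable_smul'
    measurable_spectralDensity.ennreal_ofReal (by simp)]
  refine integrable_congr ((ae_restrict_iff' measurableSet_Ioi).2 (.of_forall fun u hu => ?_))
  simp only [ENNReal.toReal_ofReal (spectralDensity_nonneg hu), smul_eq_mul]

/-- The density of the spectral measure grows like `u e^{πu}`, and `33 / 10 > π`. This is why
three factors of decay rate `11 / 10` are needed in every spectral integral. -/
lemma integrable_exp_spectralMeasure :
    Integrable (fun u => Real.exp (-(33 / 10) * |u|)) spectralMeasure := by
  have hδ : 0 < 33 / 10 - Real.pi := by linarith [Real.pi_lt_d2]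
  rw [integrable_spectralMeasure_iff]
  have hm := measurable_spectralDensity
  refine Integrable.mono' (integrable_abs_mul_exp_neg_mul_abs hδ).integrableOn
    (by apply Measurable.aestronglyMeasurable; fun_prop)
    ((ae_restrict_iff' measurableSet_Ioi).2 (.of_forall fun u hu => ?_))
  have hu' : 0 < u := hu
  rw [Real.norm_of_nonneg (mul_nonneg (spectralDensity_nonneg hu) (Real.exp_pos _).le)]
  calc _ ≤ u * Real.exp (Real.pi * u) * Real.exp (-(33 / 10) * |u|) := by
        gcongr; exact spectralDensity_le hu
    _ = _ := by
        rw [mul_assoc, ← Real.exp_add, abs_of_pos hu']; ring_nf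

lemma integral_eq_integral_Ioi_add {f : ℝ → ℝ} (hf : Integrable f) :
    ∫ u, f u = ∫ u in Ioi (0 : ℝ), (f u + f (-u)) := by
  have h1 := integral_add_compl (measurableSet_Ioi (a := (0 : ℝ))) hf
  have h2 : ∫ u in (Ioi (0 : ℝ))ᶜ, f u = ∫ u in Ioi (0 : ℝ), f (-u) := by
    rw [compl_Ioi, integral_comp_neg_Ioi, neg_zero]
  rw [← h1, h2, integral_add hf.integrableOn hf.comp_neg.integrableOn]

/-- The spectral integral of a triple product is `tri`; this is the inversion of the product
formula. -/
lemma integral_besselK_mul_besselK_mul_besselK (a b z : ℝ) :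
    ∫ u, besselK u (Real.exp z) * besselK u (Real.exp a) * besselK u (Real.exp b) ∂spectralMeasure =
      tri a b z := by
  have hpi := Real.pi_pos
  have hδ : 0 < 33 / 10 - Real.pi := by linarith [Real.pi_lt_d2]
  have hm : ∀ a, Measurable fun u : ℝ => besselK u (Real.exp a) := fun a =>
    measurable_id.besselK measurable_const
  have hi : Integrable fun u : ℝ => u * Real.exp (Real.pi * u) * (besselK u (Real.exp a) *
      besselK u (Real.exp b) * besselK u (Real.exp z)) := by
    refine Integrable.mono' ((integrable_abs_mul_exp_neg_mul_abs hδ).mul_const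
      (besselBound a * besselBound b * besselBound z)) ?_ (.of_forall fun u => ?_)
    · have := hm a
      have := hm b
      have := hm z
      exact Measurable.aestronglyMeasurable (by fun_prop)
    · simp only [norm_mul, Real.norm_eq_abs, Real.abs_exp]
      have h1 := abs_besselK_le_besselBound u a
      have h2 := abs_besselK_le_besselBound u b
      have h3 := abs_besselK_le_besselBound u z
      have hba := besselBound_pos a
      have hbb := besselBound_pos b
      have h4 : Real.pi * u ≤ Real.pi * |u| := by gcongr; exact le_abs_self u
      calc _ ≤ |u| * Real.exp (Real.pi * |u|) * ((Real.exp (-(11 / 10) * |u|) * besselBound a) *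
            (Real.exp (-(11 / 10) * |u|) * besselBound b) *
            (Real.exp (-(11 / 10) * |u|) * besselBound z)) := by gcongr
        _ = |u| * (Real.exp (Real.pi * |u|) * Real.exp (-(11 / 10) * |u|) *
            Real.exp (-(11 / 10) * |u|) * Real.exp (-(11 / 10) * |u|)) *
            (besselBound a * besselBound b * besselBound z) := by ring
        _ = _ := by simp only [← Real.exp_add]; ring_nf
  have h := integral_id_mul_exp_pi_mul_besselK a b z
  rw [integral_eq_integral_Ioi_add hi] at h
  -- Folding the line onto the half-line turns `u e^{πu}` into `2 u sinh(πu)`, as `K_{iu}` is even.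
  rw [integral_spectralMeasure, ← mul_right_inj' (pow_pos hpi 2).ne', ← h, ← integral_const_mul]
  congr 1; ext u
  simp only [besselK_neg, spectralDensity]
  rw [Real.sinh_eq]
  field_simp
  ring_nf

/-! ### Kernels of spectral multipliers -/

/-- The kernel `∫ φ(u) K_{iu}(e^x) K_{iu}(e^y) μ(du)` of the spectral multiplier `φ`. -/
noncomputable def specKernel (φ : ℝ → ℝ) (x y : ℝ) : ℝ :=
  ∫ u, φ u * besselK u (Real.exp x) * besselK u (Real.exp y) ∂spectralMeasure

/-- The convolution kernel on the line with Fourier multiplier `φ` (for `φ` even). It plays the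
part of `specKernel φ` for the free Laplacian. -/
noncomputable def flatKernel (φ : ℝ → ℝ) (d : ℝ) : ℝ :=
  Real.pi⁻¹ * ∫ u in Ioi (0 : ℝ), φ u * Real.cos (u * d)

/-- The multiplier `u ↦ K_{iu}(e^a) / K_0(e^a)`, the characteristic function of `stepDensity a`. -/
noncomputable def stepChar (a u : ℝ) : ℝ := besselK u (Real.exp a) / besselK 0 (Real.exp a)

/-- The probability density proportional to `exp (-e^a cosh w)`. -/
noncomputable def stepDensity (a w : ℝ) : ℝ :=
  Real.exp (-Real.exp a * Real.cosh w) / (2 * besselK 0 (Real.exp a))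

/-- The sub-Markov kernel whose spectral multiplier is `stepChar a`. -/
noncomputable def stepKernel (a x z : ℝ) : ℝ := tri a x z / besselK 0 (Real.exp a)

/-- A bounded multiplier that decays fast enough for all spectral integrals to converge. -/
structure IsAdmissible (C : ℝ) (φ : ℝ → ℝ) : Prop where
  measurable : Measurable φ
  bound : ∀ u, |φ u| ≤ C * Real.exp (-(11 / 10) * |u|)

instance : SFinite spectralMeasure := by unfold spectralMeasure; infer_instance

/-- `tri` is invariant under cyclic shifts of its arguments. -/
lemma tri_rotate (a b c : ℝ) : tri b c a = tri a b c := by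
  unfold tri; ring_nf

lemma stepKernel_pos (a x z : ℝ) : 0 < stepKernel a x z :=
  div_pos (tri_pos _ _ _) (besselK_zero_pos (Real.exp_pos a))

lemma stepDensity_pos (a w : ℝ) : 0 < stepDensity a w := by
  have := besselK_zero_pos (Real.exp_pos a)
  unfold stepDensity; positivity

/-- Pointwise domination: the step density is what remains of the kernel when the term
`-e^{x + z - a} / 2` is dropped from the exponent. -/
lemma stepKernel_le (a x z : ℝ) : stepKernel a x z ≤ stepDensity a (x - z) := by
  have hK := besselK_zero_pos (Real.exp_pos a)
  unfold stepKernel stepDensity tri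
  rw [div_le_div_iff₀ hK (by positivity)]
  have h1 : Real.exp (-(Real.exp (a + x - z) + Real.exp (z + a - x) + Real.exp (z + x - a)) / 2) ≤
      Real.exp (-Real.exp a * Real.cosh (x - z)) := by
    apply Real.exp_le_exp.2
    have e1 : Real.exp (a + x - z) + Real.exp (z + a - x) = 2 * (Real.exp a * Real.cosh (x - z)) := by
      rw [Real.cosh_eq, show a + x - z = a + (x - z) by ring,
        show z + a - x = a + -(x - z) by ring, Real.exp_add, Real.exp_add]; ring
    have := Real.exp_pos (z + x - a)
    linarith
  nlinarith

lemma stepChar_zero (a : ℝ) : stepChar a 0 = 1 :=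
  div_self (besselK_zero_pos (Real.exp_pos a)).ne'

lemma abs_stepChar_le_one (a u : ℝ) : |stepChar a u| ≤ 1 := by
  have hK := besselK_zero_pos (Real.exp_pos a)
  rw [stepChar, abs_div, abs_of_pos hK, div_le_one hK]
  exact abs_besselK_exp_le u a

lemma measurable_besselK_exp (x : ℝ) : Measurable fun u => besselK u (Real.exp x) :=
  measurable_id.besselK measurable_const

lemma measurable_stepChar (a : ℝ) : Measurable (stepChar a) :=
  (measurable_besselK_exp a).div_const _

lemma isAdmissible_stepChar (a : ℝ) :
    IsAdmissible (besselBound a / besselK 0 (Real.exp a)) (stepChar a) where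
  measurable := measurable_stepChar a
  bound u := by
    have hK := besselK_zero_pos (Real.exp_pos a)
    rw [stepChar, abs_div, abs_of_pos hK, div_mul_eq_mul_div]
    gcongr
    rw [mul_comm]
    exact abs_besselK_le_besselBound u a

lemma IsAdmissible.stepChar_mul {C : ℝ} {φ : ℝ → ℝ} (h : IsAdmissible C φ) (a : ℝ) :
    IsAdmissible C fun u => stepChar a u * φ u where
  measurable := (measurable_stepChar a).mul h.measurable
  bound u := by
    rw [abs_mul]
    exact (mul_le_of_le_one_left (abs_nonneg _) (abs_stepChar_le_one a u)).trans (h.bound u)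

lemma IsAdmissible.abs_mul_besselK_le {C : ℝ} {φ : ℝ → ℝ} (h : IsAdmissible C φ) (u x y : ℝ) :
    |φ u * besselK u (Real.exp x) * besselK u (Real.exp y)| ≤
      C * (besselBound x * besselBound y) * Real.exp (-(33 / 10) * |u|) := by
  rw [abs_mul, abs_mul]
  have h1 := abs_besselK_le_besselBound u x
  have h2 := abs_besselK_le_besselBound u y
  have h3 := h.bound u
  have h4 : 0 ≤ C * Real.exp (-(11 / 10) * |u|) := (abs_nonneg _).trans h3
  have hb := besselBound_pos x
  calc _ ≤ (C * Real.exp (-(11 / 10) * |u|)) * (Real.exp (-(11 / 10) * |u|) * besselBound x) *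
        (Real.exp (-(11 / 10) * |u|) * besselBound y) := by gcongr
    _ = C * (besselBound x * besselBound y) * (Real.exp (-(11 / 10) * |u|) *
        Real.exp (-(11 / 10) * |u|) * Real.exp (-(11 / 10) * |u|)) := by ring
    _ = _ := by rw [← Real.exp_add, ← Real.exp_add]; ring_nf

lemma IsAdmissible.integrable {C : ℝ} {φ : ℝ → ℝ} (h : IsAdmissible C φ) (x y : ℝ) :
    Integrable (fun u => φ u * besselK u (Real.exp x) * besselK u (Real.exp y)) spectralMeasure :=
  Integrable.mono' (integrable_exp_spectralMeasure.const_mul (C * (besselBound x * besselBound y)))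
    ((h.measurable.mul (measurable_besselK_exp x)).mul (measurable_besselK_exp y)).aestronglyMeasurable
    (.of_forall fun u => h.abs_mul_besselK_le u x y)

lemma measurable_specKernel {φ : ℝ → ℝ} (h : Measurable φ) :
    Measurable (Function.uncurry (specKernel φ)) := by
  have hm : Measurable fun q : (ℝ × ℝ) × ℝ =>
      φ q.2 * besselK q.2 (Real.exp q.1.1) * besselK q.2 (Real.exp q.1.2) :=
    ((h.comp measurable_snd).mul (measurable_snd.besselK (Real.measurable_exp.comp
      (measurable_fst.comp measurable_fst)))).mul (measurable_snd.besselK (Real.measurable_exp.comp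
      (measurable_snd.comp measurable_fst)))
  exact (hm.stronglyMeasurable.integral_prod_right' (ν := spectralMeasure)).measurable

lemma specKernel_comm (φ : ℝ → ℝ) (x y : ℝ) : specKernel φ x y = specKernel φ y x := by
  unfold specKernel
  congr 1; ext u; ring

lemma flatKernel_neg (φ : ℝ → ℝ) (d : ℝ) : flatKernel φ (-d) = flatKernel φ d := by
  simp [flatKernel]

lemma IsAdmissible.integrable_volume {C : ℝ} {φ : ℝ → ℝ} (h : IsAdmissible C φ) :
    Integrable φ :=
  Integrable.mono' ((integrable_exp_neg_mul_abs (by norm_num : (0 : ℝ) < 11 / 10)).const_mul C)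
    h.measurable.aestronglyMeasurable (.of_forall h.bound)

/-- The kernel of the multiplier `stepChar a` is explicit and positive, by the inversion of the
product formula. -/
lemma specKernel_stepChar (a x y : ℝ) : specKernel (stepChar a) x y = stepKernel a x y := by
  rw [specKernel, stepKernel, ← tri_rotate, ← integral_besselK_mul_besselK_mul_besselK,
    ← integral_div]
  congr 1; ext u
  unfold stepChar; ring

lemma continuous_stepDensity (a : ℝ) : Continuous (stepDensity a) := by
  unfold stepDensity; fun_prop

lemma integrable_stepDensity (a : ℝ) : Integrable (stepDensity a) :=
  (integrable_exp_neg_mul_cosh (Real.exp_pos a)).div_const _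

/-- The step density has characteristic function `stepChar`. -/
lemma integral_stepDensity_mul_cos (a u : ℝ) :
    ∫ w, stepDensity a w * Real.cos (u * w) = stepChar a u := by
  have h := integral_coshExp_mul u (θ := 0) (Real.exp_pos a)
    (by constructor <;> linarith [Real.pi_pos])
  simp only [Complex.ofReal_zero, zero_mul, Complex.exp_zero, one_mul] at h
  have hi : Integrable fun w : ℝ => coshExp (Real.exp a) 0 w * Complex.exp (Complex.I * u * w) :=
    (integrable_coshExp (Real.exp_pos a) (by simp)).mul_bdd (c := 1) (by fun_prop)
      (.of_forall fun w => by rw [Complex.norm_exp]; simp)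
  have h2 := congrArg Complex.re h
  rw [← RCLike.re_eq_complex_re, ← integral_re hi] at h2
  have h3 : ∀ w : ℝ, RCLike.re (coshExp (Real.exp a) 0 w * Complex.exp (Complex.I * u * w)) =
      Real.exp (-Real.exp a * Real.cosh w) * Real.cos (u * w) := by
    intro w
    rw [coshExp_zero, RCLike.re_eq_complex_re, Complex.re_ofReal_mul,
      show Complex.I * u * w = ((u * w : ℝ) : ℂ) * Complex.I by push_cast; ring,
      Complex.exp_ofReal_mul_I_re]
  simp_rw [h3] at h2
  have h4 : (RCLike.re (2 * (besselK u (Real.exp a) : ℂ)) : ℝ) = 2 * besselK u (Real.exp a) := by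
    rw [RCLike.re_eq_complex_re]; simp
  rw [h4] at h2
  unfold stepDensity stepChar
  have hK := (besselK_zero_pos (Real.exp_pos a)).ne'
  simp_rw [div_mul_eq_mul_div]
  rw [integral_div, h2]
  field_simp

lemma integrable_stepDensity_mul_cos (a u : ℝ) :
    Integrable fun w => stepDensity a w * Real.cos (u * w) :=
  (integrable_stepDensity a).mul_bdd (c := 1) (by fun_prop)
    (.of_forall fun w => Real.abs_cos_le_one _)

lemma stepDensity_neg (a w : ℝ) : stepDensity a (-w) = stepDensity a w := by
  simp [stepDensity]

/-- The step density is even, so convolution with it multiplies `cos (u ·)` by its characteristic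
function. -/
lemma integral_stepDensity_sub_mul_cos (a u d : ℝ) :
    ∫ w, stepDensity a (d - w) * Real.cos (u * w) = stepChar a u * Real.cos (u * d) := by
  have hi : ∀ s : ℝ, Integrable fun v => stepDensity a v * Real.cos (u * (d + s * v)) := fun s =>
    (integrable_stepDensity a).mul_bdd (c := 1) (by fun_prop)
      (.of_forall fun w => Real.abs_cos_le_one _)
  have h1 : ∫ w, stepDensity a (d - w) * Real.cos (u * w) =
      ∫ v, stepDensity a v * Real.cos (u * (d + -1 * v)) := by
    rw [← integral_sub_left_eq_self (fun v => stepDensity a v * Real.cos (u * (d + -1 * v)))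
      volume d]
    congr 1; ext w; ring_nf
  have h2 : ∫ v, stepDensity a v * Real.cos (u * (d + -1 * v)) =
      ∫ v, stepDensity a v * Real.cos (u * (d + 1 * v)) := by
    rw [← integral_neg_eq_self]
    congr 1; ext v; rw [stepDensity_neg]; ring_nf
  have h3 : (∫ v, stepDensity a v * Real.cos (u * (d + -1 * v))) +
      (∫ v, stepDensity a v * Real.cos (u * (d + 1 * v))) =
      2 * Real.cos (u * d) * ∫ v, stepDensity a v * Real.cos (u * v) := by
    rw [← integral_add (hi _) (hi _), ← integral_const_mul]
    congr 1; ext v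
    rw [mul_add, mul_add, Real.cos_add, Real.cos_add]
    simp
    ring
  rw [integral_stepDensity_mul_cos] at h3
  rw [h1]
  linarith

/-- Fourier inversion for the step density. -/
lemma flatKernel_stepChar (a d : ℝ) : flatKernel (stepChar a) d = stepDensity a d := by
  have h := integral_exp_mul_besselK (θ := 0) (Real.exp_pos a)
    (by constructor <;> linarith [Real.pi_pos]) d
  simp only [Complex.ofReal_zero, zero_mul, Complex.exp_zero, one_mul, coshExp_zero,
    Real.cosh_neg] at h
  have hb : Integrable fun u : ℝ => (besselK u (Real.exp a) : ℂ) := by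
    simpa using integrable_exp_mul_besselK (θ := 0) (Real.exp_pos a)
      (by constructor <;> linarith [Real.pi_pos])
  have hb' : Integrable fun u : ℝ => besselK u (Real.exp a) := by simpa using hb.re
  have hi : Integrable fun u : ℝ => (besselK u (Real.exp a) : ℂ) *
      Complex.exp (Complex.I * u * d) :=
    hb.mul_bdd (c := 1) (by fun_prop) (.of_forall fun w => by rw [Complex.norm_exp]; simp)
  have h2 := congrArg Complex.re h
  rw [← RCLike.re_eq_complex_re, ← integral_re hi] at h2
  have h3 : ∀ u : ℝ, RCLike.re ((besselK u (Real.exp a) : ℂ) * Complex.exp (Complex.I * u * d)) =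
      besselK u (Real.exp a) * Real.cos (u * d) := by
    intro u
    rw [RCLike.re_eq_complex_re, Complex.re_ofReal_mul,
      show Complex.I * u * d = ((u * d : ℝ) : ℂ) * Complex.I by push_cast; ring,
      Complex.exp_ofReal_mul_I_re]
  simp_rw [h3] at h2
  rw [integral_eq_integral_Ioi_add (hb'.mul_bdd (c := 1) (by fun_prop)
    (.of_forall fun w => Real.abs_cos_le_one _)), RCLike.re_eq_complex_re, ← Complex.ofReal_mul,
    Complex.ofReal_re] at h2
  simp only [besselK_neg, neg_mul, Real.cos_neg, ← two_mul] at h2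
  rw [integral_const_mul] at h2
  unfold flatKernel stepDensity stepChar
  simp_rw [div_mul_eq_mul_div]
  rw [integral_div]
  have hK := (besselK_zero_pos (Real.exp_pos a)).ne'
  have := Real.pi_pos.ne'
  field_simp
  linarith

lemma integrable_stepKernel_mul_besselK_zero_mul (a x : ℝ) {k : ℝ} (hk : 0 < k) :
    Integrable fun z => stepKernel a x z * besselK 0 (Real.exp z * k) := by
  refine ((integrable_tri_mul_besselK_zero_mul a x hk).div_const (besselK 0 (Real.exp a))).congr
    (.of_forall fun z => ?_)
  simp only [stepKernel]; ring

/-- The functions `K_{iu}` are eigenfunctions of the step kernel; this is the product formula. -/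
lemma integral_stepKernel_mul_besselK (a x u : ℝ) :
    ∫ z, stepKernel a x z * besselK u (Real.exp z) = stepChar a u * besselK u (Real.exp x) := by
  unfold stepKernel stepChar
  simp_rw [div_mul_eq_mul_div]
  rw [integral_div, integral_tri_mul_besselK]

lemma continuous_stepKernel (a x : ℝ) : Continuous (stepKernel a x) :=
  (continuous_tri a x).div_const _

/-- Composition with the step kernel multiplies the spectral multiplier by `stepChar`. -/
lemma integrable_stepKernel_mul_specKernel {C : ℝ} {φ : ℝ → ℝ} (h : IsAdmissible C φ) (a x y : ℝ) :
    Integrable (fun z => stepKernel a x z * specKernel φ z y) ∧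
    ∫ z, stepKernel a x z * specKernel φ z y = specKernel (fun u => stepChar a u * φ u) x y := by
  have hF : Integrable (Function.uncurry fun z u : ℝ => stepKernel a x z *
      (φ u * besselK u (Real.exp z) * besselK u (Real.exp y))) (volume.prod spectralMeasure) := by
    refine Integrable.mono' ((integrable_stepKernel_mul_besselK_zero_mul a x
      cos_eleven_tenths_pos).mul_prod
      (integrable_exp_spectralMeasure.const_mul (C * besselBound y))) ?_ (.of_forall fun p => ?_)
    · have e1 : Measurable fun p : ℝ × ℝ => besselK p.2 (Real.exp p.1) :=
        measurable_snd.besselK (Real.measurable_exp.comp measurable_fst)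
      have e2 := (continuous_stepKernel a x).measurable
      have e3 := measurable_besselK_exp y
      have e4 := h.measurable
      apply Measurable.aestronglyMeasurable
      unfold Function.uncurry
      fun_prop
    · obtain ⟨z, u⟩ := p
      simp only [Function.uncurry_apply_pair]
      rw [norm_mul, Real.norm_eq_abs, Real.norm_eq_abs, abs_of_pos (stepKernel_pos a x z)]
      calc _ ≤ stepKernel a x z * (C * (besselBound z * besselBound y) *
            Real.exp (-(33 / 10) * |u|)) :=
            mul_le_mul_of_nonneg_left (h.abs_mul_besselK_le u z y) (stepKernel_pos a x z).le
        _ = _ := by rw [← besselBound]; ring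
  have hz : ∀ z, ∫ u, stepKernel a x z * (φ u * besselK u (Real.exp z) * besselK u (Real.exp y))
      ∂spectralMeasure = stepKernel a x z * specKernel φ z y := by
    intro z; rw [integral_const_mul, specKernel]
  refine ⟨?_, ?_⟩
  · have := hF.integral_prod_left
    simpa only [Function.uncurry_apply_pair, hz] using this
  · simp_rw [← hz]
    rw [integral_integral_swap hF, specKernel]
    congr 1; ext u
    have : ∀ z, stepKernel a x z * (φ u * besselK u (Real.exp z) * besselK u (Real.exp y)) =
        (φ u * besselK u (Real.exp y)) * (stepKernel a x z * besselK u (Real.exp z)) := by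
      intro z; ring
    simp_rw [this]
    rw [integral_const_mul, integral_stepKernel_mul_besselK]
    ring

/-- Convolution with the step density multiplies the free multiplier by `stepChar`, in parallel with
`integrable_stepKernel_mul_specKernel`. -/
lemma integrable_stepDensity_sub_mul_flatKernel {C : ℝ} {φ : ℝ → ℝ} (h : IsAdmissible C φ)
    (a d : ℝ) :
    Integrable (fun w => stepDensity a (d - w) * flatKernel φ w) ∧
    ∫ w, stepDensity a (d - w) * flatKernel φ w = flatKernel (fun u => stepChar a u * φ u) d := by
  have hF : Integrable (Function.uncurry fun w u : ℝ => stepDensity a (d - w) *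
      (φ u * Real.cos (u * w))) (volume.prod (volume.restrict (Ioi 0))) := by
    have e1 : Integrable fun w => stepDensity a (d - w) := (integrable_stepDensity a).comp_sub_left d
    refine ((e1.mul_prod (h.integrable_volume.restrict (s := Ioi 0))).mul_bdd (c := 1)
      (f := fun p : ℝ × ℝ => stepDensity a (d - p.1) * φ p.2)
      (g := fun p : ℝ × ℝ => Real.cos (p.2 * p.1)) (by fun_prop)
      (.of_forall fun p => Real.abs_cos_le_one _)).congr (.of_forall fun p => ?_)
    simp only [Function.uncurry]; ring
  have hz : ∀ w, ∫ u in Ioi (0 : ℝ), stepDensity a (d - w) * (φ u * Real.cos (u * w)) =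
      Real.pi * (stepDensity a (d - w) * flatKernel φ w) := by
    intro w
    rw [integral_const_mul, flatKernel]
    have := Real.pi_pos.ne'
    field_simp
  have hpi := Real.pi_pos.ne'
  refine ⟨?_, ?_⟩
  · have := hF.integral_prod_left
    simp only [Function.uncurry_apply_pair, hz] at this
    refine (this.const_mul Real.pi⁻¹).congr (.of_forall fun w => ?_)
    simp only []
    field_simp
  · have h1 : ∫ w, Real.pi * (stepDensity a (d - w) * flatKernel φ w) =
        ∫ u in Ioi (0 : ℝ), stepChar a u * φ u * Real.cos (u * d) := by
      simp_rw [← hz]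
      rw [integral_integral_swap hF]
      congr 1; ext u
      have : ∀ w, stepDensity a (d - w) * (φ u * Real.cos (u * w)) =
        φ u * (stepDensity a (d - w) * Real.cos (u * w)) := by intro w; ring
      simp_rw [this]
      rw [integral_const_mul, integral_stepDensity_sub_mul_cos]; ring
    rw [integral_const_mul] at h1
    rw [flatKernel, ← h1]
    field_simp

/-! ### Multipliers dominated by the free kernel -/

/-- A multiplier whose kernel is nonnegative, is dominated by the free kernel with the same
multiplier, and acts on the functions `K_{iv}` through the multiplier. This class contains
`stepChar a`, is stable under multiplication by `stepChar a` and under dominated limits, and so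
contains `u ↦ e^{-tu²}`. -/
structure IsDominated (φ : ℝ → ℝ) : Prop where
  admissible : ∃ C, IsAdmissible C φ
  nonneg : ∀ x y, 0 ≤ specKernel φ x y
  le_flat : ∀ x y, specKernel φ x y ≤ flatKernel φ (x - y)
  integrable : ∀ x, Integrable fun z => specKernel φ x z * besselK 0 (Real.exp z)
  eigen : ∀ v x, ∫ z, specKernel φ x z * besselK v (Real.exp z) = φ v * besselK v (Real.exp x)

lemma isDominated_stepChar (a : ℝ) : IsDominated (stepChar a) where
  admissible := ⟨_, isAdmissible_stepChar a⟩
  nonneg x y := by rw [specKernel_stepChar]; exact (stepKernel_pos a x y).le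
  le_flat x y := by rw [specKernel_stepChar, flatKernel_stepChar]; exact stepKernel_le a x y
  integrable x := by
    simp_rw [specKernel_stepChar]
    simpa using integrable_stepKernel_mul_besselK_zero_mul a x one_pos
  eigen v x := by
    simp_rw [specKernel_stepChar]
    exact integral_stepKernel_mul_besselK a x v

lemma IsDominated.measurable {φ : ℝ → ℝ} (h : IsDominated φ) : Measurable φ :=
  h.admissible.choose_spec.measurable

/-- Each property passes through the composition of kernels: positivity and domination because both
factors are nonnegative, the eigenfunction property by Fubini. -/
lemma IsDominated.stepChar_mul {φ : ℝ → ℝ} (h : IsDominated φ) (a : ℝ) :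
    IsDominated fun u => stepChar a u * φ u := by
  obtain ⟨C, hC⟩ := h.admissible
  have hm := measurable_specKernel h.measurable
  have hcomp := fun x y => integrable_stepKernel_mul_specKernel hC a x y
  -- Tonelli for the positive eigenfunction `K_0`; it dominates all the other `K_{iv}`.
  have hF : ∀ x, Integrable (Function.uncurry fun z y : ℝ => stepKernel a x z *
      (specKernel φ z y * besselK 0 (Real.exp y))) (volume.prod volume) := by
    intro x
    refine (integrable_prod_iff ?_).2 ⟨.of_forall fun z => (h.integrable z).const_mul (stepKernel a x z), ?_⟩
    · have e1 : Measurable fun p : ℝ × ℝ => besselK 0 (Real.exp p.2) :=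
        measurable_const.besselK (Real.measurable_exp.comp measurable_snd)
      have e2 := (continuous_stepKernel a x).measurable
      exact ((e2.comp measurable_fst).mul (hm.mul e1)).aestronglyMeasurable
    · have : ∀ z, ∫ y, ‖stepKernel a x z * (specKernel φ z y * besselK 0 (Real.exp y))‖ =
          φ 0 * (stepKernel a x z * besselK 0 (Real.exp z * 1)) := by
        intro z
        rw [mul_one]
        calc _ = ∫ y, stepKernel a x z * (specKernel φ z y * besselK 0 (Real.exp y)) := by
              congr 1; ext y
              exact Real.norm_of_nonneg (mul_nonneg (stepKernel_pos a x z).le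
                (mul_nonneg (h.nonneg z y) (besselK_zero_exp_nonneg y)))
          _ = _ := by rw [integral_const_mul, h.eigen]; ring
      simp only [Function.uncurry_apply_pair, this]
      exact (integrable_stepKernel_mul_besselK_zero_mul a x one_pos).const_mul _
  have hz : ∀ v x y, ∫ z, stepKernel a x z * (specKernel φ z y * besselK v (Real.exp y)) =
      specKernel (fun u => stepChar a u * φ u) x y * besselK v (Real.exp y) := by
    intro v x y
    rw [← (hcomp x y).2, ← integral_mul_const]
    congr 1; ext z; ring
  refine ⟨⟨C, hC.stepChar_mul a⟩, fun x y => ?_, fun x y => ?_, fun x => ?_, fun v x => ?_⟩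
  · rw [← (hcomp x y).2]
    exact integral_nonneg fun z => mul_nonneg (stepKernel_pos a x z).le (h.nonneg z y)
  · have hf := integrable_stepDensity_sub_mul_flatKernel hC a (x - y)
    rw [← (hcomp x y).2, ← hf.2, ← integral_sub_right_eq_self
      (fun w => stepDensity a (x - y - w) * flatKernel φ w) y]
    refine integral_mono (hcomp x y).1 (hf.1.comp_sub_right y) fun z => ?_
    simp only [sub_sub_sub_cancel_right]
    exact mul_le_mul (stepKernel_le a x z) (h.le_flat z y) (h.nonneg z y)
      (stepDensity_pos _ _).le
  · have := (hF x).integral_prod_right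
    simpa only [Function.uncurry_apply_pair, hz] using this
  · have hFv : Integrable (Function.uncurry fun z y : ℝ => stepKernel a x z *
        (specKernel φ z y * besselK v (Real.exp y))) (volume.prod volume) := by
      refine Integrable.mono' (hF x) ?_ (.of_forall fun p => ?_)
      · have e1 : Measurable fun p : ℝ × ℝ => besselK v (Real.exp p.2) :=
          measurable_const.besselK (Real.measurable_exp.comp measurable_snd)
        have e2 := (continuous_stepKernel a x).measurable
        exact ((e2.comp measurable_fst).mul (hm.mul e1)).aestronglyMeasurable
      · obtain ⟨z, y⟩ := p
        simp only [Function.uncurry_apply_pair, norm_mul, Real.norm_eq_abs]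
        rw [abs_of_pos (stepKernel_pos a x z), abs_of_nonneg (h.nonneg z y)]
        exact mul_le_mul_of_nonneg_left (mul_le_mul_of_nonneg_left (abs_besselK_exp_le v y)
          (h.nonneg z y)) (stepKernel_pos a x z).le
    simp_rw [← hz]
    rw [← integral_integral_swap hFv]
    simp_rw [integral_const_mul, h.eigen, mul_left_comm _ (φ v)]
    rw [integral_const_mul, integral_stepKernel_mul_besselK]
    ring

lemma integrable_exp_neg_abs_sub_mul_besselK_zero (x : ℝ) :
    Integrable fun z => Real.exp (-|x - z|) * besselK 0 (Real.exp z) := by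
  obtain ⟨C, hC, hK⟩ := exists_besselK_zero_exp_le (N := 1 / 2) (by norm_num)
  have h1 : Integrable fun z : ℝ => Real.exp (-(1 / 2) * |z - x|) :=
    (integrable_exp_neg_mul_abs (by norm_num : (0 : ℝ) < 1 / 2)).comp_sub_right x
  refine Integrable.mono' (h1.const_mul (C * Real.exp (-x / 2))) ?_ (.of_forall fun z => ?_)
  · have : Measurable fun z : ℝ => besselK 0 (Real.exp z) :=
      measurable_const.besselK Real.measurable_exp
    exact Measurable.aestronglyMeasurable (by fun_prop)
  · rw [Real.norm_of_nonneg (mul_nonneg (Real.exp_pos _).le (besselK_zero_exp_nonneg z))]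
    have h2 : Real.exp (-|x - z|) * Real.exp (-(1 / 2) * z) ≤
        Real.exp (-x / 2) * Real.exp (-(1 / 2) * |z - x|) := by
      rw [← Real.exp_add, ← Real.exp_add]
      apply Real.exp_le_exp.2
      have := neg_le_abs (z - x)
      rw [abs_sub_comm x z]
      linarith
    calc _ ≤ Real.exp (-|x - z|) * (C * Real.exp (-(1 / 2) * z)) := by gcongr; exact hK z
      _ = C * (Real.exp (-|x - z|) * Real.exp (-(1 / 2) * z)) := by ring
      _ ≤ C * (Real.exp (-x / 2) * Real.exp (-(1 / 2) * |z - x|)) := by gcongr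
      _ = _ := by ring

/-- Dominated limits of multipliers in the class stay in the class, provided that the free kernels
decay exponentially at a uniform rate. -/
lemma isDominated_of_tendsto {φ : ℕ → ℝ → ℝ} {ψ : ℝ → ℝ} {C A : ℝ} (h : ∀ k, IsDominated (φ k))
    (hC : ∀ k, IsAdmissible C (φ k)) (hlim : ∀ u, Tendsto (fun k => φ k u) atTop (𝓝 (ψ u)))
    (hA : ∀ k d, flatKernel (φ k) d ≤ A * Real.exp d) : IsDominated ψ := by
  have hψ : IsAdmissible C ψ := ⟨measurable_of_tendsto_metrizable (fun k => (hC k).measurable)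
    (tendsto_pi_nhds.2 hlim), fun u => le_of_tendsto (hlim u).abs (.of_forall fun k => (hC k).bound u)⟩
  have hS : ∀ x y, Tendsto (fun k => specKernel (φ k) x y) atTop (𝓝 (specKernel ψ x y)) := by
    intro x y
    refine tendsto_integral_of_dominated_convergence _
      (fun k => ((hC k).integrable x y).aestronglyMeasurable)
      (integrable_exp_spectralMeasure.const_mul (C * (besselBound x * besselBound y)))
      (fun k => .of_forall fun u => (hC k).abs_mul_besselK_le u x y)
      (.of_forall fun u => ((hlim u).mul_const _).mul_const _)
  have hB : ∀ d, Tendsto (fun k => flatKernel (φ k) d) atTop (𝓝 (flatKernel ψ d)) := by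
    intro d
    refine Tendsto.const_mul _ (tendsto_integral_of_dominated_convergence
      (fun u => C * Real.exp (-(11 / 10) * |u|))
      (fun k => (((hC k).measurable.mul (by fun_prop)).aestronglyMeasurable))
      (((integrable_exp_neg_mul_abs (by norm_num : (0 : ℝ) < 11 / 10)).const_mul C).restrict)
      (fun k => .of_forall fun u => ?_) (.of_forall fun u => (hlim u).mul_const _))
    rw [norm_mul]
    exact (mul_le_of_le_one_right (norm_nonneg _) (Real.abs_cos_le_one _)).trans ((hC k).bound u)
  -- The free kernels are even, so a one-sided exponential bound is two-sided.
  have hA' : ∀ k d, flatKernel (φ k) d ≤ A * Real.exp (-|d|) := by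
    intro k d
    rcases le_total 0 d with hd | hd
    · rw [abs_of_nonneg hd, ← flatKernel_neg]; exact hA k (-d)
    · rw [abs_of_nonpos hd, neg_neg]; exact hA k d
  have hK : ∀ v x z k, ‖specKernel (φ k) x z * besselK v (Real.exp z)‖ ≤
      A * (Real.exp (-|x - z|) * besselK 0 (Real.exp z)) := by
    intro v x z k
    rw [norm_mul, Real.norm_eq_abs, Real.norm_eq_abs, abs_of_nonneg ((h k).nonneg x z), ← mul_assoc]
    have h1 := ((h k).le_flat x z).trans (hA' k (x - z))
    exact mul_le_mul h1 (abs_besselK_exp_le v z) (abs_nonneg _) (((h k).nonneg x z).trans h1)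
  have hKm : ∀ v, Measurable fun z : ℝ => besselK v (Real.exp z) := fun v =>
    measurable_const.besselK Real.measurable_exp
  have hSm : ∀ {χ : ℝ → ℝ}, Measurable χ → ∀ x, Measurable fun z => specKernel χ x z := fun hχ x =>
    (measurable_specKernel hχ).comp (measurable_const.prodMk measurable_id)
  refine ⟨⟨C, hψ⟩, fun x y => ?_, fun x y => ?_, fun x => ?_, fun v x => ?_⟩
  · exact ge_of_tendsto' (hS x y) fun k => (h k).nonneg x y
  · exact le_of_tendsto_of_tendsto' (hS x y) (hB (x - y)) fun k => (h k).le_flat x y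
  · refine Integrable.mono' ((integrable_exp_neg_abs_sub_mul_besselK_zero x).const_mul A)
      ((hSm hψ.measurable x).mul (hKm 0)).aestronglyMeasurable (.of_forall fun z => ?_)
    exact le_of_tendsto ((hS x z).mul_const (besselK 0 (Real.exp z))).norm
      (.of_forall fun k => hK 0 x z k)
  · have h1 := tendsto_integral_of_dominated_convergence
      (F := fun k z => specKernel (φ k) x z * besselK v (Real.exp z))
      (f := fun z => specKernel ψ x z * besselK v (Real.exp z)) _
      (fun k => ((hSm (hC k).measurable x).mul (hKm v)).aestronglyMeasurable)
      ((integrable_exp_neg_abs_sub_mul_besselK_zero x).const_mul A)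
      (fun k => .of_forall fun z => hK v x z k) (.of_forall fun z => (hS x z).mul_const _)
    simp_rw [(h _).eigen] at h1
    exact tendsto_nhds_unique h1 ((hlim v).mul_const _)

/-- The exponential moment of the step density `f_a`. As `f_a` is even, `∫ e^w f_a(w) dw` is the
integral of `f_a(w) cosh w`. -/
noncomputable def stepMoment (a : ℝ) : ℝ := ∫ w, stepDensity a w * Real.cosh w

lemma integrable_stepDensity_mul_exp (a M : ℝ) :
    Integrable fun w => stepDensity a w * Real.exp (M * w) := by
  refine Integrable.mono' ((integrable_exp_neg_mul_cosh_add (Real.exp_pos a) |M|).div_const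
    (2 * besselK 0 (Real.exp a))) ?_ (.of_forall fun w => ?_)
  · have := continuous_stepDensity a
    exact Continuous.aestronglyMeasurable (by fun_prop)
  · have hK := besselK_zero_pos (Real.exp_pos a)
    rw [Real.norm_of_nonneg (mul_nonneg (stepDensity_pos a w).le (Real.exp_pos _).le),
      stepDensity, Real.exp_add, div_mul_eq_mul_div]
    refine div_le_div_of_nonneg_right (mul_le_mul_of_nonneg_left (Real.exp_le_exp.2 ?_)
      (Real.exp_pos _).le) (by positivity)
    rw [← abs_mul]; exact le_abs_self _

lemma integrable_stepDensity_mul_cosh (a : ℝ) :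
    Integrable fun w => stepDensity a w * Real.cosh w := by
  refine (((integrable_stepDensity_mul_exp a 1).add (integrable_stepDensity_mul_exp a (-1))).div_const
    2).congr (.of_forall fun w => ?_)
  simp only [Pi.add_apply, Real.cosh_eq, one_mul, neg_mul]; ring

lemma integral_stepDensity_mul_exp_neg (a : ℝ) :
    ∫ w, stepDensity a w * Real.exp (-w) = stepMoment a := by
  have i1 : Integrable fun w => stepDensity a w * Real.exp w := by
    simpa using integrable_stepDensity_mul_exp a 1
  have i2 : Integrable fun w => stepDensity a w * Real.exp (-w) := by
    simpa using integrable_stepDensity_mul_exp a (-1)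
  have h1 : ∫ w, stepDensity a w * Real.exp (-w) = ∫ w, stepDensity a w * Real.exp w := by
    rw [← integral_neg_eq_self]; simp [stepDensity_neg]
  have h2 : 2 * stepMoment a =
      (∫ w, stepDensity a w * Real.exp w) + ∫ w, stepDensity a w * Real.exp (-w) := by
    rw [← integral_add i1 i2, stepMoment, ← integral_const_mul]
    congr 1; ext w; rw [Real.cosh_eq]; ring
  linarith

/-- Multiplication by `stepChar a` costs at most a factor `stepMoment a` in an exponential bound for
the free kernel. -/
lemma flatKernel_stepChar_mul_le {C A a : ℝ} {φ : ℝ → ℝ} (h : IsAdmissible C φ)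
    (hA : ∀ d, flatKernel φ d ≤ A * Real.exp d) (d : ℝ) :
    flatKernel (fun u => stepChar a u * φ u) d ≤ stepMoment a * A * Real.exp d := by
  obtain ⟨h1, h2⟩ := integrable_stepDensity_sub_mul_flatKernel h a d
  have i2 : Integrable fun w => stepDensity a w * Real.exp (-w) := by
    simpa using integrable_stepDensity_mul_exp a (-1)
  have h3 : ∫ w, stepDensity a (d - w) * Real.exp (-(d - w)) = stepMoment a := by
    rw [← integral_stepDensity_mul_exp_neg]
    exact integral_sub_left_eq_self (fun w => stepDensity a w * Real.exp (-w)) volume d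
  rw [← h2, ← h3, mul_assoc, ← integral_mul_const]
  refine integral_mono h1 ((i2.comp_sub_left d).mul_const _) fun w => ?_
  calc stepDensity a (d - w) * flatKernel φ w ≤ stepDensity a (d - w) * (A * Real.exp w) :=
        mul_le_mul_of_nonneg_left (hA w) (stepDensity_pos _ _).le
    _ = stepDensity a (d - w) * Real.exp (-(d - w)) * (A * Real.exp d) := by
        rw [show w = -(d - w) + d by ring, Real.exp_add]; ring_nf

lemma integral_stepDensity (a : ℝ) : ∫ w, stepDensity a w = 1 := by
  have := integral_stepDensity_mul_cos a 0
  rw [stepChar_zero] at this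
  simpa using this

/-- The exponential moment is `1 + O(e^{-a})`, so that it stays bounded when `e^a` is of order `k`
and `k` steps are composed. With `r` the mean of `cosh` under the step density, integration by parts gives
`e^a (∫ cosh² - 1) = r`, while `r² ≤ ∫ cosh²`. -/
lemma stepMoment_le (a : ℝ) : stepMoment a ≤ 1 + Real.exp (-a) := by
  have iE := fun M => integrable_stepDensity_mul_exp a M
  have i0 := integrable_stepDensity a
  have i1 := integrable_stepDensity_mul_cosh a
  have i2 : Integrable fun w => stepDensity a w * Real.cosh w ^ 2 := by
    refine ((((iE 2).add (iE (-2))).div_const 4).add (i0.div_const 2)).congr (.of_forall fun w => ?_)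
    simp only [Pi.add_apply, Real.cosh_eq]
    rw [show 2 * w = w + w by ring, show -2 * w = -w + -w by ring, Real.exp_add, Real.exp_add]
    have : Real.exp w * Real.exp (-w) = 1 := by rw [← Real.exp_add]; simp
    linear_combination (-1 / 2) * stepDensity a w * this
  have iS : Integrable fun w => stepDensity a w * Real.sinh w := by
    refine (((iE 1).sub (iE (-1))).div_const 2).congr (.of_forall fun w => ?_)
    simp only [Pi.sub_apply, Real.sinh_eq, one_mul, neg_mul]; ring
  set r := stepMoment a with hr
  set m := ∫ w, stepDensity a w * Real.cosh w ^ 2 with hm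
  have i20 : Integrable fun w => stepDensity a w * Real.cosh w ^ 2 - stepDensity a w := i2.sub i0
  have hd : ∀ w, HasDerivAt (fun w => stepDensity a w * Real.sinh w)
      (stepDensity a w * Real.cosh w -
        Real.exp a * (stepDensity a w * Real.cosh w ^ 2 - stepDensity a w)) w := by
    intro w
    have h1 := ((((Real.hasDerivAt_cosh w).const_mul (-Real.exp a)).exp).div_const
      (2 * besselK 0 (Real.exp a))).mul (Real.hasDerivAt_sinh w)
    refine HasDerivAt.congr_deriv h1 ?_
    rw [Real.cosh_sq' w]
    unfold stepDensity
    ring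
  have h0 := integral_eq_zero_of_hasDerivAt_of_integrable hd
    (i1.sub (i20.const_mul _)) iS
  rw [integral_sub i1 (i20.const_mul _), integral_const_mul, integral_sub i2 i0,
    integral_stepDensity] at h0
  change r - Real.exp a * (m - 1) = 0 at h0
  have h2 : 0 ≤ m - 2 * r * r + r ^ 2 := by
    have e1 : ∫ w, stepDensity a w * (Real.cosh w - r) ^ 2 = m - 2 * r * r + r ^ 2 := by
      have : ∀ w, stepDensity a w * (Real.cosh w - r) ^ 2 = stepDensity a w * Real.cosh w ^ 2 -
          2 * r * (stepDensity a w * Real.cosh w) + r ^ 2 * stepDensity a w := by intro w; ring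
      simp_rw [this]
      have i21 : Integrable fun w => stepDensity a w * Real.cosh w ^ 2 -
          2 * r * (stepDensity a w * Real.cosh w) := i2.sub (i1.const_mul _)
      rw [integral_add i21 (i0.const_mul _), integral_sub i2 (i1.const_mul _),
        integral_const_mul, integral_const_mul, integral_stepDensity]
      simp only [← hm, mul_one]
      rfl
    rw [← e1]
    exact integral_nonneg fun w => mul_nonneg (stepDensity_pos a w).le (sq_nonneg _)
  have h3 : 1 ≤ r := by
    rw [← integral_stepDensity a]
    refine integral_mono i0 i1 fun w => ?_
    exact le_mul_of_one_le_right (stepDensity_pos a w).le (Real.one_le_cosh w)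
  have h4 : Real.exp a * (r ^ 2 - 1) ≤ r := by
    have := Real.exp_pos a
    nlinarith
  have h5 : Real.exp a * (r - 1) ≤ 1 := by
    have e : Real.exp a * (r - 1) * (r + 1) ≤ 1 * (r + 1) := by nlinarith
    exact le_of_mul_le_mul_right e (by linarith)
  have h6 : r - 1 ≤ Real.exp (-a) := by
    rw [Real.exp_neg, ← one_div, le_div_iff₀ (Real.exp_pos a)]; linarith
  linarith

/-! ### The Gaussian limit -/

lemma tendsto_cosh_sub_one_div (v : ℝ) :
    Tendsto (fun ε : ℝ => (Real.cosh (ε * v) - 1) / ε ^ 2) (𝓝[>] 0) (𝓝 (v ^ 2 / 2)) := by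
  have h1 : HasDerivAt (fun ε : ℝ => Real.sinh (ε * (v / 2))) (v / 2) 0 := by
    simpa using ((hasDerivAt_id (0 : ℝ)).mul_const (v / 2)).sinh
  have h2 := (h1.tendsto_slope_zero_right.pow 2).const_mul 2
  rw [show v ^ 2 / 2 = 2 * (v / 2) ^ 2 by ring]
  refine h2.congr fun ε => ?_
  have h3 : Real.cosh (ε * v) = 1 + 2 * Real.sinh (ε * (v / 2)) ^ 2 := by
    have := Real.cosh_two_mul (ε * (v / 2))
    rw [show 2 * (ε * (v / 2)) = ε * v by ring, Real.cosh_sq] at this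
    linarith
  rw [h3]
  simp [mul_pow, div_eq_mul_inv]
  ring

lemma tendsto_one_sub_cos_div (v : ℝ) :
    Tendsto (fun ε : ℝ => (1 - Real.cos (ε * v)) / ε ^ 2) (𝓝[>] 0) (𝓝 (v ^ 2 / 2)) := by
  have h1 : HasDerivAt (fun ε : ℝ => Real.sin (ε * (v / 2))) (v / 2) 0 := by
    simpa using ((hasDerivAt_id (0 : ℝ)).mul_const (v / 2)).sin
  have h2 := (h1.tendsto_slope_zero_right.pow 2).const_mul 2
  rw [show v ^ 2 / 2 = 2 * (v / 2) ^ 2 by ring]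
  refine h2.congr fun ε => ?_
  have h3 : Real.cos (ε * v) = 1 - 2 * Real.sin (ε * (v / 2)) ^ 2 := by
    have := Real.cos_two_mul (ε * (v / 2))
    rw [show 2 * (ε * (v / 2)) = ε * v by ring, Real.cos_sq'] at this
    linarith
  rw [h3]
  simp [mul_pow, div_eq_mul_inv]
  ring

lemma sq_mul_exp_neg_sq_half_le (v : ℝ) :
    v ^ 2 * Real.exp (-(1 / 2) * v ^ 2) ≤ 4 * Real.exp (-(1 / 4) * v ^ 2) := by
  have h1 : v ^ 2 / 4 ≤ Real.exp (v ^ 2 / 4) := by linarith [Real.add_one_le_exp (v ^ 2 / 4)]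
  have h2 : Real.exp (-(1 / 4) * v ^ 2) = Real.exp (v ^ 2 / 4) * Real.exp (-(1 / 2) * v ^ 2) := by
    rw [← Real.exp_add]; ring_nf
  rw [h2, ← mul_assoc]
  gcongr
  linarith

lemma integrable_exp_neg_sq_half : Integrable fun v : ℝ => Real.exp (-(1 / 2) * v ^ 2) :=
  integrable_exp_neg_mul_sq (by norm_num)

lemma integrable_sq_mul_exp_neg_sq_half :
    Integrable fun v : ℝ => v ^ 2 * Real.exp (-(1 / 2) * v ^ 2) := by
  refine Integrable.mono' ((integrable_exp_neg_mul_sq (by norm_num : (0 : ℝ) < 1 / 4)).const_mul 4)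
    (by fun_prop) (.of_forall fun v => ?_)
  rw [Real.norm_of_nonneg (by positivity)]
  exact sq_mul_exp_neg_sq_half_le v

lemma integral_sq_mul_exp_neg_sq_half :
    ∫ v : ℝ, v ^ 2 * Real.exp (-(1 / 2) * v ^ 2) = ∫ v : ℝ, Real.exp (-(1 / 2) * v ^ 2) := by
  have hd : ∀ v : ℝ, HasDerivAt (fun v : ℝ => v * Real.exp (-(1 / 2) * v ^ 2))
      (Real.exp (-(1 / 2) * v ^ 2) - v ^ 2 * Real.exp (-(1 / 2) * v ^ 2)) v := by
    intro v
    have h1 : HasDerivAt (fun v : ℝ => Real.exp (-(1 / 2) * v ^ 2))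
        (Real.exp (-(1 / 2) * v ^ 2) * (-(1 / 2) * (2 * v))) v := by
      simpa using ((hasDerivAt_pow 2 v).const_mul (-(1 / 2) : ℝ)).exp
    refine ((hasDerivAt_id v).mul h1).congr_deriv ?_
    simp only [id]; ring
  have hi : Integrable fun v : ℝ => v * Real.exp (-(1 / 2) * v ^ 2) :=
    integrable_mul_exp_neg_mul_sq (by norm_num)
  have h := integral_eq_zero_of_hasDerivAt_of_integrable hd
    (integrable_exp_neg_sq_half.sub integrable_sq_mul_exp_neg_sq_half) hi
  rw [integral_sub integrable_exp_neg_sq_half integrable_sq_mul_exp_neg_sq_half] at h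
  linarith

/-- In the variable `v = w / ε`, the step density of parameter `e^a = ε⁻²` is proportional to
`exp (-(cosh (εv) - 1) / ε²)`. -/
lemma one_sub_stepChar_div {ε : ℝ} (hε : 0 < ε) (u : ℝ) :
    (1 - stepChar (Real.log (1 / ε ^ 2)) u) / ε ^ 2 =
      (∫ v, Real.exp (-((Real.cosh (ε * v) - 1) / ε ^ 2)) * ((1 - Real.cos (ε * (u * v))) / ε ^ 2)) /
      ∫ v, Real.exp (-((Real.cosh (ε * v) - 1) / ε ^ 2)) := by
  set a := Real.log (1 / ε ^ 2) with ha
  have hexp : Real.exp a = 1 / ε ^ 2 := Real.exp_log (by positivity)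
  have hK := besselK_zero_pos (Real.exp_pos a)
  have hmul : ∀ g : ℝ → ℝ, ∫ v, g (ε * v) = ε⁻¹ * ∫ w, g w := by
    intro g
    rw [Measure.integral_comp_mul_left, abs_of_pos (inv_pos.2 hε), smul_eq_mul]
  have hden : ∀ v, Real.exp (-((Real.cosh (ε * v) - 1) / ε ^ 2)) =
      (2 * besselK 0 (Real.exp a)) * Real.exp (1 / ε ^ 2) * stepDensity a (ε * v) := by
    intro v
    rw [stepDensity, hexp, mul_comm (2 * besselK 0 (1 / ε ^ 2)) (Real.exp _), mul_assoc,
      mul_div_cancel₀ _ (by rw [← hexp]; positivity), ← Real.exp_add]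
    congr 1; ring
  have h1 : ∫ v, Real.exp (-((Real.cosh (ε * v) - 1) / ε ^ 2)) =
      (2 * besselK 0 (Real.exp a)) * Real.exp (1 / ε ^ 2) * ε⁻¹ := by
    simp_rw [hden]
    rw [integral_const_mul, hmul (stepDensity a), integral_stepDensity, mul_one]
  have h2 : ∫ v, Real.exp (-((Real.cosh (ε * v) - 1) / ε ^ 2)) *
      ((1 - Real.cos (ε * (u * v))) / ε ^ 2) =
      (2 * besselK 0 (Real.exp a)) * Real.exp (1 / ε ^ 2) * ε⁻¹ * ((1 - stepChar a u) / ε ^ 2) := by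
    have e1 : ∀ v, Real.exp (-((Real.cosh (ε * v) - 1) / ε ^ 2)) *
        ((1 - Real.cos (ε * (u * v))) / ε ^ 2) = (2 * besselK 0 (Real.exp a)) *
        Real.exp (1 / ε ^ 2) / ε ^ 2 * (fun w => stepDensity a w - stepDensity a w *
          Real.cos (u * w)) (ε * v) := by
      intro v
      rw [hden]
      simp only []
      rw [show ε * (u * v) = u * (ε * v) by ring]
      ring
    rw [integral_congr_ae (.of_forall e1), integral_const_mul, hmul (fun w => stepDensity a w - stepDensity a w *
        Real.cos (u * w)), integral_sub
      (integrable_stepDensity a) (integrable_stepDensity_mul_cos a u), integral_stepDensity,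
      integral_stepDensity_mul_cos]
    ring
  rw [h1, h2, mul_div_cancel_left₀]
  positivity

/-- The step characters have variance asymptotic to `e^{-a}`. -/
lemma tendsto_one_sub_stepChar_div (u : ℝ) :
    Tendsto (fun ε : ℝ => (1 - stepChar (Real.log (1 / ε ^ 2)) u) / ε ^ 2) (𝓝[>] 0)
      (𝓝 (u ^ 2 / 2)) := by
  have hle : ∀ ε : ℝ, 0 < ε → ∀ v : ℝ, Real.exp (-((Real.cosh (ε * v) - 1) / ε ^ 2)) ≤
      Real.exp (-(1 / 2) * v ^ 2) := by
    intro ε hε v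
    apply Real.exp_le_exp.2
    have h1 := one_add_sq_half_le_cosh (ε * v)
    have h2 : 1 / 2 * v ^ 2 ≤ (Real.cosh (ε * v) - 1) / ε ^ 2 := by
      rw [le_div_iff₀ (by positivity)]; nlinarith
    linarith
  have hpos : ∀ᶠ ε : ℝ in 𝓝[>] 0, 0 < ε := eventually_mem_nhdsWithin
  have hexp : ∀ v, Tendsto (fun ε : ℝ => Real.exp (-((Real.cosh (ε * v) - 1) / ε ^ 2))) (𝓝[>] 0)
      (𝓝 (Real.exp (-(1 / 2) * v ^ 2))) := by
    intro v
    have := (Real.continuous_exp.tendsto _).comp (tendsto_cosh_sub_one_div v).neg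
    rw [show -(v ^ 2 / 2) = -(1 / 2) * v ^ 2 by ring] at this
    exact this
  have hden := tendsto_integral_filter_of_dominated_convergence (μ := volume) (l := 𝓝[>] (0 : ℝ))
    (F := fun (ε v : ℝ) => Real.exp (-((Real.cosh (ε * v) - 1) / ε ^ 2))) _
    (.of_forall fun ε => by fun_prop)
    (hpos.mono fun ε hε => .of_forall fun v => by
      rw [Real.norm_of_nonneg (Real.exp_pos _).le]; exact hle ε hε v)
    integrable_exp_neg_sq_half (.of_forall hexp)
  have hnum := tendsto_integral_filter_of_dominated_convergence (μ := volume) (l := 𝓝[>] (0 : ℝ))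
    (F := fun (ε v : ℝ) => Real.exp (-((Real.cosh (ε * v) - 1) / ε ^ 2)) *
      ((1 - Real.cos (ε * (u * v))) / ε ^ 2))
    (fun v => u ^ 2 / 2 * (v ^ 2 * Real.exp (-(1 / 2) * v ^ 2)))
    (.of_forall fun ε => by fun_prop)
    (hpos.mono fun ε hε => .of_forall fun v => by
      have h1 : (1 - Real.cos (ε * (u * v))) / ε ^ 2 ≤ u ^ 2 / 2 * v ^ 2 := by
        rw [div_le_iff₀ (by positivity)]
        have := Real.one_sub_sq_div_two_le_cos (x := ε * (u * v))
        nlinarith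
      have h0 : 0 ≤ (1 - Real.cos (ε * (u * v))) / ε ^ 2 :=
        div_nonneg (sub_nonneg.2 (Real.cos_le_one _)) (sq_nonneg _)
      rw [Real.norm_of_nonneg (mul_nonneg (Real.exp_pos _).le h0)]
      calc _ ≤ Real.exp (-(1 / 2) * v ^ 2) * (u ^ 2 / 2 * v ^ 2) := by
            exact mul_le_mul (hle ε hε v) h1 h0 (Real.exp_pos _).le
        _ = _ := by ring)
    (integrable_sq_mul_exp_neg_sq_half.const_mul _)
    (.of_forall fun v => (hexp v).mul (tendsto_one_sub_cos_div (u * v)))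
  have hI : (∫ v : ℝ, Real.exp (-(1 / 2) * v ^ 2)) ≠ 0 :=
    (integral_exp_pos integrable_exp_neg_sq_half).ne'
  have h := hnum.div hden hI
  have e1 : (∫ v : ℝ, Real.exp (-(1 / 2) * v ^ 2) * ((u * v) ^ 2 / 2)) /
      (∫ v : ℝ, Real.exp (-(1 / 2) * v ^ 2)) = u ^ 2 / 2 := by
    have : ∀ v : ℝ, Real.exp (-(1 / 2) * v ^ 2) * ((u * v) ^ 2 / 2) =
      u ^ 2 / 2 * (v ^ 2 * Real.exp (-(1 / 2) * v ^ 2)) := by intro v; ring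
    simp_rw [this]
    rw [integral_const_mul, integral_sq_mul_exp_neg_sq_half, mul_div_assoc, div_self hI, mul_one]
  rw [e1] at h
  refine h.congr' (hpos.mono fun ε hε => ?_)
  exact (one_sub_stepChar_div hε u).symm

lemma tendsto_stepChar_one (u : ℝ) :
    Tendsto (fun k : ℕ => stepChar (Real.log (k + 1)) u) atTop (𝓝 1) := by
  set ε : ℕ → ℝ := fun k => (Real.sqrt (k + 1))⁻¹ with hε
  have hp : ∀ k : ℕ, (0 : ℝ) < k + 1 := fun k => by positivity
  have hsq : ∀ k, 1 / ε k ^ 2 = k + 1 := by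
    intro k; rw [hε]; simp only [inv_pow, Real.sq_sqrt (hp k).le]; simp
  have hlim : Tendsto ε atTop (𝓝 0) := by
    refine (Real.tendsto_sqrt_atTop.comp ?_).inv_tendsto_atTop
    exact tendsto_atTop_add_const_right _ _ tendsto_natCast_atTop_atTop
  have hlim' : Tendsto ε atTop (𝓝[>] 0) := tendsto_nhdsWithin_iff.2
    ⟨hlim, .of_forall fun k => inv_pos.2 (Real.sqrt_pos.2 (hp k))⟩
  have h := ((tendsto_one_sub_stepChar_div u).comp hlim').mul (hlim.pow 2)
  have h2 := h.const_sub 1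
  rw [show (1 : ℝ) - u ^ 2 / 2 * 0 ^ 2 = 1 by ring] at h2
  refine h2.congr fun k => ?_
  have hne : ε k ≠ 0 := (inv_pos.2 (Real.sqrt_pos.2 (hp k))).ne'
  simp only [Function.comp, hsq]
  field_simp
  ring

/-- The central limit theorem for the step density: its rescaled powers approximate the
characteristic function of a Gaussian. -/
lemma tendsto_stepChar_pow {t : ℝ} (ht : 0 < t) (u : ℝ) :
    Tendsto (fun k : ℕ => stepChar (Real.log (k / (2 * t))) u ^ k) atTop
      (𝓝 (Real.exp (-t * u ^ 2))) := by
  set ε : ℕ → ℝ := fun k => (Real.sqrt (k / (2 * t)))⁻¹ with hε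
  have hlim : Tendsto ε atTop (𝓝 0) := by
    refine (Real.tendsto_sqrt_atTop.comp ?_).inv_tendsto_atTop
    exact tendsto_natCast_atTop_atTop.atTop_div_const (by positivity)
  have hpos : ∀ᶠ k : ℕ in atTop, 0 < ε k := by
    filter_upwards [eventually_gt_atTop 0] with k hk
    have : (0 : ℝ) < k := by exact_mod_cast hk
    exact inv_pos.2 (Real.sqrt_pos.2 (by positivity))
  have hlim' : Tendsto ε atTop (𝓝[>] 0) := tendsto_nhdsWithin_iff.2 ⟨hlim, hpos⟩
  have h := ((tendsto_one_sub_stepChar_div u).comp hlim').const_mul (-(2 * t))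
  rw [show -(2 * t) * (u ^ 2 / 2) = -t * u ^ 2 by ring] at h
  have key := Real.tendsto_one_add_pow_exp_of_tendsto
    (g := fun k : ℕ => stepChar (Real.log (k / (2 * t))) u - 1) (t := -t * u ^ 2) (h.congr' ?_)
  · simpa using key
  filter_upwards [eventually_gt_atTop 0] with k hk
  have hk' : (0 : ℝ) < k := by exact_mod_cast hk
  have hsq : ε k ^ 2 = 2 * t / k := by
    rw [hε]; simp only [inv_pow]; rw [Real.sq_sqrt (by positivity), inv_div]
  simp only [Function.comp, hsq, one_div, inv_div]
  field_simp
  ring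

lemma isAdmissible_exp_neg_mul_sq {t : ℝ} (ht : 0 < t) :
    ∃ C, IsAdmissible C fun u => Real.exp (-t * u ^ 2) := by
  refine ⟨Real.exp ((11 / 10) ^ 2 / (4 * t)), by fun_prop, fun u => ?_⟩
  rw [Real.abs_exp, ← Real.exp_add]
  apply Real.exp_le_exp.2
  have h : 0 ≤ t * (|u| - (11 / 10) / (2 * t)) ^ 2 := by positivity
  have h2 : t * (|u| - (11 / 10) / (2 * t)) ^ 2 = t * u ^ 2 - 11 / 10 * |u| +
      (11 / 10) ^ 2 / (4 * t) := by
    rw [← sq_abs u]; field_simp; ring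
  linarith

/-- The free kernel of the multiplier `e^{-tu²}` is the Gaussian density of variance `2t`. -/
lemma flatKernel_exp_neg_mul_sq {t : ℝ} (ht : 0 < t) (d : ℝ) :
    flatKernel (fun u => Real.exp (-t * u ^ 2)) d =
      (2 * Real.sqrt (Real.pi * t))⁻¹ * Real.exp (-d ^ 2 / (4 * t)) := by
  have h := fourierIntegral_gaussian (b := (t : ℂ)) (by simpa using ht) (d : ℂ)
  have h3 : ∀ u : ℝ, Complex.exp (Complex.I * d * u) * Complex.exp (-t * u ^ 2) =
      ((Real.exp (-t * u ^ 2) : ℝ) : ℂ) * Complex.exp (((u * d : ℝ) : ℂ) * Complex.I) := by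
    intro u
    push_cast
    rw [mul_comm]; congr 2; ring
  have hg : Integrable fun u : ℝ => Real.exp (-t * u ^ 2) := integrable_exp_neg_mul_sq ht
  have hi : Integrable fun u : ℝ => ((Real.exp (-t * u ^ 2) : ℝ) : ℂ) *
      Complex.exp (((u * d : ℝ) : ℂ) * Complex.I) :=
    hg.ofReal.mul_bdd (c := 1) (by fun_prop) (.of_forall fun w => by rw [Complex.norm_exp]; simp)
  simp_rw [h3] at h
  have h2 := congrArg Complex.re h
  rw [← RCLike.re_eq_complex_re, ← integral_re hi] at h2
  have h4 : ∀ u : ℝ, RCLike.re (((Real.exp (-t * u ^ 2) : ℝ) : ℂ) *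
      Complex.exp (((u * d : ℝ) : ℂ) * Complex.I)) = Real.exp (-t * u ^ 2) * Real.cos (u * d) := by
    intro u
    rw [RCLike.re_eq_complex_re, Complex.re_ofReal_mul, Complex.exp_ofReal_mul_I_re]
  simp_rw [h4] at h2
  have h5 : ((Real.pi : ℂ) / t) ^ (1 / 2 : ℂ) * Complex.exp (-(d : ℂ) ^ 2 / (4 * t)) =
      ((Real.sqrt (Real.pi / t) * Real.exp (-d ^ 2 / (4 * t)) : ℝ) : ℂ) := by
    rw [Real.sqrt_eq_rpow]
    push_cast
    rw [Complex.ofReal_cpow (by have := Real.pi_pos; positivity)]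
    push_cast
    rfl
  rw [h5, RCLike.re_eq_complex_re, Complex.ofReal_re, integral_eq_integral_Ioi_add
    (hg.mul_bdd (c := 1) (by fun_prop) (.of_forall fun w => Real.abs_cos_le_one _))] at h2
  simp only [even_two, Even.neg_pow, neg_mul, Real.cos_neg, ← two_mul] at h2
  rw [integral_const_mul] at h2
  have hsq : Real.sqrt (Real.pi / t) = Real.pi / Real.sqrt (Real.pi * t) := by
    rw [Real.sqrt_div Real.pi_pos.le, Real.sqrt_mul Real.pi_pos.le]
    have h6 := Real.mul_self_sqrt Real.pi_pos.le
    have := Real.sqrt_pos.2 Real.pi_pos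
    have := Real.sqrt_pos.2 ht
    field_simp
    linarith
  rw [hsq] at h2
  rw [flatKernel]
  have hpi := Real.pi_pos
  have := Real.sqrt_pos.2 (mul_pos hpi ht)
  simp only [neg_mul]
  rw [eq_div_of_mul_eq two_ne_zero ((mul_comm _ _).trans h2)]
  field_simp

lemma exists_flatKernel_exp_neg_mul_sq_le {t : ℝ} (ht : 0 < t) :
    ∃ A, 0 < A ∧ ∀ d, flatKernel (fun u => Real.exp (-t * u ^ 2)) d ≤ A * Real.exp d := by
  have := Real.pi_pos
  refine ⟨(2 * Real.sqrt (Real.pi * t))⁻¹ * Real.exp t, by positivity, fun d => ?_⟩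
  rw [flatKernel_exp_neg_mul_sq ht, mul_assoc, ← Real.exp_add]
  gcongr
  rw [div_le_iff₀ (by positivity)]
  nlinarith [sq_nonneg (d + 2 * t)]

lemma exists_stepDensity_le (a : ℝ) : ∃ A, 0 < A ∧ ∀ d, stepDensity a d ≤ A * Real.exp d := by
  have hK := besselK_zero_pos (Real.exp_pos a)
  refine ⟨Real.exp (1 / Real.exp a) / (2 * besselK 0 (Real.exp a)), by positivity, fun d => ?_⟩
  rw [stepDensity, div_mul_eq_mul_div, ← Real.exp_add]
  gcongr
  have h1 := one_add_sq_half_le_cosh d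
  have h2 := Real.exp_pos a
  have h3 : 0 ≤ (Real.exp a * d + 1) ^ 2 / (2 * Real.exp a) := by positivity
  have h4 : (Real.exp a * d + 1) ^ 2 / (2 * Real.exp a) =
      Real.exp a * d ^ 2 / 2 + d + 1 / (2 * Real.exp a) := by field_simp; ring
  have h5 : 1 / (2 * Real.exp a) ≤ 1 / Real.exp a := by
    apply one_div_le_one_div_of_le h2; linarith
  nlinarith

/-- Composition with `n` steps of parameter `a`, with the growth of the exponential bound. -/
lemma IsDominated.stepChar_pow_mul {C A : ℝ} {φ : ℝ → ℝ} (h : IsDominated φ)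
    (hC : IsAdmissible C φ) (hA : ∀ d, flatKernel φ d ≤ A * Real.exp d) (a : ℝ) (n : ℕ) :
    IsDominated (fun u => stepChar a u ^ n * φ u) ∧
    IsAdmissible C (fun u => stepChar a u ^ n * φ u) ∧
    ∀ d, flatKernel (fun u => stepChar a u ^ n * φ u) d ≤ stepMoment a ^ n * A * Real.exp d := by
  induction n with
  | zero => simpa using ⟨h, hC, hA⟩
  | succ n ih =>
    obtain ⟨h1, h2, h3⟩ := ih
    have e : (fun u => stepChar a u ^ (n + 1) * φ u) =
        fun u => stepChar a u * (stepChar a u ^ n * φ u) := by ext u; ring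
    rw [e]
    refine ⟨h1.stepChar_mul a, h2.stepChar_mul a, fun d => ?_⟩
    refine (flatKernel_stepChar_mul_le h2 h3 d).trans (le_of_eq ?_)
    ring

lemma stepMoment_nonneg (a : ℝ) : 0 ≤ stepMoment a :=
  integral_nonneg fun w => mul_nonneg (stepDensity_pos a w).le (Real.cosh_pos w).le

/-- The multiplier `e^{-tu²}` of the heat semigroup lies in the class: it is reached from the step
characters by the central limit theorem, regularised by one fixed step which is then removed. The fixed step supplies the bound
`IsAdmissible` uniformly along the powers. -/
theorem isDominated_exp_neg_mul_sq {t : ℝ} (ht : 0 < t) :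
    IsDominated fun u => Real.exp (-t * u ^ 2) := by
  have hreg : ∀ a, IsDominated fun u => stepChar a u * Real.exp (-t * u ^ 2) := by
    intro a
    obtain ⟨A, hA0, hA⟩ := exists_stepDensity_le a
    have hA' : ∀ d, flatKernel (stepChar a) d ≤ A * Real.exp d := by
      intro d; rw [flatKernel_stepChar]; exact hA d
    -- `k` steps of variance about `2t / k` each, followed by one step of the fixed parameter `a`.
    have hall := fun k : ℕ => (isDominated_stepChar a).stepChar_pow_mul (isAdmissible_stepChar a) hA'
      (Real.log (k / (2 * t))) k
    refine isDominated_of_tendsto (A := Real.exp (2 * t) * A) (fun k => (hall k).1)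
      (fun k => (hall k).2.1) (fun u => ?_) fun k d => ((hall k).2.2 d).trans ?_
    · rw [mul_comm (stepChar a u)]
      exact (tendsto_stepChar_pow ht u).mul_const _
    -- The moments multiply to at most `(1 + 2t / k) ^ k ≤ e^{2t}`, uniformly in `k`.
    · gcongr
      rcases Nat.eq_zero_or_pos k with rfl | hk
      · simpa using Real.one_le_exp (by positivity : (0 : ℝ) ≤ 2 * t)
      · have hk' : (0 : ℝ) < k := by exact_mod_cast hk
        have h1 := stepMoment_le (Real.log (k / (2 * t)))
        rw [Real.exp_neg, Real.exp_log (by positivity), inv_div] at h1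
        have h2 : stepMoment (Real.log (k / (2 * t))) ≤ Real.exp (2 * t / k) := by
          linarith [Real.add_one_le_exp (2 * t / k)]
        calc _ ≤ Real.exp (2 * t / k) ^ k := pow_le_pow_left₀ (stepMoment_nonneg _) h2 k
          _ = Real.exp (2 * t) := by rw [← Real.exp_nat_mul]; congr 1; field_simp
  -- Removal of the fixed step: `stepChar (log (k + 1)) → 1`, and its moments are at most `2`.
  obtain ⟨C, hC⟩ := isAdmissible_exp_neg_mul_sq ht
  obtain ⟨A, hA0, hA⟩ := exists_flatKernel_exp_neg_mul_sq_le ht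
  refine isDominated_of_tendsto (A := 2 * A) (fun k : ℕ => hreg (Real.log (k + 1)))
    (fun k => hC.stepChar_mul _) (fun u => ?_) fun k d => ?_
  · simpa only [one_mul] using (tendsto_stepChar_one u).mul_const (Real.exp (-t * u ^ 2))
  · refine (flatKernel_stepChar_mul_le hC hA d).trans ?_
    gcongr
    have h1 := stepMoment_le (Real.log (k + 1))
    have hk : (0 : ℝ) ≤ k := by positivity
    rw [Real.exp_neg, Real.exp_log (by positivity)] at h1
    have : ((k : ℝ) + 1)⁻¹ ≤ 1 := inv_le_one_of_one_le₀ (by linarith)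
    linarith

/-! ### The heat kernel -/

lemma heatKernel_eq_specKernel (t x y : ℝ) :
    heatKernel t x y = specKernel (fun u => Real.exp (-t * u ^ 2)) x y := rfl

lemma heatKernel_nonneg {t : ℝ} (ht : 0 < t) (x y : ℝ) : 0 ≤ heatKernel t x y :=
  (isDominated_exp_neg_mul_sq ht).nonneg x y

lemma heatKernel_comm (t x y : ℝ) : heatKernel t x y = heatKernel t y x := specKernel_comm _ x y

lemma measurable_heatKernel (t : ℝ) : Measurable (Function.uncurry (heatKernel t)) :=
  measurable_specKernel (φ := fun u => Real.exp (-t * u ^ 2)) (by fun_prop)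

/-- The Gaussian bound for the free kernel decays faster than every exponential in `|x - y|`. -/
lemma exists_heatKernel_le_exp_abs {t : ℝ} (ht : 0 < t) (k : ℝ) :
    ∃ C > 0, ∀ x y, heatKernel t x y ≤ C * Real.exp (-k * |x - y|) := by
  have hp := Real.pi_pos
  refine ⟨(2 * √(Real.pi * t))⁻¹ * Real.exp (t * k ^ 2), by positivity, fun x y => ?_⟩
  refine ((isDominated_exp_neg_mul_sq ht).le_flat x y).trans ?_
  rw [flatKernel_exp_neg_mul_sq ht, mul_assoc, ← Real.exp_add]
  gcongr
  rw [div_le_iff₀ (by positivity), ← sq_abs]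
  nlinarith [sq_nonneg (|x - y| - 2 * t * k)]

/-- The decay at infinity of each factor `K_{iu}(e^x)` gives decay along the diagonal. For
`x + y → -∞` the bound is not small, and this is the reason for the condition `0 < a + c`. -/
lemma exists_heatKernel_le_exp_neg {t N : ℝ} (ht : 0 < t) (hN : 0 < N) :
    ∃ C > 0, ∀ x y, heatKernel t x y ≤ C * Real.exp (-N * (x + y)) := by
  obtain ⟨A, hA⟩ := isAdmissible_exp_neg_mul_sq ht
  obtain ⟨B, hB, hB'⟩ := exists_besselK_zero_mul_le hN cos_eleven_tenths_pos
  have hA0 : 0 ≤ A := by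
    have := (abs_nonneg _).trans (hA.bound 0); simpa using this
  have hI : 0 ≤ ∫ u, Real.exp (-(33 / 10) * |u|) ∂spectralMeasure :=
    integral_nonneg fun u => (Real.exp_pos _).le
  refine ⟨A * (B * B) * (∫ u, Real.exp (-(33 / 10) * |u|) ∂spectralMeasure) + 1, by positivity,
    fun x y => ?_⟩
  have h1 := norm_integral_le_of_norm_le (integrable_exp_spectralMeasure.const_mul
    (A * (besselBound x * besselBound y))) (.of_forall fun u => (Real.norm_eq_abs _).trans_le
      (hA.abs_mul_besselK_le u x y))
  rw [integral_const_mul] at h1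
  have hx := hB' x
  have hy := hB' y
  calc heatKernel t x y ≤ A * (besselBound x * besselBound y) *
        ∫ u, Real.exp (-(33 / 10) * |u|) ∂spectralMeasure := (Real.le_norm_self _).trans h1
    _ ≤ A * ((B * Real.exp (-N * x)) * (B * Real.exp (-N * y))) *
        ∫ u, Real.exp (-(33 / 10) * |u|) ∂spectralMeasure := by
      have := besselBound_pos x
      have := besselBound_pos y
      gcongr
      · exact hx
      · exact hy
    _ = A * (B * B) * (∫ u, Real.exp (-(33 / 10) * |u|) ∂spectralMeasure) *
        Real.exp (-N * (x + y)) := by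
      rw [show -N * (x + y) = -N * x + -N * y by ring, Real.exp_add]; ring
    _ ≤ _ := by gcongr; linarith

/-- The geometric mean of the two bounds `heatKernel t x y = O(e^{-2k|x-y|})` and
`O(e^{-2N(x+y)})`. -/
lemma exists_heatKernel_le_exp {t N : ℝ} (ht : 0 < t) (hN : 0 < N) (k : ℝ) :
    ∃ C > 0, ∀ x y, heatKernel t x y ≤ C * Real.exp (-k * |x - y| - N * (x + y)) := by
  obtain ⟨A, hA, hA'⟩ := exists_heatKernel_le_exp_abs ht (2 * k)
  obtain ⟨B, hB, hB'⟩ := exists_heatKernel_le_exp_neg ht (by positivity : 0 < 2 * N)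
  refine ⟨A + B, by positivity, fun x y => ?_⟩
  have h0 := heatKernel_nonneg ht x y
  refine le_of_sq_le_sq ?_ (by positivity)
  calc heatKernel t x y ^ 2 ≤ (A * Real.exp (-(2 * k) * |x - y|)) *
        (B * Real.exp (-(2 * N) * (x + y))) := by
        rw [sq]; exact mul_le_mul (hA' x y) (hB' x y) h0 (by positivity)
    _ = A * B * Real.exp (-k * |x - y| - N * (x + y)) ^ 2 := by
      rw [← Real.exp_nat_mul, mul_mul_mul_comm, ← Real.exp_add]; congr 2; push_cast; ring
    _ ≤ (A + B) ^ 2 * Real.exp (-k * |x - y| - N * (x + y)) ^ 2 := by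
      gcongr; nlinarith
    _ = _ := by ring

/-- In the coordinates `x + y` and `x - y` the weight is `e^{2k(x+y)} e^{(a-c)(x-y)/2}` with
`4k = a + c`. The factor in `x - y` is absorbed by the Gaussian bound, and the factor in `x + y` by
`e^{-3k(x+y)}` for `x + y ≥ 0` and by `e^{-k(x+y)}` for `x + y ≤ 0`. -/
lemma integrable_exp_mul_heatKernel {t a c : ℝ} (ht : 0 < t) (hac : 0 < a + c) :
    Integrable fun z : ℝ × ℝ => Real.exp (a * z.1 + c * z.2) * heatKernel t z.1 z.2 := by
  set k := (a + c) / 4 with hk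
  have hk0 : 0 < k := by positivity
  obtain ⟨A, hA, hA'⟩ := exists_heatKernel_le_exp ht (by positivity : 0 < 3 * k) (k + |a - c| / 2)
  obtain ⟨B, hB, hB'⟩ := exists_heatKernel_le_exp ht hk0 (k + |a - c| / 2)
  have hi := integrable_exp_neg_mul_abs hk0
  refine Integrable.mono' ((hi.mul_prod hi).const_mul (A + B))
    ((Measurable.mul (by fun_prop) (measurable_heatKernel t)).aestronglyMeasurable)
    (.of_forall fun ⟨x, y⟩ => ?_)
  have h0 := heatKernel_nonneg ht x y
  rw [Real.norm_of_nonneg (mul_nonneg (Real.exp_pos _).le h0)]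
  simp only
  rw [← Real.exp_add]
  have hd : (a - c) * (x - y) ≤ |a - c| * |x - y| := (le_abs_self _).trans (abs_mul _ _).le
  have e1 : a * x + c * y = 2 * k * (x + y) + (a - c) * (x - y) / 2 := by rw [hk]; ring
  have htri : |x| + |y| ≤ |x + y| + |x - y| := by
    rcases abs_cases x with h | h <;> rcases abs_cases y with h' | h' <;>
      linarith [le_abs_self (x + y), neg_abs_le (x + y), le_abs_self (x - y), neg_abs_le (x - y)]
  have key : ∀ D N : ℝ, 0 < D → D ≤ A + B → 2 * k * (x + y) - N * (x + y) ≤ -k * |x + y| →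
      heatKernel t x y ≤ D * Real.exp (-(k + |a - c| / 2) * |x - y| - N * (x + y)) →
      Real.exp (a * x + c * y) * heatKernel t x y ≤ (A + B) * Real.exp (-k * |x| + -k * |y|) := by
    intro D N hD hDAB hN hp
    calc _ ≤ Real.exp (a * x + c * y) *
          (D * Real.exp (-(k + |a - c| / 2) * |x - y| - N * (x + y))) := by gcongr
      _ = D * Real.exp (a * x + c * y + (-(k + |a - c| / 2) * |x - y| - N * (x + y))) := by
        rw [Real.exp_add (a * x + c * y)]; ring
      _ ≤ _ := by
        refine mul_le_mul hDAB (Real.exp_le_exp.2 ?_) (Real.exp_pos _).le (by positivity)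
        rw [e1]
        nlinarith
  rcases le_total 0 (x + y) with h | h
  · exact key A (3 * k) hA (by linarith) (by rw [abs_of_nonneg h]; linarith) (hA' x y)
  · exact key B k hB (by linarith) (by rw [abs_of_nonpos h]; linarith) (hB' x y)

lemma integrable_exp_mul_heatKernel_right {t : ℝ} (ht : 0 < t) (a x : ℝ) :
    Integrable fun y => heatKernel t x y * Real.exp (a * y) := by
  obtain ⟨A, hA, hA'⟩ := exists_heatKernel_le_exp_abs ht (1 + |a|)
  have hi := (integrable_exp_neg_mul_abs one_pos).comp_sub_left x
  refine Integrable.mono' (hi.const_mul (A * Real.exp (a * x)))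
    (Measurable.mul ((measurable_heatKernel t).comp measurable_prodMk_left)
      (by fun_prop)).aestronglyMeasurable (.of_forall fun y => ?_)
  rw [Real.norm_of_nonneg (mul_nonneg (heatKernel_nonneg ht x y) (Real.exp_pos _).le)]
  calc _ ≤ A * Real.exp (-(1 + |a|) * |x - y|) * Real.exp (a * y) := by gcongr; exact hA' x y
    _ = A * Real.exp (-(1 + |a|) * |x - y| + a * y) := by rw [mul_assoc, ← Real.exp_add]
    _ ≤ A * Real.exp (a * x + -1 * |x - y|) := by
      refine mul_le_mul_of_nonneg_left (Real.exp_le_exp.2 ?_) hA.le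
      have : -(a * (x - y)) ≤ |a| * |x - y| := (neg_le_abs _).trans (abs_mul _ _).le
      linarith
    _ = _ := by rw [Real.exp_add]; ring

/-- No section of the heat kernel vanishes almost everywhere, because `K_0` is an eigenfunction
with positive eigenvalue. -/
lemma not_heatKernel_ae_eq_zero {t : ℝ} (ht : 0 < t) (x : ℝ) :
    ¬ heatKernel t x =ᵐ[volume] 0 := by
  intro h
  have h1 := (isDominated_exp_neg_mul_sq ht).eigen 0 x
  have h2 : ∫ z, heatKernel t x z * besselK 0 (Real.exp z) = 0 := by
    refine integral_eq_zero_of_ae (h.mono fun z hz => ?_)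
    simp only [Pi.zero_apply] at hz
    simp [hz]
  have h3 := besselK_zero_pos (Real.exp_pos x)
  have : Real.exp (-t * 0 ^ 2) * besselK 0 (Real.exp x) = 0 := h1.symm.trans h2
  simp at this
  exact h3.ne' this

/-- The inner integral is positive for every `y`, since no section of the kernel vanishes almost
everywhere. -/
lemma normConst_pos {τ a c : ℝ} (hτ : 0 < τ) (hac : 0 < a + c) : 0 < normConst τ a c := by
  have hi := integrable_exp_mul_heatKernel hτ hac
  have hpos : ∀ y, 0 < ∫ x, Real.exp (a * x + c * y) * heatKernel τ x y := by
    intro y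
    have hnn : ∀ x, 0 ≤ Real.exp (a * x + c * y) * heatKernel τ x y := fun x =>
      mul_nonneg (Real.exp_pos _).le (heatKernel_nonneg hτ x y)
    refine lt_of_le_of_ne (integral_nonneg hnn) fun h => not_heatKernel_ae_eq_zero hτ y ?_
    have hint : Integrable fun x => Real.exp (a * x + c * y) * heatKernel τ x y := by
      refine ((integrable_exp_mul_heatKernel_right hτ a y).const_mul (Real.exp (c * y))).congr
        (.of_forall fun x => ?_)
      simp only
      rw [heatKernel_comm τ x y, Real.exp_add]; ring
    refine ((integral_eq_zero_iff_of_nonneg hnn hint).1 h.symm).mono fun x hx => ?_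
    simpa [heatKernel_comm τ y x, (Real.exp_pos _).ne'] using hx
  unfold normConst
  refine (integral_pos_iff_support_of_nonneg (fun y => (hpos y).le) hi.integral_prod_right).2 ?_
  rw [show (Function.support fun y => ∫ x, Real.exp (a * x + c * y) * heatKernel τ x y) = univ from
    eq_univ_of_forall fun y => (hpos y).ne']
  simp

/-- The Chapman–Kolmogorov equation: insert the spectral integral of the second factor and apply
the eigenfunction property of the first. -/
lemma integrable_heatKernel_mul_heatKernel {s t : ℝ} (hs : 0 < s) (ht : 0 < t) (x z : ℝ) :
    Integrable (fun y => heatKernel s x y * heatKernel t y z) ∧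
    ∫ y, heatKernel s x y * heatKernel t y z = heatKernel (s + t) x z := by
  have hD := isDominated_exp_neg_mul_sq hs
  obtain ⟨A, hA⟩ := isAdmissible_exp_neg_mul_sq (half_pos ht)
  have hms : Measurable (heatKernel s x) := (measurable_heatKernel s).comp measurable_prodMk_left
  have hF : Integrable (Function.uncurry fun y u : ℝ => heatKernel s x y *
      (Real.exp (-t * u ^ 2) * besselK u (Real.exp y) * besselK u (Real.exp z)))
      (volume.prod spectralMeasure) := by
    refine Integrable.mono' ((hD.integrable x).mul_prod
      (integrable_exp_spectralMeasure.const_mul (A * A * besselBound z))) ?_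
      (.of_forall fun ⟨y, u⟩ => ?_)
    · have m1 : Measurable fun q : ℝ × ℝ => besselK q.2 (Real.exp q.1) :=
        measurable_snd.besselK (Real.measurable_exp.comp measurable_fst)
      have m2 : Measurable fun q : ℝ × ℝ => besselK q.2 (Real.exp z) :=
        measurable_snd.besselK measurable_const
      have m3 : Measurable fun q : ℝ × ℝ => heatKernel s x q.1 := hms.comp measurable_fst
      exact (m3.mul ((Measurable.mul (by fun_prop) m1).mul m2)).aestronglyMeasurable
    · simp only [Function.uncurry_apply_pair]
      have h1 := hA.bound u
      have h2 := abs_besselK_exp_le u y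
      have h3 := abs_besselK_le_besselBound u z
      rw [abs_of_pos (Real.exp_pos _)] at h1
      rw [norm_mul, norm_mul, norm_mul, Real.norm_of_nonneg (heatKernel_nonneg hs x y),
        Real.norm_eq_abs, Real.norm_eq_abs, Real.norm_eq_abs, abs_of_pos (Real.exp_pos _)]
      -- Each half of the exponent gives one factor of decay rate `11 / 10`, and `K_{iu}(e^z)` the third.
      have e1 : Real.exp (-t * u ^ 2) = Real.exp (-(t / 2) * u ^ 2) * Real.exp (-(t / 2) * u ^ 2) := by
        rw [← Real.exp_add]; congr 1; ring
      have hK := besselK_zero_exp_nonneg y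
      have hp := heatKernel_nonneg hs x y
      have h4 : Real.exp (-t * u ^ 2) ≤ A * Real.exp (-(11 / 10) * |u|) *
          (A * Real.exp (-(11 / 10) * |u|)) := by
        rw [e1]
        exact mul_le_mul h1 h1 (Real.exp_pos _).le ((Real.exp_pos _).le.trans h1)
      have h5 : 0 ≤ A * Real.exp (-(11 / 10) * |u|) := (Real.exp_pos _).le.trans h1
      calc _ ≤ heatKernel s x y * (A * Real.exp (-(11 / 10) * |u|) *
            (A * Real.exp (-(11 / 10) * |u|)) * besselK 0 (Real.exp y) *
            (Real.exp (-(11 / 10) * |u|) * besselBound z)) := by gcongr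
        _ = heatKernel s x y * besselK 0 (Real.exp y) * (A * A * besselBound z *
            (Real.exp (-(11 / 10) * |u|) * Real.exp (-(11 / 10) * |u|) *
              Real.exp (-(11 / 10) * |u|))) := by ring
        _ = _ := by
          rw [← Real.exp_add, ← Real.exp_add,
            show -(11 / 10) * |u| + -(11 / 10) * |u| + -(11 / 10) * |u| = -(33 / 10) * |u| by ring]
          rfl
  have h1 : ∀ y, ∫ u, heatKernel s x y * (Real.exp (-t * u ^ 2) * besselK u (Real.exp y) *
      besselK u (Real.exp z)) ∂spectralMeasure = heatKernel s x y * heatKernel t y z := fun y => by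
    rw [integral_const_mul]; rfl
  constructor
  · exact hF.integral_prod_left.congr (.of_forall h1)
  · rw [← integral_congr_ae (.of_forall h1), integral_integral_swap hF]
    refine integral_congr_ae (.of_forall fun u => ?_)
    simp only
    have h2 : ∀ y, heatKernel s x y * (Real.exp (-t * u ^ 2) * besselK u (Real.exp y) *
        besselK u (Real.exp z)) = Real.exp (-t * u ^ 2) * besselK u (Real.exp z) *
        (specKernel (fun u => Real.exp (-s * u ^ 2)) x y * besselK u (Real.exp y)) := by
      intro y; rw [heatKernel_eq_specKernel]; ring
    simp_rw [h2]
    rw [integral_const_mul, hD.eigen u x, show -(s + t) * u ^ 2 = -s * u ^ 2 + -t * u ^ 2 by ring,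
      Real.exp_add]
    ring

/-! ### The Kolmogorov extension theorem -/

section Kolmogorov

variable {ι : Type*} {α : ι → Type*} [∀ i, TopologicalSpace (α i)]

/-- If each finite part of a sequence of points stays in the prescribed compact sets from some
index on, then the compact cylinders have a common point: the coordinatewise limit of the sequence
along an ultrafilter. -/
lemma nonempty_iInter_cylinder_of_isCompact [∀ i, T2Space (α i)] (J : ℕ → Finset ι)
    (K : ∀ n, Set (Π j : J n, α j)) (hK : ∀ n, IsCompact (K n)) (ω : ℕ → Π i, α i)
    (hω : ∀ n m, n ≤ m → (J n).restrict (ω m) ∈ K n) : (⋂ n, cylinder (J n) (K n)).Nonempty := by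
  classical
  set U : Ultrafilter ℕ := hyperfilter ℕ
  have hU : ∀ n, ∀ᶠ m in (U : Filter ℕ), n ≤ m := fun n =>
    (Nat.hyperfilter_le_atTop) (eventually_ge_atTop n)
  have hlim : ∀ n, ∃ z ∈ K n, Tendsto (fun m => (J n).restrict (ω m)) U (𝓝 z) := by
    intro n
    have h : ((U.map fun m => (J n).restrict (ω m) : Ultrafilter _) : Filter _) ≤ 𝓟 (K n) := by
      rw [le_principal_iff]
      exact (hU n).mono fun m hm => hω n m hm
    obtain ⟨z, hz, hz'⟩ := (hK n).ultrafilter_le_nhds _ h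
    exact ⟨z, hz, hz'⟩
  choose z hz hzlim using hlim
  -- Coordinates outside all the `J n` are irrelevant and get an arbitrary value.
  let w : Π i, α i := fun i =>
    if h : ∃ l, Tendsto (fun m => ω m i) U (𝓝 l) then h.choose else ω 0 i
  refine ⟨w, mem_iInter.2 fun n => ?_⟩
  have : (J n).restrict w = z n := by
    ext j
    have hj : Tendsto (fun m => ω m j) U (𝓝 (z n j)) := (tendsto_pi_nhds.1 (hzlim n)) j
    have hex : ∃ l, Tendsto (fun m => ω m j) U (𝓝 l) := ⟨_, hj⟩
    have hw : w j = hex.choose := dif_pos hex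
    rw [Finset.restrict_def]
    simp only
    rw [hw]
    exact tendsto_nhds_unique hex.choose_spec hj
  rw [mem_cylinder, this]
  exact hz n

variable [∀ i, MeasurableSpace (α i)] [∀ i, BorelSpace (α i)] [∀ i, PolishSpace (α i)]
  {P : ∀ J : Finset ι, Measure (Π j : J, α j)} [∀ J, IsFiniteMeasure (P J)]

/-- The content of a projective family on Polish spaces is continuous at the empty set: by inner
regularity the cylinders can be replaced by compact ones at an arbitrarily small total cost. -/
lemma projectiveFamilyContent_tendsto_zero (hP : IsProjectiveMeasureFamily P)
    {s : ℕ → Set (Π i, α i)} (hs : ∀ n, s n ∈ measurableCylinders α) (hanti : Antitone s)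
    (hempty : ⋂ n, s n = ∅) :
    Tendsto (fun n => projectiveFamilyContent hP (s n)) atTop (𝓝 0) := by
  have hmono : Antitone fun n => projectiveFamilyContent hP (s n) := fun m n hmn =>
    projectiveFamilyContent_mono hP (hs n) (hs m) (hanti hmn)
  have hlim := tendsto_atTop_iInf hmono
  rcases eq_or_ne (⨅ n, projectiveFamilyContent hP (s n)) 0 with h0 | h0
  · rwa [h0] at hlim
  exfalso
  obtain ⟨δ, hδ, hδsum⟩ := ENNReal.exists_pos_sum_of_countable' h0 ℕ
  choose J S hS hsJ using fun n => (mem_measurableCylinders (s n)).1 (hs n)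
  choose K hKS hKc hKδ using fun n =>
    (hS n).exists_isCompact_sdiff_lt (measure_ne_top (P (J n)) _) (hδ n).ne'
  have hKm : ∀ n, MeasurableSet (K n) := fun n => (hKc n).isClosed.measurableSet
  set B : ℕ → Set (Π i, α i) := fun n => cylinder (J n) (K n)
  have hBm : ∀ n, B n ∈ measurableCylinders α := fun n =>
    cylinder_mem_measurableCylinders _ _ (hKm n)
  have hdiff : ∀ n, projectiveFamilyContent hP (s n \ B n) ≤ δ n := by
    intro n
    have : s n \ B n = cylinder (J n) (S n \ K n) := by
      rw [hsJ n]; rfl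
    rw [this, projectiveFamilyContent_cylinder hP ((hS n).diff (hKm n))]
    exact (hKδ n).le
  -- Each `s n` exceeds `⋂ k ≤ n, B k` by less than the lower bound of the contents.
  have hne : ∀ n, ∃ ω, ∀ k ≤ n, ω ∈ B k := by
    intro n
    by_contra! hcon
    have hsub : s n ⊆ ⋃ k ≤ n, s k \ B k := by
      intro ω hω
      obtain ⟨k, hk, hkB⟩ := hcon ω
      exact mem_iUnion₂.2 ⟨k, hk, hanti hk hω, hkB⟩
    have hdm : ∀ k, s k \ B k ∈ measurableCylinders α := fun k =>
      isSetRing_measurableCylinders.sdiff_mem (hs k) (hBm k)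
    have hUm : (⋃ k ≤ n, s k \ B k) ∈ measurableCylinders α := by
      have := isSetRing_measurableCylinders.biUnion_mem (Finset.range (n + 1)) fun k _ => hdm k
      simpa only [Finset.mem_range_succ_iff] using this
    refine absurd hδsum (not_lt.2 ?_)
    calc _ ≤ projectiveFamilyContent hP (s n) := iInf_le _ n
      _ ≤ projectiveFamilyContent hP (⋃ k ≤ n, s k \ B k) :=
        projectiveFamilyContent_mono hP (hs n) hUm hsub
      _ ≤ ∑ k ∈ Finset.range (n + 1), projectiveFamilyContent hP (s k \ B k) :=
        projectiveFamilyContent_iUnion_le hP hdm n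
      _ ≤ ∑ k ∈ Finset.range (n + 1), δ k := Finset.sum_le_sum fun k _ => hdiff k
      _ ≤ ∑' k, δ k := ENNReal.sum_le_tsum _
  choose ω hω using hne
  obtain ⟨w, hw⟩ := nonempty_iInter_cylinder_of_isCompact J K hKc ω fun n m hnm => hω m n hnm
  have : w ∈ ⋂ n, s n := mem_iInter.2 fun n => by
    rw [hsJ n]
    exact hKS n (mem_iInter.1 hw n)
  rw [hempty] at this
  exact this

/-- The Kolmogorov extension theorem. -/
theorem exists_isProjectiveLimit (hP : IsProjectiveMeasureFamily P) :
    ∃ μ : Measure (Π i, α i), IsProjectiveLimit μ P := by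
  have hsub : (projectiveFamilyContent hP).IsSigmaSubadditive := by
    refine isSigmaSubadditive_of_addContent_iUnion_eq_tsum
      isSetRing_measurableCylinders (fun f hf hf_Union hf' => ?_)
    exact addContent_iUnion_eq_sum_of_tendsto_zero isSetRing_measurableCylinders
      (projectiveFamilyContent hP) (fun s hs => projectiveFamilyContent_ne_top hP)
      (fun s hs => projectiveFamilyContent_tendsto_zero hP hs) hf hf_Union hf'
  refine ⟨(projectiveFamilyContent hP).measure isSetSemiring_measurableCylinders
    generateFrom_measurableCylinders.ge hsub, fun I => ?_⟩
  ext s hs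
  rw [Measure.map_apply (Finset.measurable_restrict I) hs, AddContent.measure_eq, ← cylinder,
    projectiveFamilyContent_cylinder hP hs]
  · exact generateFrom_measurableCylinders.symm
  · exact cylinder_mem_measurableCylinders _ _ hs

end Kolmogorov

/-! ### Consistent joint densities -/

section MarkovDensity

open scoped ENNReal

variable {T : Type*} [LinearOrder T] [OrderBot T]

/-- The last time of `I` before `k`, or `⊥` if there is none. -/
def predIn (I : Finset T) (k : T) : T := (I.filter (· < k)).sup id

lemma sup_id_mem {I : Finset T} (hI : ⊥ ∈ I) : I.sup id ∈ I := by
  obtain ⟨k, hk, h⟩ := Finset.exists_mem_eq_sup I ⟨⊥, hI⟩ id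
  rw [h]; exact hk

lemma predIn_mem {I : Finset T} (hI : ⊥ ∈ I) (k : T) : predIn I k ∈ I := by
  rcases (I.filter (· < k)).eq_empty_or_nonempty with h | h
  · rw [predIn, h, Finset.sup_empty]; exact hI
  · obtain ⟨i, hi, h'⟩ := Finset.exists_mem_eq_sup _ h id
    rw [predIn, h']
    exact (Finset.mem_filter.1 hi).1

lemma predIn_lt {I : Finset T} {k : T} (hk : k ≠ ⊥) : predIn I k < k :=
  (Finset.sup_lt_iff (bot_lt_iff_ne_bot.2 hk)).2 fun _ hi => (Finset.mem_filter.1 hi).2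

lemma le_predIn {I : Finset T} {i k : T} (hi : i ∈ I) (hik : i < k) : i ≤ predIn I k :=
  Finset.le_sup (f := id) (Finset.mem_filter.2 ⟨hi, hik⟩)

lemma predIn_eq {I : Finset T} {i k : T} (hi : i ∈ I) (hik : i < k)
    (h : ∀ l ∈ I, l < k → l ≤ i) : predIn I k = i :=
  le_antisymm (Finset.sup_le fun l hl => h l (Finset.mem_filter.1 hl).1 (Finset.mem_filter.1 hl).2)
    (le_predIn hi hik)

lemma predIn_insert_of_le {I : Finset T} {j k : T} (hkj : k ≤ j) :
    predIn (insert j I) k = predIn I k := by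
  rw [predIn, Finset.filter_insert, if_neg (not_lt.2 hkj), predIn]

lemma predIn_insert_of_lt_mem {I : Finset T} {i j k : T} (hi : i ∈ I) (hji : j < i) (hik : i < k) :
    predIn (insert j I) k = predIn I k := by
  rw [predIn, Finset.filter_insert, if_pos (hji.trans hik), Finset.sup_insert, id]
  exact sup_eq_right.2 (hji.le.trans (le_predIn hi hik))

/-- An entrance law `e` at the least time, transition densities `q s t x y` from `(s, x)` to
`(t, y)`, and space-time harmonic functions `h t`, normalized so that the `h`-transform of `q`
started from the density `e * h ⊥` is a Markov process of total mass one. -/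
structure IsMarkovDensity (e : ℝ → ℝ≥0∞) (q : T → T → ℝ → ℝ → ℝ≥0∞) (h : T → ℝ → ℝ≥0∞) : Prop where
  measurable_init : Measurable e
  measurable_kernel : ∀ s t, Measurable (Function.uncurry (q s t))
  measurable_weight : ∀ t, Measurable (h t)
  comp : ∀ r s t, r < s → s < t → ∀ x z, ∫⁻ y, q r s x y * q s t y z = q r t x z
  harmonic : ∀ s t, s < t → ∀ x, ∫⁻ y, q s t x y * h t y = h s x
  total : ∫⁻ x, e x * h ⊥ x = 1
  weight_ne_top : ∀ t x, h t x ≠ ∞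

/-- The density at the times `I` of the unweighted chain with entrance law `e` and transition
densities `q`, as a function on all of `T → ℝ`. -/
noncomputable def chainDensity (e : ℝ → ℝ≥0∞) (q : T → T → ℝ → ℝ → ℝ≥0∞) (I : Finset T) (x : T → ℝ) : ℝ≥0∞ :=
  e (x ⊥) * ∏ k ∈ I.erase ⊥, q (predIn I k) k (x (predIn I k)) (x k)

/-- The joint density of the `h`-transformed chain at the times `I`, as a function on `T → ℝ`. -/
noncomputable def markovDensity (e : ℝ → ℝ≥0∞) (q : T → T → ℝ → ℝ → ℝ≥0∞) (h : T → ℝ → ℝ≥0∞) (I : Finset T)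
    (x : T → ℝ) : ℝ≥0∞ :=
  chainDensity e q I x * h (I.sup id) (x (I.sup id))

variable {e : ℝ → ℝ≥0∞} {q : T → T → ℝ → ℝ → ℝ≥0∞} {h : T → ℝ → ℝ≥0∞}

lemma chainDensity_update {I : Finset T} (hI : ⊥ ∈ I) {j : T} (hj : j ∉ I) (x : T → ℝ) (y : ℝ) :
    chainDensity e q I (Function.update x j y) = chainDensity e q I x := by
  have hne : ∀ k ∈ I, k ≠ j := fun k hk h => hj (h ▸ hk)
  unfold chainDensity
  rw [Function.update_of_ne (hne _ hI)]
  congr 1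
  refine Finset.prod_congr rfl fun k hk => ?_
  rw [Function.update_of_ne (hne _ (predIn_mem hI k)),
    Function.update_of_ne (hne _ (Finset.mem_of_mem_erase hk))]

lemma sup_insert_of_forall_lt {I : Finset T} {j : T} (hj : ∀ k ∈ I, k < j) :
    (insert j I).sup id = j := by
  rw [Finset.sup_insert, id]
  exact sup_eq_left.2 (Finset.sup_le fun k hk => (hj k hk).le)

/-- Appending a time after all others multiplies the density by one more transition. -/
lemma chainDensity_insert_of_forall_lt {I : Finset T} (hI : ⊥ ∈ I) {j : T} (hj : ∀ k ∈ I, k < j)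
    (x : T → ℝ) : chainDensity e q (insert j I) x =
      chainDensity e q I x * q (I.sup id) j (x (I.sup id)) (x j) := by
  have hjI : j ∉ I := fun h => lt_irrefl j (hj j h)
  have hpj : predIn (insert j I) j = I.sup id :=
    predIn_eq (Finset.mem_insert_of_mem (sup_id_mem hI)) (hj _ (sup_id_mem hI)) fun l hl hlj =>
      Finset.le_sup (f := id) (Finset.mem_of_mem_insert_of_ne hl hlj.ne)
  unfold chainDensity
  rw [Finset.erase_insert_of_ne (hj _ hI).ne',
    Finset.prod_insert fun h => hjI (Finset.mem_of_mem_erase h), hpj, mul_comm (q _ _ _ _), mul_assoc]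
  congr 2
  refine Finset.prod_congr rfl fun k hk => ?_
  rw [predIn_insert_of_le (hj k (Finset.mem_of_mem_erase hk)).le]

/-- Inserting a time `j` whose successor in `I` is `m` splits the transition into `m`. The cofactor
`R` collects the remaining transitions, none of which involves the coordinate `j`. -/
lemma chainDensity_insert_of_lt {I : Finset T} (hI : ⊥ ∈ I) {j m : T} (hj : j ∉ I) (hm : m ∈ I)
    (hjm : j < m) (hmin : ∀ k ∈ I, j < k → m ≤ k) :
    ∃ R : (T → ℝ) → ℝ≥0∞, (∀ x y, R (Function.update x j y) = R x) ∧
      (∀ x, chainDensity e q I x = R x * q (predIn I m) m (x (predIn I m)) (x m)) ∧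
      ∀ x, chainDensity e q (insert j I) x = R x * (q (predIn I m) j (x (predIn I m)) (x j) *
        q j m (x j) (x m)) := by
  have hj0 : j ≠ ⊥ := fun h => hj (h ▸ hI)
  have hm0 : m ≠ ⊥ := (bot_le.trans_lt hjm).ne'
  have hlt : ∀ k ∈ I, k < m → k < j := fun k hk hkm =>
    lt_of_le_of_ne (not_lt.1 fun h => (hmin k hk h).not_gt hkm) fun h => hj (h ▸ hk)
  have hpm : predIn (insert j I) m = j :=
    predIn_eq (Finset.mem_insert_self _ _) hjm fun l hl hlm => by
      rcases Finset.mem_insert.1 hl with rfl | hl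
      · exact le_rfl
      · exact (hlt l hl hlm).le
  have hpj : predIn (insert j I) j = predIn I m := by
    rw [predIn_insert_of_le le_rfl]
    exact predIn_eq (predIn_mem hI m) (hlt _ (predIn_mem hI m) (predIn_lt hm0)) fun l hl hlj =>
      le_predIn hl (hlj.trans hjm)
  have hne : ∀ k ∈ I, k ≠ j := fun k hk h => hj (h ▸ hk)
  refine ⟨fun x => e (x ⊥) * ∏ k ∈ (I.erase ⊥).erase m, q (predIn I k) k (x (predIn I k)) (x k),
    fun x y => ?_, fun x => ?_, fun x => ?_⟩
  · simp only
    rw [Function.update_of_ne (hne _ hI)]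
    congr 1
    refine Finset.prod_congr rfl fun k hk => ?_
    rw [Function.update_of_ne (hne _ (predIn_mem hI k)), Function.update_of_ne
      (hne _ (Finset.mem_of_mem_erase (Finset.mem_of_mem_erase hk)))]
  · rw [chainDensity, ← Finset.mul_prod_erase _ _ (Finset.mem_erase.2 ⟨hm0, hm⟩)]
    ring
  · rw [chainDensity, Finset.erase_insert_of_ne hj0,
      Finset.prod_insert fun h => hj (Finset.mem_of_mem_erase h),
      ← Finset.mul_prod_erase _ _ (Finset.mem_erase.2 ⟨hm0, hm⟩), hpm, hpj]
    rw [Finset.prod_congr rfl fun k hk => ?_]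
    · ring
    · obtain ⟨hkm, hk⟩ := Finset.mem_erase.1 hk
      have hkI := Finset.mem_of_mem_erase hk
      rcases lt_or_ge j k with hjk | hjk
      · rw [predIn_insert_of_lt_mem hm hjm (lt_of_le_of_ne (hmin k hkI hjk) hkm.symm)]
      · rw [predIn_insert_of_le hjk]

namespace IsMarkovDensity

variable (H : IsMarkovDensity e q h)

include H

lemma measurable_chainDensity (I : Finset T) : Measurable (chainDensity e q I) := by
  have h1 := H.measurable_init
  have h2 : ∀ s t : T, Measurable fun x : T → ℝ => q s t (x s) (x t) := fun s t =>
    Measurable.comp (f := fun x : T → ℝ => (x s, x t)) (H.measurable_kernel s t)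
      ((measurable_pi_apply s).prodMk (measurable_pi_apply t))
  exact (h1.comp (measurable_pi_apply _)).mul (Finset.measurable_fun_prod _ fun k _ => h2 _ _)

lemma measurable_markovDensity (I : Finset T) : Measurable (markovDensity e q h I) :=
  (H.measurable_chainDensity I).mul ((H.measurable_weight _).comp (measurable_pi_apply _))

/-- The joint densities are consistent: integrating out one time removes it. For the last time this
is harmonicity of the weight, for any other time the Chapman–Kolmogorov equation. -/
lemma lintegral_markovDensity_insert {I : Finset T} (hI : ⊥ ∈ I) {j : T} (hj : j ∉ I) (x : T → ℝ) :
    ∫⁻ y, markovDensity e q h (insert j I) (Function.update x j y) = markovDensity e q h I x := by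
  have hne : ∀ k ∈ I, k ≠ j := fun k hk h => hj (h ▸ hk)
  have hmk : ∀ (s t : T) (a : ℝ), Measurable fun y => q s t a y := fun s t a =>
    Measurable.comp (g := Function.uncurry (q s t)) (H.measurable_kernel s t) measurable_prodMk_left
  have hmk' : ∀ (s t : T) (a : ℝ), Measurable fun y => q s t y a := fun s t a =>
    Measurable.comp (g := Function.uncurry (q s t)) (H.measurable_kernel s t) measurable_prodMk_right
  rcases (I.filter (j < ·)).eq_empty_or_nonempty with hemp | hnon
  · have hlt : ∀ k ∈ I, k < j := fun k hk => lt_of_le_of_ne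
      (not_lt.1 fun h => by
        have := Finset.mem_filter.2 ⟨hk, h⟩
        rw [hemp] at this
        simp at this) (hne k hk)
    unfold markovDensity
    simp_rw [sup_insert_of_forall_lt hlt, chainDensity_insert_of_forall_lt hI hlt,
      chainDensity_update hI hj, Function.update_self,
      Function.update_of_ne (hne _ (sup_id_mem hI)), mul_assoc]
    have hmeas : Measurable fun y => q (I.sup id) j (x (I.sup id)) y * h j y :=
      (hmk _ _ _).mul (H.measurable_weight _)
    rw [lintegral_const_mul _ hmeas,
      H.harmonic _ _ (hlt _ (sup_id_mem hI))]
  · obtain ⟨m, hm, hmin⟩ : ∃ m, (m ∈ I ∧ j < m) ∧ ∀ k ∈ I, j < k → m ≤ k :=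
      ⟨(I.filter (j < ·)).min' hnon, Finset.mem_filter.1 (Finset.min'_mem _ hnon), fun k hk hjk =>
        Finset.min'_le _ _ (Finset.mem_filter.2 ⟨hk, hjk⟩)⟩
    have hsup : (insert j I).sup id = I.sup id := by
      rw [Finset.sup_insert, id]
      exact sup_eq_right.2 (hm.2.le.trans (Finset.le_sup (f := id) hm.1))
    have hpm : predIn I m < j := lt_of_le_of_ne
      (not_lt.1 fun h => (hmin _ (predIn_mem hI m) h).not_gt (predIn_lt (bot_le.trans_lt hm.2).ne'))
      (hne _ (predIn_mem hI m))
    obtain ⟨R, hRu, hR, hR'⟩ := chainDensity_insert_of_lt (e := e) (q := q) hI hj hm.1 hm.2 hmin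
    unfold markovDensity
    rw [hsup]
    simp_rw [Function.update_of_ne (hne _ (sup_id_mem hI))]
    simp_rw [hR', hRu, Function.update_self, Function.update_of_ne (hne _ hm.1),
      Function.update_of_ne (hne _ (predIn_mem hI m))]
    have hmeas : Measurable fun y => q (predIn I m) j (x (predIn I m)) y * q j m y (x m) :=
      (hmk _ _ _).mul (hmk' _ _ _)
    rw [lintegral_mul_const _ (hmeas.const_mul _), lintegral_const_mul _ hmeas,
      H.comp _ _ _ hpm hm.2, hR]

end IsMarkovDensity

end MarkovDensity

/-! ### The law on path space -/

section MarkovProcess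

open scoped ENNReal

variable {T : Type*} [LinearOrder T] [OrderBot T]

omit [LinearOrder T] [OrderBot T] in
lemma dependsOn_indicator_preimage {β : Type*} {F : (T → ℝ) → β} {s : Set T} (hF : DependsOn F s)
    (S : Set β) : DependsOn ((F ⁻¹' S).indicator (1 : (T → ℝ) → ℝ≥0∞)) s := fun x y hxy => by
  change S.indicator (1 : β → ℝ≥0∞) (F x) = S.indicator 1 (F y)
  rw [hF hxy]

/-- The joint law at the times `J` of the `h`-transformed chain: its joint density at the times
`insert ⊥ J`, projected to `J`. -/
noncomputable def fddMeasure (e : ℝ → ℝ≥0∞) (q : T → T → ℝ → ℝ → ℝ≥0∞) (h : T → ℝ → ℝ≥0∞)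
    (J : Finset T) : Measure (J → ℝ) :=
  ((volume : Measure ((insert ⊥ J : Finset T) → ℝ)).withDensity fun y =>
    markovDensity e q h (insert ⊥ J) (Function.updateFinset 0 (insert ⊥ J) y)).map
      (Finset.restrict₂ (π := fun _ : T => ℝ) (Finset.subset_insert ⊥ J))

variable {e : ℝ → ℝ≥0∞} {q : T → T → ℝ → ℝ → ℝ≥0∞} {h : T → ℝ → ℝ≥0∞}

namespace IsMarkovDensity

variable (H : IsMarkovDensity e q h)

include H

/-- A functional of the times `I` has the same integral against the joint density at any larger set
of times. -/
lemma lmarginal_markovDensity_mul {I : Finset T} (hI : ⊥ ∈ I) {Φ : (T → ℝ) → ℝ≥0∞}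
    (hΦ : Measurable Φ) (hdep : DependsOn Φ I) (K : Finset T) :
    (∫⋯∫⁻_(I ∪ K), fun x => markovDensity e q h (I ∪ K) x * Φ x) =
      ∫⋯∫⁻_I, fun x => markovDensity e q h I x * Φ x := by
  induction K using Finset.induction_on with
  | empty => simp
  | insert j K _ ih =>
    rw [Finset.union_insert]
    by_cases hj : j ∈ I ∪ K
    · rw [Finset.insert_eq_of_mem hj, ih]
    · rw [lmarginal_insert' (fun x => markovDensity e q h (insert j (I ∪ K)) x * Φ x) ((H.measurable_markovDensity _).mul hΦ) hj, ← ih]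
      congr 1
      ext x
      have hΦj : ∀ y, Φ (Function.update x j y) = Φ x := fun y => hdep fun i hi =>
        Function.update_of_ne (ne_of_mem_of_not_mem (Finset.mem_union_left _ hi) hj) _ _
      simp_rw [hΦj]
      have hmeas : Measurable fun y =>
          markovDensity e q h (insert j (I ∪ K)) (Function.update x j y) :=
        (H.measurable_markovDensity _).comp (measurable_update x)
      rw [lintegral_mul_const _ hmeas,
        H.lintegral_markovDensity_insert (Finset.mem_union_left _ hI) hj]

lemma lintegral_fddMeasure (J : Finset T) {φ : (J → ℝ) → ℝ≥0∞} (hφ : Measurable φ) :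
    ∫⁻ y, φ y ∂fddMeasure e q h J = (∫⋯∫⁻_(insert ⊥ J), fun x =>
      markovDensity e q h (insert ⊥ J) x * φ (J.restrict x)) 0 := by
  have hm : Measurable fun y : (insert ⊥ J : Finset T) → ℝ =>
      markovDensity e q h (insert ⊥ J) (Function.updateFinset 0 (insert ⊥ J) y) :=
    (H.measurable_markovDensity _).comp measurable_updateFinset
  have hr : Measurable (Finset.restrict₂ (π := fun _ : T => ℝ) (Finset.subset_insert ⊥ J)) :=
    Finset.measurable_restrict₂ _
  rw [fddMeasure, lintegral_map hφ hr]
  refine (lintegral_withDensity_eq_lintegral_mul _ hm (hφ.comp hr)).trans ?_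
  refine lintegral_congr fun y => ?_
  simp only [Pi.mul_apply, Function.comp_apply]
  congr 2
  ext ⟨j, hj⟩
  simp [Function.updateFinset, hj]

lemma fddMeasure_apply (J : Finset T) {S : Set (J → ℝ)} (hS : MeasurableSet S) :
    fddMeasure e q h J S = (∫⋯∫⁻_(insert ⊥ J), fun x =>
      markovDensity e q h (insert ⊥ J) x * (J.restrict ⁻¹' S).indicator 1 x) 0 := by
  rw [← lintegral_indicator_one hS, H.lintegral_fddMeasure J (measurable_one.indicator hS)]
  rfl

lemma isProjectiveMeasureFamily_fddMeasure :
    IsProjectiveMeasureFamily (α := fun _ : T => ℝ) (fddMeasure e q h) := by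
  intro I J hJI
  ext S hS
  have hS' := Finset.measurable_restrict₂ (X := fun _ : T => ℝ) hJI hS
  rw [Measure.map_apply (Finset.measurable_restrict₂ (X := fun _ : T => ℝ) hJI) hS, H.fddMeasure_apply J hS,
    H.fddMeasure_apply I hS', ← Finset.union_eq_right.2 (Finset.insert_subset_insert ⊥ hJI)]
  refine (congrFun (H.lmarginal_markovDensity_mul (Finset.mem_insert_self ⊥ J)
    (measurable_one.indicator (Finset.measurable_restrict J hS)) (dependsOn_indicator_preimage (fun x y hxy => ?_) S) _) 0).symm
  ext ⟨j, hj⟩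
  exact hxy j (Finset.mem_insert_of_mem hj)

lemma isProbabilityMeasure_fddMeasure (J : Finset T) : IsProbabilityMeasure (fddMeasure e q h J) := by
  constructor
  have h1 := congrFun (H.lmarginal_markovDensity_mul (Finset.mem_singleton_self (⊥ : T))
    measurable_one (fun _ _ _ => rfl) J) 0
  rw [H.fddMeasure_apply J .univ]
  rw [← Finset.insert_eq] at h1
  simp only [preimage_univ, indicator_univ]
  rw [h1, lmarginal_singleton, ← H.total]
  refine lintegral_congr fun y => ?_
  simp [markovDensity, chainDensity]

/-- The law of the `h`-transformed chain on the space of all paths, characterised by its integrals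
of functionals of finitely many times. The base point `0` of the marginal integral plays no part,
since the integrand depends only on the coordinates in `I`. -/
lemma exists_measure : ∃ P : Measure (T → ℝ), IsProbabilityMeasure P ∧
    ∀ (I : Finset T), ⊥ ∈ I → ∀ Φ : (T → ℝ) → ℝ≥0∞, Measurable Φ → DependsOn Φ I →
      ∫⁻ x, Φ x ∂P = (∫⋯∫⁻_I, fun x => markovDensity e q h I x * Φ x) 0 := by
  have hprob := H.isProbabilityMeasure_fddMeasure
  obtain ⟨P, hP⟩ := exists_isProjectiveLimit H.isProjectiveMeasureFamily_fddMeasure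
  refine ⟨P, hP.isProbabilityMeasure, fun I hI Φ hΦ hdep => ?_⟩
  have h1 : ∀ x, Φ (Function.updateFinset 0 I (I.restrict x)) = Φ x := fun x => hdep fun i hi => by
    have hi' : i ∈ I := hi
    simp [Function.updateFinset, hi']
  have hφ : Measurable fun y : I → ℝ => Φ (Function.updateFinset 0 I y) :=
    hΦ.comp measurable_updateFinset
  calc ∫⁻ x, Φ x ∂P = ∫⁻ x, Φ (Function.updateFinset 0 I (I.restrict x)) ∂P := by simp_rw [h1]
    _ = ∫⁻ y, Φ (Function.updateFinset 0 I y) ∂fddMeasure e q h I := by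
      rw [← hP I, lintegral_map hφ (Finset.measurable_restrict I)]
    _ = _ := by
      rw [H.lintegral_fddMeasure I hφ, Finset.insert_eq_of_mem hI]
      simp_rw [h1]

end IsMarkovDensity

end MarkovProcess

/-! ### The Markov property and the joint densities -/

section MarkovProperty

open scoped ENNReal

variable {T : Type*} [LinearOrder T] [OrderBot T]
  {e : ℝ → ℝ≥0∞} {q : T → T → ℝ → ℝ → ℝ≥0∞} {h : T → ℝ → ℝ≥0∞}

/-- The transition probability from `(s, x)` into `B` at time `t` of the `h`-transformed chain. -/
noncomputable def transProb (q : T → T → ℝ → ℝ → ℝ≥0∞) (h : T → ℝ → ℝ≥0∞) (s t : T) (B : Set ℝ)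
    (x : ℝ) : ℝ≥0∞ :=
  (∫⁻ y in B, q s t x y * h t y) / h s x

namespace IsMarkovDensity

variable (H : IsMarkovDensity e q h)

include H

lemma measurable_transProb (s t : T) (B : Set ℝ) : Measurable (transProb q h s t B) := by
  have h1 : Measurable fun p : ℝ × ℝ => q s t p.1 p.2 * h t p.2 :=
    (H.measurable_kernel s t).mul ((H.measurable_weight t).comp measurable_snd)
  exact (Measurable.lintegral_prod_right' (ν := volume.restrict B) h1).div (H.measurable_weight s)

lemma lintegral_restrict_le {s t : T} (hst : s < t) (B : Set ℝ) (x : ℝ) :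
    ∫⁻ y in B, q s t x y * h t y ≤ h s x :=
  (lintegral_mono' Measure.restrict_le_self le_rfl).trans (H.harmonic s t hst x).le

/-- Where `h s x = 0` the quotient is `0 / 0 = 0`, and the right side vanishes by harmonicity. -/
lemma transProb_mul {s t : T} (hst : s < t) (B : Set ℝ) (x : ℝ) :
    transProb q h s t B x * h s x = ∫⁻ y in B, q s t x y * h t y :=
  ENNReal.div_mul_cancel' (fun h0 => le_zero_iff.1 (h0 ▸ H.lintegral_restrict_le hst B x))
    fun h1 => absurd h1 (H.weight_ne_top s x)

lemma transProb_le_one {s t : T} (hst : s < t) (B : Set ℝ) (x : ℝ) : transProb q h s t B x ≤ 1 :=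
  ENNReal.div_le_of_le_mul (by rw [one_mul]; exact H.lintegral_restrict_le hst B x)

variable {P : Measure (T → ℝ)}
  (hP : ∀ (I : Finset T), ⊥ ∈ I → ∀ Φ : (T → ℝ) → ℝ≥0∞, Measurable Φ → DependsOn Φ I →
      ∫⁻ x, Φ x ∂P = (∫⋯∫⁻_I, fun x => markovDensity e q h I x * Φ x) 0)

include hP

/-- The Markov property, tested on functionals of finitely many times up to `I.sup id`. -/
lemma lintegral_mul_indicator {I : Finset T} (hI : ⊥ ∈ I) {t : T} (ht : I.sup id < t) {B : Set ℝ}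
    (hB : MeasurableSet B) {Ψ : (T → ℝ) → ℝ≥0∞} (hΨ : Measurable Ψ) (hdep : DependsOn Ψ I) :
    ∫⁻ x, Ψ x * B.indicator 1 (x t) ∂P = ∫⁻ x, Ψ x * transProb q h (I.sup id) t B (x (I.sup id)) ∂P := by
  have hlt : ∀ k ∈ I, k < t := fun k hk => (Finset.le_sup (f := id) hk).trans_lt ht
  have htI : t ∉ I := fun h => lt_irrefl t (hlt t h)
  have hmB : Measurable fun x : T → ℝ => B.indicator (1 : ℝ → ℝ≥0∞) (x t) :=
    (measurable_one.indicator hB).comp (measurable_pi_apply t)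
  have hmg : Measurable fun x : T → ℝ => transProb q h (I.sup id) t B (x (I.sup id)) :=
    (H.measurable_transProb _ _ _).comp (measurable_pi_apply _)
  rw [hP (insert t I) (Finset.mem_insert_of_mem hI) (fun x => Ψ x * B.indicator 1 (x t))
      (hΨ.mul hmB) fun x y hxy => ?_,
    hP I hI (fun x => Ψ x * transProb q h (I.sup id) t B (x (I.sup id))) (hΨ.mul hmg) fun x y hxy => ?_]
  · rw [lmarginal_insert' (fun x => markovDensity e q h (insert t I) x * (Ψ x * B.indicator 1 (x t)))
      ((H.measurable_markovDensity _).mul (hΨ.mul hmB)) htI]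
    congr 2
    ext x
    have hΨt : ∀ y, Ψ (Function.update x t y) = Ψ x := fun y => hdep fun i hi =>
      Function.update_of_ne (ne_of_mem_of_not_mem hi htI) _ _
    have hm : Measurable fun y => q (I.sup id) t (x (I.sup id)) y * h t y :=
      (Measurable.comp (f := fun y => (x (I.sup id), y)) (H.measurable_kernel _ t)
        measurable_prodMk_left).mul (H.measurable_weight t)
    have e1 : ∀ y, markovDensity e q h (insert t I) (Function.update x t y) *
        (Ψ (Function.update x t y) * B.indicator 1 (Function.update x t y t)) =
        chainDensity e q I x * Ψ x *
          B.indicator (fun y => q (I.sup id) t (x (I.sup id)) y * h t y) y := by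
      intro y
      rw [hΨt, markovDensity, sup_insert_of_forall_lt hlt, chainDensity_insert_of_forall_lt hI hlt,
        chainDensity_update hI htI, Function.update_self,
        Function.update_of_ne (ne_of_mem_of_not_mem (sup_id_mem hI) htI)]
      by_cases hy : y ∈ B
      · simp only [indicator_of_mem hy, Pi.one_apply]; ring
      · simp only [indicator_of_notMem hy, mul_zero]
    simp_rw [e1]
    rw [lintegral_const_mul _ (hm.indicator hB), lintegral_indicator hB,
      ← H.transProb_mul ht, markovDensity]
    ring
  · simp only
    rw [hdep hxy, hxy _ (sup_id_mem hI)]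
  · simp only
    rw [hdep fun i hi => hxy i (Finset.mem_insert_of_mem hi), hxy t (Finset.mem_insert_self t I)]

/-- The Markov property, tested on all events of the past of `s`. The two sides are finite measures
on the past which agree on cylinders. -/
lemma measure_inter_eq_setLIntegral [IsProbabilityMeasure P] {s t : T} (hst : s < t) {B : Set ℝ} (hB : MeasurableSet B)
    {A : Set (T → ℝ)}
    (hA : MeasurableSet[MeasurableSpace.comap (fun (ω : T → ℝ) (r : Iic s) => ω r) inferInstance] A) :
    P ((fun ω => ω t) ⁻¹' B ∩ A) = ∫⁻ ω in A, transProb q h s t B (ω s) ∂P := by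
  set ρ : (T → ℝ) → Iic s → ℝ := fun ω r => ω r
  have hρ : Measurable ρ := measurable_pi_lambda _ fun r => measurable_pi_apply _
  have hB' : MeasurableSet ((fun ω : T → ℝ => ω t) ⁻¹' B) := measurable_pi_apply t hB
  have hg : Measurable fun ω : T → ℝ => transProb q h s t B (ω s) :=
    (H.measurable_transProb s t B).comp (measurable_pi_apply s)
  set M₁ := (P.restrict ((fun ω => ω t) ⁻¹' B)).map ρ
  set M₂ := (P.withDensity fun ω => transProb q h s t B (ω s)).map ρ
  have hM : M₁ = M₂ := by
    refine IsProjectiveLimit.unique (P := fun J : Finset (Iic s) => M₁.map J.restrict)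
      (fun J => rfl) fun J => ?_
    ext S hS
    have hr : Measurable (J.restrict (π := fun _ : Iic s => ℝ)) := Finset.measurable_restrict J
    have hD : MeasurableSet (ρ ⁻¹' (J.restrict ⁻¹' S)) := hρ (hr hS)
    rw [Measure.map_apply hr hS, Measure.map_apply hr hS, Measure.map_apply hρ (hr hS),
      Measure.map_apply hρ (hr hS), Measure.restrict_apply hD, withDensity_apply _ hD]
    set D := ρ ⁻¹' (J.restrict ⁻¹' S) with hDdef
    set I : Finset T := insert ⊥ (insert s (J.map (Function.Embedding.subtype _))) with hIdef
    have hsup : I.sup id = s := by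
      refine le_antisymm (Finset.sup_le fun i hi => ?_) (Finset.le_sup (f := id) (by simp [hIdef]))
      rcases Finset.mem_insert.1 hi with rfl | hi
      · exact bot_le
      rcases Finset.mem_insert.1 hi with rfl | hi
      · exact le_rfl
      · obtain ⟨j, _, rfl⟩ := Finset.mem_map.1 hi
        exact j.2
    have hdep : DependsOn (D.indicator (1 : (T → ℝ) → ℝ≥0∞)) I := by
      refine dependsOn_indicator_preimage (F := fun ω => J.restrict (ρ ω)) (fun x y hxy => ?_) S
      ext ⟨j, hj⟩
      exact hxy j (Finset.mem_insert_of_mem (Finset.mem_insert_of_mem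
        (Finset.mem_map_of_mem (Function.Embedding.subtype _) hj)))
    have key := H.lintegral_mul_indicator hP (Finset.mem_insert_self _ _) (hsup ▸ hst) hB
      (measurable_one.indicator hD) hdep
    rw [← hIdef, hsup] at key
    rw [← lintegral_indicator hD, ← lintegral_indicator_one (hD.inter hB')]
    refine Eq.trans ?_ (key.symm.trans ?_)
    · refine lintegral_congr fun ω => ?_
      by_cases hω : ω ∈ D <;> simp [hω]
    · refine lintegral_congr fun ω => ?_
      by_cases hω : ω ∈ D <;> by_cases hω' : ω t ∈ B <;> simp [hω, hω', indicator]
  obtain ⟨A', hA', rfl⟩ := hA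
  have h1 := congrArg (fun M : Measure (Iic s → ℝ) => M A') hM
  simp only [M₁, M₂] at h1
  rwa [Measure.map_apply hρ hA', Measure.map_apply hρ hA', Measure.restrict_apply (hρ hA'),
    withDensity_apply _ (hρ hA'), inter_comm] at h1

/-- The coordinate process under the path law of a Markov density is a Markov process. -/
theorem isMarkovProcess_eval [IsProbabilityMeasure P] : IsMarkovProcess (fun (t : T) (ω : T → ℝ) => ω t) P where
  measurable t := measurable_pi_apply t
  markov s t hst B hB := by
    have hle : ∀ r : T, MeasurableSpace.comap (fun ω : T → ℝ => ω r) inferInstance ≤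
        (MeasurableSpace.pi : MeasurableSpace (T → ℝ)) := fun r =>
      (measurable_pi_apply r).comap_le
    have hpast : (⨆ r, ⨆ _ : r ≤ s, MeasurableSpace.comap (fun ω : T → ℝ => ω r) inferInstance) ≤
        MeasurableSpace.comap (fun (ω : T → ℝ) (r : Iic s) => ω r) inferInstance := by
      refine iSup₂_le fun r hr => ?_
      refine Measurable.comap_le ?_
      exact (measurable_pi_apply (X := fun _ : Iic s => ℝ) ⟨r, hr⟩).comp (comap_measurable _)
    have hpres : MeasurableSpace.comap (fun ω : T → ℝ => ω s) inferInstance ≤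
        ⨆ r, ⨆ _ : r ≤ s, MeasurableSpace.comap (fun ω : T → ℝ => ω r) inferInstance :=
      le_iSup₂_of_le s le_rfl le_rfl
    have hpast' : (⨆ r, ⨆ _ : r ≤ s, MeasurableSpace.comap (fun ω : T → ℝ => ω r) inferInstance) ≤
        (MeasurableSpace.pi : MeasurableSpace (T → ℝ)) := iSup₂_le fun r _ => hle r
    have hB' : MeasurableSet ((fun ω : T → ℝ => ω t) ⁻¹' B) := measurable_pi_apply t hB
    have hint : Integrable (((fun ω : T → ℝ => ω t) ⁻¹' B).indicator fun _ => (1 : ℝ)) P :=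
      (integrable_const 1).indicator hB'
    rcases hst.eq_or_lt with rfl | hst
    · have hm : StronglyMeasurable[MeasurableSpace.comap (fun ω : T → ℝ => ω s) inferInstance]
          (((fun ω : T → ℝ => ω s) ⁻¹' B).indicator fun _ => (1 : ℝ)) :=
        stronglyMeasurable_const.indicator ⟨B, hB, rfl⟩
      rw [condExp_of_stronglyMeasurable (hle s) hm hint,
        condExp_of_stronglyMeasurable hpast' (hm.mono hpres) hint]
    -- Both conditional expectations are the transition probability out of the present state.
    have hg : Measurable[MeasurableSpace.comap (fun ω : T → ℝ => ω s) inferInstance]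
        fun ω : T → ℝ => transProb q h s t B (ω s) :=
      (H.measurable_transProb s t B).comp (comap_measurable _)
    have hg1 : ∀ ω : T → ℝ, transProb q h s t B (ω s) ≤ 1 := fun ω =>
      H.transProb_le_one hst B (ω s)
    have key : ∀ m : MeasurableSpace (T → ℝ),
        MeasurableSpace.comap (fun ω : T → ℝ => ω s) inferInstance ≤ m →
        m ≤ (⨆ r, ⨆ _ : r ≤ s, MeasurableSpace.comap (fun ω : T → ℝ => ω r) inferInstance) →
        (fun ω : T → ℝ => (transProb q h s t B (ω s)).toReal) =ᵐ[P]
          P[((fun ω : T → ℝ => ω t) ⁻¹' B).indicator fun _ => (1 : ℝ) | m] := by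
      intro m hm1 hm2
      have hi : Integrable (fun ω : T → ℝ => (transProb q h s t B (ω s)).toReal) P := by
        refine Integrable.mono' (integrable_const (1 : ℝ))
          (hg.mono (hle s) le_rfl).ennreal_toReal.aestronglyMeasurable (.of_forall fun ω => ?_)
        rw [Real.norm_of_nonneg ENNReal.toReal_nonneg]
        exact ENNReal.toReal_le_of_le_ofReal zero_le_one (by simpa using hg1 ω)
      refine ae_eq_condExp_of_forall_setIntegral_eq (hm2.trans hpast') hint
        (fun A _ _ => hi.integrableOn) (fun A hA _ => ?_)
        (hg.mono hm1 le_rfl).ennreal_toReal.stronglyMeasurable.aestronglyMeasurable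
      have h1 := H.measure_inter_eq_setLIntegral hP hst hB (hpast _ (hm2 _ hA))
      rw [integral_toReal (hg.mono (hle s) le_rfl).aemeasurable
        (.of_forall fun ω => (hg1 ω).trans_lt ENNReal.one_lt_top), ← h1,
        integral_indicator_const _ hB', Measure.real, Measure.restrict_apply hB']
      simp
    exact (key _ hpres le_rfl).symm.trans (key _ le_rfl hpres)

/-- The joint density at an increasing sequence of times starting at the least time. -/
theorem map_eq_withDensity {d : ℕ} {t : Fin (d + 2) → T} (ht : StrictMono t) (h0 : t 0 = ⊥) :
    P.map (fun ω k => ω (t k)) = volume.withDensity fun x : Fin (d + 2) → ℝ =>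
      e (x 0) * (∏ k : Fin (d + 1), q (t k.castSucc) (t k.succ) (x k.castSucc) (x k.succ)) *
        h (t (Fin.last (d + 1))) (x (Fin.last (d + 1))) := by
  classical
  set f : (Fin (d + 2) → ℝ) → ℝ≥0∞ := fun x =>
      e (x 0) * (∏ k : Fin (d + 1), q (t k.castSucc) (t k.succ) (x k.castSucc) (x k.succ)) *
        h (t (Fin.last (d + 1))) (x (Fin.last (d + 1))) with hf
  have hfm : Measurable f := by
    have h1 := H.measurable_init
    have h2 := H.measurable_weight (t (Fin.last (d + 1)))
    have h3 : ∀ k : Fin (d + 1), Measurable fun x : Fin (d + 2) → ℝ =>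
        q (t k.castSucc) (t k.succ) (x k.castSucc) (x k.succ) := fun k =>
      Measurable.comp (f := fun x : Fin (d + 2) → ℝ => (x k.castSucc, x k.succ))
        (H.measurable_kernel _ _) ((measurable_pi_apply _).prodMk (measurable_pi_apply _))
    exact ((h1.comp (measurable_pi_apply _)).mul (Finset.measurable_fun_prod _ fun k _ => h3 k)).mul
      (h2.comp (measurable_pi_apply _))
  set I : Finset T := Finset.univ.image t with hI
  have hbot : ⊥ ∈ I := h0 ▸ Finset.mem_image_of_mem t (Finset.mem_univ 0)
  have hsup : I.sup id = t (Fin.last (d + 1)) := by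
    refine le_antisymm (Finset.sup_le fun i hi => ?_)
      (Finset.le_sup (f := id) (Finset.mem_image_of_mem t (Finset.mem_univ _)))
    obtain ⟨k, _, rfl⟩ := Finset.mem_image.1 hi
    exact ht.monotone (Fin.le_last k)
  have hpred : ∀ k : Fin (d + 1), predIn I (t k.succ) = t k.castSucc := fun k =>
    predIn_eq (Finset.mem_image_of_mem t (Finset.mem_univ _)) (ht Fin.castSucc_lt_succ)
      fun l hl hlk => by
        obtain ⟨i, _, rfl⟩ := Finset.mem_image.1 hl
        exact ht.monotone (Fin.le_castSucc_iff.2 (ht.lt_iff_lt.1 hlk))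
  have herase : I.erase ⊥ = Finset.univ.image fun k : Fin (d + 1) => t k.succ := by
    ext i
    simp only [hI, Finset.mem_erase, Finset.mem_image, Finset.mem_univ, true_and]
    constructor
    · rintro ⟨hi, k, rfl⟩
      have hk : k ≠ 0 := fun hk => hi (by rw [hk, h0])
      exact ⟨k.pred hk, by rw [Fin.succ_pred]⟩
    · rintro ⟨k, rfl⟩
      exact ⟨fun hk => (Fin.succ_ne_zero k) (ht.injective (hk.trans h0.symm)), k.succ, rfl⟩
  have hdens : ∀ x : T → ℝ, markovDensity e q h I x = f fun k => x (t k) := by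
    intro x
    rw [markovDensity, chainDensity, hsup, herase, Finset.prod_image fun i _ j _ hij =>
      Fin.succ_injective _ (ht.injective hij), hf]
    simp_rw [hpred, h0]
  have hmt : Measurable fun (ω : T → ℝ) k => ω (t k) :=
    measurable_pi_lambda _ fun k => measurable_pi_apply _
  ext S hS
  have hmS : Measurable (S.indicator (1 : (Fin (d + 2) → ℝ) → ℝ≥0∞)) := measurable_one.indicator hS
  rw [Measure.map_apply hmt hS, withDensity_apply _ hS, ← lintegral_indicator_one (hmt hS),
    hP I hbot _ (measurable_one.indicator (hmt hS)) (dependsOn_indicator_preimage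
      (F := fun (ω : T → ℝ) k => ω (t k)) (fun x y hxy => funext fun k => hxy _ (Finset.mem_image_of_mem t (Finset.mem_univ k))) S)]
  · have h1 := lmarginal_image (X := fun _ : T => ℝ) (μ := fun _ => volume) ht.injective Finset.univ
      (hfm.mul hmS) 0
    rw [lmarginal_univ] at h1
    refine Eq.trans ?_ (h1.trans ?_)
    · congr 2
      ext x
      rw [hdens]
      rfl
    · rw [← lintegral_indicator hS]
      refine lintegral_congr fun x => ?_
      by_cases hx : x ∈ S <;> simp [hx]

end IsMarkovDensity

end MarkovProperty

/-! ### The weighted heat kernel as a Markov density -/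

section HeatProcess

open scoped ENNReal

/-- The time interval `[0, τ]` with its least element. -/
noncomputable abbrev orderBotIcc {τ : ℝ} (hτ : 0 < τ) : OrderBot (Icc (0 : ℝ) τ) where
  bot := ⟨0, left_mem_Icc.2 hτ.le⟩
  bot_le x := x.2.1

/-- The function `x ↦ ∫ p_{τ-t}(x, z) e^{a z} dz`, with its limit value `e^{a x}` at `t = τ`. -/
noncomputable def heatWeight (τ a t x : ℝ) : ℝ≥0∞ :=
  if t = τ then ENNReal.ofReal (Real.exp (a * x)) else
    ∫⁻ z, ENNReal.ofReal (heatKernel (τ - t) x z) * ENNReal.ofReal (Real.exp (a * z))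

lemma measurable_ofReal_heatKernel (t : ℝ) :
    Measurable fun p : ℝ × ℝ => ENNReal.ofReal (heatKernel t p.1 p.2) :=
  (measurable_heatKernel t).ennreal_ofReal

lemma lintegral_heatKernel_mul_heatKernel {s t : ℝ} (hs : 0 < s) (ht : 0 < t) (x z : ℝ) :
    ∫⁻ y, ENNReal.ofReal (heatKernel s x y) * ENNReal.ofReal (heatKernel t y z) =
      ENNReal.ofReal (heatKernel (s + t) x z) := by
  obtain ⟨hi, h⟩ := integrable_heatKernel_mul_heatKernel hs ht x z
  rw [← h, ofReal_integral_eq_lintegral_ofReal hi (.of_forall fun y =>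
    mul_nonneg (heatKernel_nonneg hs x y) (heatKernel_nonneg ht y z))]
  simp_rw [ENNReal.ofReal_mul (heatKernel_nonneg hs _ _)]

lemma measurable_heatWeight (τ a t : ℝ) : Measurable (heatWeight τ a t) := by
  unfold heatWeight
  split_ifs
  · fun_prop
  · have h : Measurable fun p : ℝ × ℝ => ENNReal.ofReal (heatKernel (τ - t) p.1 p.2) *
        ENNReal.ofReal (Real.exp (a * p.2)) :=
      (measurable_ofReal_heatKernel _).mul (by fun_prop)
    exact Measurable.lintegral_prod_right' h

lemma heatWeight_ne_top {τ t : ℝ} (ht : t ≤ τ) (a x : ℝ) : heatWeight τ a t x ≠ ∞ := by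
  unfold heatWeight
  split_ifs with h
  · exact ENNReal.ofReal_ne_top
  · have hpos : 0 < τ - t := sub_pos.2 (lt_of_le_of_ne ht h)
    simp_rw [← ENNReal.ofReal_mul (heatKernel_nonneg hpos _ _)]
    exact (integrable_exp_mul_heatKernel_right hpos a x).lintegral_lt_top.ne

/-- Harmonicity of the weight, from the Chapman–Kolmogorov equation. -/
lemma lintegral_heatKernel_mul_heatWeight {τ s t : ℝ} (hst : s < t) (ht : t ≤ τ) (a x : ℝ) :
    ∫⁻ y, ENNReal.ofReal (heatKernel (t - s) x y) * heatWeight τ a t y = heatWeight τ a s x := by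
  rcases ht.eq_or_lt with rfl | ht
  · simp [heatWeight, hst.ne]
  · have h1 : ∀ r y, Measurable fun z => ENNReal.ofReal (heatKernel r y z) := fun r y =>
      Measurable.comp (f := fun z => (y, z)) (measurable_ofReal_heatKernel r) measurable_prodMk_left
    simp only [heatWeight, ht.ne, (hst.trans ht).ne, if_false]
    have e1 : ∀ y, ENNReal.ofReal (heatKernel (t - s) x y) *
        ∫⁻ z, ENNReal.ofReal (heatKernel (τ - t) y z) * ENNReal.ofReal (Real.exp (a * z)) =
        ∫⁻ z, ENNReal.ofReal (heatKernel (t - s) x y) *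
          (ENNReal.ofReal (heatKernel (τ - t) y z) * ENNReal.ofReal (Real.exp (a * z))) := fun y =>
      (lintegral_const_mul _ ((h1 (τ - t) y).mul (by fun_prop))).symm
    simp_rw [e1]
    rw [lintegral_lintegral_swap]
    · refine lintegral_congr fun z => ?_
      simp_rw [← mul_assoc]
      rw [lintegral_mul_const' _ _ ENNReal.ofReal_ne_top,
        lintegral_heatKernel_mul_heatKernel (sub_pos.2 hst) (sub_pos.2 ht),
        show t - s + (τ - t) = τ - s by ring]
    · have m1 : Measurable fun p : ℝ × ℝ => ENNReal.ofReal (heatKernel (t - s) x p.1) :=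
        Measurable.comp (g := fun y => ENNReal.ofReal (heatKernel (t - s) x y)) (h1 _ _)
          measurable_fst
      have m2 : Measurable fun p : ℝ × ℝ => ENNReal.ofReal (Real.exp (a * p.2)) := by fun_prop
      exact (m1.mul ((measurable_ofReal_heatKernel (τ - t)).mul m2)).aemeasurable

/-- The normalizing constant makes the total mass one. The kernel is symmetric, so the exponents `a`
and `c` may be exchanged with the order of integration. -/
lemma lintegral_exp_mul_heatWeight {τ a c : ℝ} (hτ : 0 < τ) (hac : 0 < a + c) :
    ∫⁻ x, ENNReal.ofReal (1 / normConst τ a c * Real.exp (c * x)) * heatWeight τ a 0 x = 1 := by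
  have hC := normConst_pos hτ hac
  have hi := integrable_exp_mul_heatKernel hτ hac
  have hm : Measurable fun p : ℝ × ℝ => ENNReal.ofReal
      (Real.exp (a * p.1 + c * p.2) * heatKernel τ p.1 p.2) :=
    (Measurable.mul (by fun_prop) (measurable_heatKernel τ)).ennreal_ofReal
  have h1 : ENNReal.ofReal (normConst τ a c) =
      ∫⁻ y, ∫⁻ x, ENNReal.ofReal (Real.exp (a * x + c * y) * heatKernel τ x y) := by
    have e1 : normConst τ a c = ∫ p : ℝ × ℝ, Real.exp (a * p.1 + c * p.2) * heatKernel τ p.1 p.2 := by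
      rw [Measure.volume_eq_prod, integral_prod_symm _ hi]; rfl
    rw [e1, ofReal_integral_eq_lintegral_ofReal hi (.of_forall fun p =>
      mul_nonneg (Real.exp_pos _).le (heatKernel_nonneg hτ _ _)), Measure.volume_eq_prod,
      lintegral_prod_symm _ hm.aemeasurable]
  have h2 : ∀ x, ENNReal.ofReal (1 / normConst τ a c * Real.exp (c * x)) * heatWeight τ a 0 x =
      ENNReal.ofReal (1 / normConst τ a c) *
        ∫⁻ z, ENNReal.ofReal (Real.exp (a * z + c * x) * heatKernel τ z x) := by
    intro x
    have hmz : Measurable fun z => ENNReal.ofReal (heatKernel τ x z) * ENNReal.ofReal (Real.exp (a * z)) :=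
      ((measurable_ofReal_heatKernel τ).comp measurable_prodMk_left).mul (by fun_prop)
    simp only [heatWeight, hτ.ne, if_false, sub_zero]
    rw [ENNReal.ofReal_mul (by positivity), mul_assoc, ← lintegral_const_mul _ hmz]
    congr 1
    refine lintegral_congr fun z => ?_
    rw [heatKernel_comm τ z x, Real.exp_add, ← ENNReal.ofReal_mul (heatKernel_nonneg hτ _ _),
      ← ENNReal.ofReal_mul (Real.exp_pos _).le]
    congr 1; ring
  simp_rw [h2]
  rw [lintegral_const_mul _ (Measurable.lintegral_prod_left' hm), ← h1,
    ← ENNReal.ofReal_mul (by positivity), one_div_mul_cancel hC.ne', ENNReal.ofReal_one]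

/-- The heat kernel, started from the density proportional to `e^{c x}` and weighted by `e^{a x}` at
time `τ`, is a Markov density on `[0, τ]`. -/
lemma isMarkovDensity_heatKernel {τ a c : ℝ} (hτ : 0 < τ) (hac : 0 < a + c) :
    letI := orderBotIcc hτ
    IsMarkovDensity (T := Icc (0 : ℝ) τ)
      (fun x => ENNReal.ofReal (1 / normConst τ a c * Real.exp (c * x)))
      (fun s t x y => ENNReal.ofReal (heatKernel (t - s) x y)) (fun t => heatWeight τ a t) :=
  letI := orderBotIcc hτ
  { measurable_init := by fun_prop
    measurable_kernel := fun s t => measurable_ofReal_heatKernel _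
    measurable_weight := fun t => measurable_heatWeight τ a t
    comp := fun r s t hrs hst x z => by
      rw [lintegral_heatKernel_mul_heatKernel (sub_pos.2 hrs) (sub_pos.2 hst)]
      congr 2; ring
    harmonic := fun s t hst x => lintegral_heatKernel_mul_heatWeight hst t.2.2 a x
    total := lintegral_exp_mul_heatWeight hτ hac
    weight_ne_top := fun t x => heatWeight_ne_top t.2.2 a x }

lemma measurable_jointDensity (τ a c : ℝ) {d : ℕ} (t : Fin (d + 2) → ℝ) :
    Measurable (jointDensity τ a c t) := by
  have h : ∀ k : Fin (d + 1), Measurable fun x : Fin (d + 2) → ℝ =>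
      heatKernel (t k.succ - t k.castSucc) (x k.castSucc) (x k.succ) := fun k =>
    Measurable.comp (f := fun x : Fin (d + 2) → ℝ => (x k.castSucc, x k.succ))
      (measurable_heatKernel _) ((measurable_pi_apply _).prodMk (measurable_pi_apply _))
  exact Measurable.mul (by fun_prop) (Finset.measurable_fun_prod _ fun k _ => h k)

end HeatProcess

end Yakubovich

theorem mainTheorem4 (τ a c : ℝ) (hτ : 0 < τ) (hac : 0 < a + c) :
    (Integrable (fun z : ℝ × ℝ => Real.exp (a * z.1 + c * z.2) * Yakubovich.heatKernel τ z.1 z.2) ∧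
      0 < Yakubovich.normConst τ a c) ∧
    ∃ (Ω : Type) (_ : MeasurableSpace Ω) (P : Measure Ω) (_ : IsProbabilityMeasure P)
      (Y : Set.Icc (0 : ℝ) τ → Ω → ℝ),
      Yakubovich.IsMarkovProcess Y P ∧
      ∀ (d : ℕ) (t : Fin (d + 2) → Set.Icc (0 : ℝ) τ), StrictMono t →
        (t 0 : ℝ) = 0 → (t (Fin.last (d + 1)) : ℝ) = τ →
        Yakubovich.HasDensity (P.map fun ω => fun k => Y (t k) ω)
          (Yakubovich.jointDensity τ a c fun k => (t k : ℝ)) := by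
  refine ⟨⟨Yakubovich.integrable_exp_mul_heatKernel hτ hac, Yakubovich.normConst_pos hτ hac⟩, ?_⟩
  let := Yakubovich.orderBotIcc hτ
  have H := Yakubovich.isMarkovDensity_heatKernel hτ hac
  have hC := Yakubovich.normConst_pos hτ hac
  obtain ⟨P, hprob, hP⟩ := H.exists_measure
  refine ⟨_, _, P, hprob, fun t ω => ω t, H.isMarkovProcess_eval hP, fun d t ht h0 hlast => ?_⟩
  have hpos : ∀ k : Fin (d + 1), (0 : ℝ) < t k.succ - t k.castSucc := fun k =>
    sub_pos.2 (ht Fin.castSucc_lt_succ)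
  have hprod : ∀ x : Fin (d + 2) → ℝ, 0 ≤ ∏ k : Fin (d + 1),
      Yakubovich.heatKernel (t k.succ - t k.castSucc) (x k.castSucc) (x k.succ) := fun x =>
    Finset.prod_nonneg fun k _ => Yakubovich.heatKernel_nonneg (hpos k) _ _
  refine ⟨Yakubovich.measurable_jointDensity τ a c _, fun x => mul_nonneg (by positivity) (hprod x), ?_⟩
  rw [H.map_eq_withDensity hP ht (Subtype.ext h0)]
  congr 1
  ext x
  rw [Yakubovich.heatWeight, if_pos hlast, Yakubovich.jointDensity, Real.exp_add, ← mul_assoc,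
    mul_right_comm, ← ENNReal.ofReal_prod_of_nonneg fun k _ => Yakubovich.heatKernel_nonneg (hpos k) _ _,
    ← ENNReal.ofReal_mul (by positivity), ← ENNReal.ofReal_mul (by positivity)]
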